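/- **Setting.** Let $X$ be a complex Banach space, $I=[0,1]$, $\Delta=\{(s,t)\in I^2: s\le t\}$. An operator-valued map $t\mapsto B(t)\in L(X)$ is called $n$ times strongly continuously differentiable if $t\mapsto B(t)x$ is $n$ times continuously differentiable for every $x\in X$; its derivatives are then again bounded operators. For a set $S\subset\mathbb C$, $B_r(S)$ and $\overline B_r(S)$ denote the points with distance $<r$, respectively $\le r$, from $S$. For a family $A$ of densely defined operators $A(t):D(A(t))\subset X\to X$ ($t\in I$), an *evolution system for $A$ on $D(A(t))$* is a family of $U(t,s)\in L(X)$, $(s,t)\in\Delta$, such that for all $s\in[0,1)$, $y\in D(A(s))$ the map $[s,1]\ni t\mapsto x(t)=U(t,s)y$ is continuously differentiable with $x(t)\in D(A(t))$, $x'(t)=A(t)x(t)$, $x(s)=y$, and such that $U(t,s)U(s,r)=U(t,r)$ and $(s,t)\mapsto U(t,s)x$ is continuous on $\Delta$ for every $x\in X$. We write $U(t)=U(t,0)$. It is *adiabatic w.r.t.* a family $P$ of bounded projections if $P(t)U(t,s)=U(t,s)P(s)$ for all $(s,t)\in\Delta$. A bounded projection $P$ is *associated with* a closed operator $A$ and a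 nonempty compact isolated subset $\sigma\subset\sigma(A)$ if $PA\subset AP$, $PD(A)=PX$, $\sigma(A|_{PD(A)})=\sigma$ and $\sigma(A|_{(1-P)D(A)})=\sigma(A)\setminus\sigma$ (the restrictions being operators in $PX$ and $(1-P)X$). **Assumption 1.** $A(t):D(A(t))\subset X\to X$ is densely defined and closed for every $t\in I$; for every $\varepsilon\in(0,\infty)$ the evolution system $U_\varepsilon$ for $\frac1\varepsilon A$ on $D(A(t))$ exists; and there is $M\ge1$ with $\|U_\varepsilon(t,s)\|\le M$ for all $(s,t)\in\Delta$, $\varepsilon>0$. **Assumption 2 (degree of regularity $n\in\{1,2,\dots\}\cup\{\infty\}$).** $\sigma(t)$ is, for every $t\in I$, a nonempty compact subset of $\sigma(A(t))$, there is $r_0>0$ with $B_{r_0}(\sigma(t))\setminus\sigma(t)\subset\rho(A(t))$ for all $t\in I$, and $t\mapsto\sigma(t)$ is continuous (in the Hausdorff distance). For every $t_0\in I$ there are given a cycle $\gamma_{t_0}$ (piecewise $C^1$) in $\overline B_{4r_0/7}(\sigma(t_0))\setminus B_{3r_0/7}(\sigma(t_0))$ with index $1$ around every point of $B_{3r_0/7}(\sigma(t_0))$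 and index $0$ around every point of $\mathbb C\setminus\overline B_{4r_0/7}(\sigma(t_0))$, and a nontrivial closed interval $J_{t_0}\subset I$ that is a neighbourhood of $t_0$ in $I$, with $\sigma(t)\subset B_{r_0/7}(\sigma(t_0))$ and $\sigma(t_0)\subset B_{r_0/7}(\sigma(t))$ for $t\in J_{t_0}$. $P(t)$ is the projection associated with $A(t)$ and $\sigma(t)$ for every $t\in I$, and $t\mapsto P(t)$ is $n+1$ times strongly continuously differentiable on $I$. For every $t_0\in I$, $J_{t_0}\ni t\mapsto (z-A(t))^{-1}$ is $n$ times strongly continuously differentiable for every $z\in\operatorname{ran}\gamma_{t_0}$, the map $\operatorname{ran}\gamma_{t_0}\ni z\mapsto \frac{d^l}{dt^l}(z-A(t))^{-1}$ is strongly continuous for all $t\in J_{t_0}$ and integers $1\le l\le n$, and there are constants $a_{t_0},b_{t_0},c_{t_0}>0$ with $$\sup_{(t,z)\in J_{t_0}\times\operatorname{ran}\gamma_{t_0}}\Big\|\tfrac{d^l}{dt^l}(z-A(t))^{-1}\Big\|\le a_{t_0}c_{t_0}^l\frac{l!}{(1+l)^2}\ (1\le l\le n),\qquad \sup_{t\in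 J_{t_0}}\Big\|\tfrac{d^l}{dt^l}[P'(t),P(t)]\Big\|\le b_{t_0}c_{t_0}^l\frac{l!}{(1+l)^2}\ (0\le l\le n),$$ where $l$ runs through the integers (all of them if $n=\infty$). **Iteration of Joye and Pfister.** For $\varepsilon>0$ put $A_{0\,\varepsilon}=A$ and, successively for $k=0,1,2,\dots$, $$P_{k\,\varepsilon}(t)=\frac1{2\pi i}\int_{\gamma_t}(z-A_{k\,\varepsilon}(t))^{-1}dz,\qquad K_{k\,\varepsilon}(t)=[P_{k\,\varepsilon}'(t),P_{k\,\varepsilon}(t)],\qquad A_{k+1\,\varepsilon}(t)=A(t)-\varepsilon K_{k\,\varepsilon}(t).$$ $A_{k\,\varepsilon},P_{k\,\varepsilon},K_{k\,\varepsilon}$ are called *well-defined* if for every $j\le k$ one has $\operatorname{ran}\gamma_t\subset\rho(A_{j\,\varepsilon}(t))$ for all $t\in I$ and $t\mapsto P_{j\,\varepsilon}(t)$ is strongly continuously differentiable on $I$. **Theorem.** Let Assumption 1 hold, and let Assumption 2 hold for a finite $n\ge1$, or for $n=\infty$, respectively. Then there is $\varepsilon^*>0$ and, in case $n=\infty$,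 there is moreover $\kappa>0$ such that $n^*(\varepsilon):=\lfloor 1/(\kappa\varepsilon)\rfloor\ge1$ for all $\varepsilon\in(0,\varepsilon^*]$, and there is $g\in(0,\infty)$, such that the following holds. Put $k_\varepsilon:=n$ if $n$ is finite and $k_\varepsilon:=n^*(\varepsilon)$ if $n=\infty$. Then $A_{k_\varepsilon\,\varepsilon},P_{k_\varepsilon\,\varepsilon},K_{k_\varepsilon\,\varepsilon}$ are well-defined for all $\varepsilon\in(0,\varepsilon^*]$, and, with $P_\varepsilon:=P_{k_\varepsilon\,\varepsilon}$: (i) $\sup_{t\in I}\|P_\varepsilon(t)-P(t)\|=O(\varepsilon)$ as $\varepsilon\searrow0$. (ii) For $\varepsilon\in(0,\varepsilon^*]$, whenever an evolution system $V_\varepsilon$ for $\frac1\varepsilon A_{k_\varepsilon\,\varepsilon}+K_{k_\varepsilon\,\varepsilon}$ on $D(A(t))$ exists, $V_\varepsilon$ is adiabatic w.r.t. $P_\varepsilon$, and $\sup_{t\in I}\|V_\varepsilon(t)-U_\varepsilon(t)\|=O(\varepsilon^n)$, respectively $O(e^{-g/\varepsilon})$. (iii) Irrespective of the existence of $V_\varepsilon$,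 both $\sup_{t\in I}\|(1-P_\varepsilon(t))U_\varepsilon(t)P_\varepsilon(0)\|$ and $\sup_{t\in I}\|P_\varepsilon(t)U_\varepsilon(t)(1-P_\varepsilon(0))\|$ are $O(\varepsilon^n)$, respectively $O(e^{-g/\varepsilon})$. All $O$-bounds hold on $(0,\varepsilon^*]$ with a constant that does not depend on $t$, $\varepsilon$ or $V_\varepsilon$. -/

import Mathlib

open Set Filter Topology

namespace Adiabatic

noncomputable section

/-! ### Unbounded operators: resolvent set, resolvent, spectrum, parts -/

section Operators

variable {X : Type*} [NormedAddCommGroup X] [NormedSpace ℂ X]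

/-- `R` is a bounded two-sided inverse of `z - A : D(A) → X`. -/
def IsResolventAt (A : X →ₗ.[ℂ] X) (z : ℂ) (R : X →L[ℂ] X) : Prop :=
  (∀ y : X, ∃ h : R y ∈ A.domain, z • R y - A ⟨R y, h⟩ = y) ∧
    ∀ x : A.domain, R (z • (x : X) - A x) = x

/-- The resolvent set `ρ(A)`. -/
def resolventSet (A : X →ₗ.[ℂ] X) : Set ℂ := {z | ∃ R : X →L[ℂ] X, IsResolventAt A z R}

/-- The spectrum `σ(A)`. -/
def spectrum (A : X →ₗ.[ℂ] X) : Set ℂ := (resolventSet A)ᶜ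

/-- The resolvent `(z - A)⁻¹`; it is meaningful for `z ∈ ρ(A)` and `0` by convention otherwise. -/
def resolvent (A : X →ₗ.[ℂ] X) (z : ℂ) : X →L[ℂ] X :=
  open Classical in if h : ∃ R : X →L[ℂ] X, IsResolventAt A z R then h.choose else 0

theorem IsResolventAt.unique {A : X →ₗ.[ℂ] X} {z : ℂ} {R S : X →L[ℂ] X}
    (hR : IsResolventAt A z R) (hS : IsResolventAt A z S) : R = S := by
  ext y
  obtain ⟨h, hy⟩ := hR.1 y
  have := hS.2 ⟨R y, h⟩
  rw [hy] at this
  exact this.symm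

theorem IsResolventAt.resolvent_eq {A : X →ₗ.[ℂ] X} {z : ℂ} {R : X →L[ℂ] X}
    (hR : IsResolventAt A z R) : resolvent A z = R := by
  have h : ∃ R : X →L[ℂ] X, IsResolventAt A z R := ⟨R, hR⟩
  rw [resolvent, dif_pos h]
  exact h.choose_spec.unique hR

/-- The part of `A` in the subspace `M`: its domain is `{y ∈ M ∩ D(A) : A y ∈ M}`. If `P` is a
projection commuting with `A` and `M = P X`, this domain is `P D(A)`. -/
def partIn (A : X →ₗ.[ℂ] X) (M : Submodule ℂ X) : M →ₗ.[ℂ] M where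
  domain :=
    { carrier := {y | ∃ h : (y : X) ∈ A.domain, A ⟨y, h⟩ ∈ M}
      zero_mem' := ⟨A.domain.zero_mem, by
        have : A ⟨((0 : M) : X), A.domain.zero_mem⟩ = 0 := A.map_zero
        rw [this]; exact M.zero_mem⟩
      add_mem' := by
        rintro a b ⟨ha, ha'⟩ ⟨hb, hb'⟩
        refine ⟨A.domain.add_mem ha hb, ?_⟩
        have : A ⟨((a + b : M) : X), A.domain.add_mem ha hb⟩ = A ⟨a, ha⟩ + A ⟨b, hb⟩ :=
          A.map_add ⟨a, ha⟩ ⟨b, hb⟩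
        rw [this]; exact M.add_mem ha' hb'
      smul_mem' := by
        rintro c a ⟨ha, ha'⟩
        refine ⟨A.domain.smul_mem c ha, ?_⟩
        have : A ⟨((c • a : M) : X), A.domain.smul_mem c ha⟩ = c • A ⟨a, ha⟩ :=
          A.map_smul c ⟨a, ha⟩
        rw [this]; exact M.smul_mem c ha' }
  toFun :=
    { toFun := fun y => ⟨A ⟨(y : M), y.2.choose⟩, y.2.choose_spec⟩
      map_add' := fun a b => Subtype.ext <|
        A.map_add ⟨((a : M) : X), a.2.choose⟩ ⟨((b : M) : X), b.2.choose⟩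
      map_smul' := fun c a => Subtype.ext <| A.map_smul c ⟨((a : M) : X), a.2.choose⟩ }

/-- The bounded projection `P` is associated with `A` and `σ`: `P A ⊆ A P`, `P D(A) = P X`, and the
restrictions of `A` to `P D(A)` and `(1 - P) D(A)`, operators in the Banach spaces `P X` and
`(1 - P) X`, have the spectra `σ` and `σ(A) \ σ`. -/
structure IsAssociatedProjection (A : X →ₗ.[ℂ] X) (σ : Set ℂ) (P : X →L[ℂ] X) : Prop where
  isProj : IsIdempotentElem P
  commutes : ∀ x : A.domain, ∃ h : P x ∈ A.domain, A ⟨P x, h⟩ = P (A x)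
  map_domain : A.domain.map (P : X →ₗ[ℂ] X) = (P : X →ₗ[ℂ] X).range
  spectrum_range : spectrum (partIn A (P : X →ₗ[ℂ] X).range) = σ
  spectrum_compl :
    spectrum (partIn A ((1 - P : X →L[ℂ] X) : X →ₗ[ℂ] X).range) = spectrum A \ σ

/-- The operator `A + B` on `D(A)`, for a bounded operator `B`. -/
def addBdd (A : X →ₗ.[ℂ] X) (B : X →L[ℂ] X) : X →ₗ.[ℂ] X := (B : X →ₗ[ℂ] X) +ᵥ A

end Operators

/-! ### Cycles in the complex plane -/

/-- A closed piecewise continuously differentiable path in `ℂ`, parametrized by `[0, 1]`. -/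
structure ClosedPath where
  base : ℂ
  path : Path base base
  piecewiseC1 : ∃ (N : ℕ) (p : ℕ → ℝ), Monotone p ∧ p 0 = 0 ∧ p N = 1 ∧
    ∀ i < N, ContDiffOn ℝ 1 path.extend (Icc (p i) (p (i + 1)))

/-- A cycle in `ℂ`: a formal finite sum of closed paths with integer multiplicities. -/
abbrev Cycle := ClosedPath →₀ ℤ

namespace Cycle

/-- The set of all points on the paths of the cycle. -/
def ran (γ : Cycle) : Set ℂ := ⋃ κ ∈ γ.support, range κ.path

/-- The contour integral `∫_γ f(z) dz`. -/
def integral {F : Type*} [NormedAddCommGroup F] [NormedSpace ℂ F] (γ : Cycle) (f : ℂ → F) : F :=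
  γ.sum fun κ m => (m : ℂ) • ∫ᶜ z in κ.path, ContinuousLinearMap.toSpanSingleton ℂ (f z)

/-- The index (winding number) `n(γ, w)` of a cycle around a point `w ∉ ran γ`. -/
def index (γ : Cycle) (w : ℂ) : ℂ :=
  (2 * Real.pi * Complex.I)⁻¹ * γ.integral fun z => (z - w)⁻¹

end Cycle

/-! ### Strong differentiability and evolution systems on `I = [0, 1]` -/

section Evolution

variable {X : Type*} [NormedAddCommGroup X] [NormedSpace ℂ X]

/-- `t ↦ B(t)` is `n` times strongly continuously differentiable on `S`. -/
def StrongContDiffOn (n : ℕ∞) (B : ℝ → X →L[ℂ] X) (S : Set ℝ) : Prop :=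
  ∀ x : X, ContDiffOn ℝ n (fun t => B t x) S

/-- The `l`-th strong derivative at `t` of the operator function `B` on `S` has norm at
most `c`. -/
def StrongDerivBound (l : ℕ) (B : ℝ → X →L[ℂ] X) (S : Set ℝ) (t c : ℝ) : Prop :=
  ∀ x : X, ‖iteratedDerivWithin l (fun s => B s x) S t‖ ≤ c * ‖x‖

/-- The strong derivative `B'(t)` of an operator function on `[0, 1]` (`0` by convention where it
does not exist as a bounded operator). -/
def strongDeriv (B : ℝ → X →L[ℂ] X) (t : ℝ) : X →L[ℂ] X :=
  open Classical in
  if h : ∃ T : X →L[ℂ] X, ∀ x, HasDerivWithinAt (fun s => B s x) (T x) (Icc 0 1) t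
  then h.choose else 0

/-- The commutator `[P'(t), P(t)]`. -/
def derivComm (P : ℝ → X →L[ℂ] X) (t : ℝ) : X →L[ℂ] X :=
  strongDeriv P t * P t - P t * strongDeriv P t

/-- `U` is an evolution system for the family `A` on the spaces `D(A(t))`, `t ∈ [0, 1]`;
the operator `U t s` is considered for `0 ≤ s ≤ t ≤ 1`. -/
structure IsEvolutionSystem (A : ℝ → X →ₗ.[ℂ] X) (U : ℝ → ℝ → X →L[ℂ] X) : Prop where
  initial : ∀ s ∈ Ico (0 : ℝ) 1, ∀ y ∈ (A s).domain, U s s y = y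
  contDiff : ∀ s ∈ Ico (0 : ℝ) 1, ∀ y ∈ (A s).domain,
    ContDiffOn ℝ 1 (fun t => U t s y) (Icc s 1)
  solves : ∀ s ∈ Ico (0 : ℝ) 1, ∀ y ∈ (A s).domain, ∀ t ∈ Icc s 1,
    ∃ h : U t s y ∈ (A t).domain,
      HasDerivWithinAt (fun τ => U τ s y) (A t ⟨U t s y, h⟩) (Icc s 1) t
  cocycle : ∀ r s t : ℝ, 0 ≤ r → r ≤ s → s ≤ t → t ≤ 1 → U t s * U s r = U t r
  continuous : ∀ x : X,
    ContinuousOn (fun p : ℝ × ℝ => U p.2 p.1 x) {p | 0 ≤ p.1 ∧ p.1 ≤ p.2 ∧ p.2 ≤ 1}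

/-- The evolution `U` is adiabatic with respect to the family `P` of bounded projections. -/
def IsAdiabatic (U : ℝ → ℝ → X →L[ℂ] X) (P : ℝ → X →L[ℂ] X) : Prop :=
  (∀ t ∈ Icc (0 : ℝ) 1, IsIdempotentElem (P t)) ∧
    ∀ s t : ℝ, 0 ≤ s → s ≤ t → t ≤ 1 → P t * U t s = U t s * P s

/-- `A(t)`, `t ∈ [0, 1]`, are densely defined closed operators, `U ε` is the evolution system for
`(1/ε) A` on the spaces `D(A(t))` for every `ε > 0`, and all these evolutions have a common
bound. -/
structure EvolutionCondition (A : ℝ → X →ₗ.[ℂ] X) (U : ℝ → ℝ → ℝ → X →L[ℂ] X) : Prop where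
  dense : ∀ t ∈ Icc (0 : ℝ) 1, Dense ((A t).domain : Set X)
  closed : ∀ t ∈ Icc (0 : ℝ) 1, (A t).IsClosed
  evolution : ∀ ε : ℝ, 0 < ε → IsEvolutionSystem (fun t => ((ε⁻¹ : ℝ) : ℂ) • A t) (U ε)
  bounded : ∃ M : ℝ, 1 ≤ M ∧ ∀ ε : ℝ, 0 < ε → ∀ s t : ℝ, 0 ≤ s → s ≤ t → t ≤ 1 → ‖U ε t s‖ ≤ M

end Evolution

/-! ### The iterative scheme of Joye and Pfister -/

section Iteration

variable {X : Type*} [NormedAddCommGroup X] [NormedSpace ℂ X]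

/-- `(2πi)⁻¹ ∫_{γ t} (z - A(t))⁻¹ dz`. -/
def rieszIntegral (γ : ℝ → Cycle) (A : ℝ → X →ₗ.[ℂ] X) (t : ℝ) : X →L[ℂ] X :=
  (2 * Real.pi * Complex.I : ℂ)⁻¹ • (γ t).integral (resolvent (A t))

/-- `A_{0 ε} = A` and `A_{k+1 ε} = A - ε K_{k ε}`, where `K_{k ε} = [P_{k ε}', P_{k ε}]` and
`P_{k ε}` is the contour integral of the resolvent of `A_{k ε}`. -/
def iterA (γ : ℝ → Cycle) (A : ℝ → X →ₗ.[ℂ] X) (ε : ℝ) : ℕ → ℝ → X →ₗ.[ℂ] X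
  | 0 => A
  | k + 1 => fun t =>
      addBdd (A t) (-((ε : ℂ) • derivComm (rieszIntegral γ (iterA γ A ε k)) t))

/-- The operators `P_{k ε}(t)`. -/
def iterP (γ : ℝ → Cycle) (A : ℝ → X →ₗ.[ℂ] X) (ε : ℝ) (k : ℕ) : ℝ → X →L[ℂ] X :=
  rieszIntegral γ (iterA γ A ε k)

/-- The operators `K_{k ε}(t) = [P_{k ε}'(t), P_{k ε}(t)]`. -/
def iterK (γ : ℝ → Cycle) (A : ℝ → X →ₗ.[ℂ] X) (ε : ℝ) (k : ℕ) : ℝ → X →L[ℂ] X :=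
  derivComm (iterP γ A ε k)

/-- `A_{k ε}`, `P_{k ε}`, `K_{k ε}` are well-defined with respect to `γ t`, `t ∈ [0, 1]`: at every
level `j ≤ k` the cycles lie in the resolvent sets and `P_{j ε}` is strongly continuously
differentiable. -/
def IterWellDefined (γ : ℝ → Cycle) (A : ℝ → X →ₗ.[ℂ] X) (ε : ℝ) (k : ℕ) : Prop :=
  ∀ j ≤ k, (∀ t ∈ Icc (0 : ℝ) 1, (γ t).ran ⊆ resolventSet (iterA γ A ε j t)) ∧
    StrongContDiffOn 1 (iterP γ A ε j) (Icc 0 1)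

end Iteration

/-! ### The regularity condition of degree `n` -/

section Condition

variable {X : Type*} [NormedAddCommGroup X] [NormedSpace ℂ X]

open Metric in
/-- The regularity condition of degree `n ∈ ℕ ∪ {∞}` for the operators `A(t)`, the spectral sets
`σ(t)` and the projections `P(t)`, `t ∈ [0, 1]`, with gap `r₀`, cycles `γ t` and intervals `J t`. -/
structure HigherOrderCondition (n : ℕ∞) (A : ℝ → X →ₗ.[ℂ] X) (σ : ℝ → Set ℂ)
    (P : ℝ → X →L[ℂ] X) (r₀ : ℝ) (γ : ℝ → Cycle) (J : ℝ → Set ℝ) : Prop where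
  dense : ∀ t ∈ Icc (0 : ℝ) 1, Dense ((A t).domain : Set X)
  closed : ∀ t ∈ Icc (0 : ℝ) 1, (A t).IsClosed
  /-- `σ(t)` is a nonempty compact subset of `σ(A(t))`, uniformly isolated in it. -/
  nonempty : ∀ t ∈ Icc (0 : ℝ) 1, (σ t).Nonempty
  compact : ∀ t ∈ Icc (0 : ℝ) 1, IsCompact (σ t)
  subset_spectrum : ∀ t ∈ Icc (0 : ℝ) 1, σ t ⊆ spectrum (A t)
  gap_pos : 0 < r₀
  gap : ∀ t ∈ Icc (0 : ℝ) 1, thickening r₀ (σ t) \ σ t ⊆ resolventSet (A t)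
  /-- `σ(·)` is continuous with respect to the Hausdorff distance. -/
  continuous : ∀ t ∈ Icc (0 : ℝ) 1, ∀ δ > 0, ∀ᶠ s in 𝓝[Icc 0 1] t,
    σ s ⊆ thickening δ (σ t) ∧ σ t ⊆ thickening δ (σ s)
  /-- The cycle `γ t` runs in a closed annular region around `σ(t)` and surrounds `σ(t)` once. -/
  cycle_ran : ∀ t ∈ Icc (0 : ℝ) 1,
    (γ t).ran ⊆ cthickening (4 * r₀ / 7) (σ t) \ thickening (3 * r₀ / 7) (σ t)
  cycle_index_one : ∀ t ∈ Icc (0 : ℝ) 1, ∀ w ∈ thickening (3 * r₀ / 7) (σ t), (γ t).index w = 1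
  cycle_index_zero : ∀ t ∈ Icc (0 : ℝ) 1, ∀ w ∉ cthickening (4 * r₀ / 7) (σ t), (γ t).index w = 0
  /-- `J t` is a nontrivial closed interval in `[0, 1]`, a neighbourhood of `t` in `[0, 1]`, on
  which `σ(·)` is close to `σ(t)`. -/
  interval : ∀ t ∈ Icc (0 : ℝ) 1, ∃ u v : ℝ, u < v ∧ J t = Icc u v
  interval_subset : ∀ t ∈ Icc (0 : ℝ) 1, J t ⊆ Icc 0 1
  interval_nhds : ∀ t ∈ Icc (0 : ℝ) 1, J t ∈ 𝓝[Icc 0 1] t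
  interval_close : ∀ t₀ ∈ Icc (0 : ℝ) 1, ∀ t ∈ J t₀,
    σ t ⊆ thickening (r₀ / 7) (σ t₀) ∧ σ t₀ ⊆ thickening (r₀ / 7) (σ t)
  resolvent_contDiff : ∀ t₀ ∈ Icc (0 : ℝ) 1, ∀ z ∈ (γ t₀).ran,
    StrongContDiffOn n (fun t => resolvent (A t) z) (J t₀)
  resolvent_deriv_continuous : ∀ t₀ ∈ Icc (0 : ℝ) 1, ∀ t ∈ J t₀, ∀ l : ℕ, 1 ≤ l → (l : ℕ∞) ≤ n →
    ∀ x : X, ContinuousOn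
      (fun z => iteratedDerivWithin l (fun s => resolvent (A s) z x) (J t₀) t) (γ t₀).ran
  projection : ∀ t ∈ Icc (0 : ℝ) 1, IsAssociatedProjection (A t) (σ t) (P t)
  projection_contDiff : StrongContDiffOn (n + 1) P (Icc 0 1)
  /-- The bounds on the derivatives of the resolvent and of `[P', P]`. -/
  bounds : ∀ t₀ ∈ Icc (0 : ℝ) 1, ∃ a b c : ℝ, 0 < a ∧ 0 < b ∧ 0 < c ∧
    (∀ l : ℕ, 1 ≤ l → (l : ℕ∞) ≤ n → ∀ t ∈ J t₀, ∀ z ∈ (γ t₀).ran,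
      StrongDerivBound l (fun s => resolvent (A s) z) (J t₀) t
        (a * c ^ l * (l.factorial / (1 + l) ^ 2))) ∧
    (∀ l : ℕ, (l : ℕ∞) ≤ n → ∀ t ∈ J t₀,
      StrongDerivBound l (derivComm P) (Icc 0 1) t
        (b * c ^ l * (l.factorial / (1 + l) ^ 2)))

end Condition

end

end Adiabatic

open Adiabatic

/-!
# Superadiabatic approximation by the iteration of Joye and Pfister

If `Q(t)` are projections commuting with generators `B(t)`, then `Q' = [[Q', Q], Q]`, so that the
evolution generated by `B + [Q', Q]` is adiabatic with respect to `Q`. Applied to `B = ε⁻¹ A_{n ε}`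
and `Q = P_{n ε}`, the generator is `ε⁻¹ A + (K_{n ε} - K_{n-1 ε})`: it differs from that of `U_ε` by
the bounded operator `Δ_n = K_{n ε} - K_{n-1 ε}`, and by Duhamel's principle
(`IsEvolutionSystem.norm_intertwine_le`) all the errors are bounded by a constant times `sup ‖Δ_n‖`.
In this way `IterationData.adiabatic` reduces the theorem to the estimate
`‖Δ_n(t)‖ ≤ b (θ ε) ^ n * n!`, in which `θ` does not depend on `n` or `ε`. For fixed `n` this is
`O(ε ^ n)`; for `n = ⌊1 / (κ ε)⌋` with `κ` large compared to `θ` it is exponentially small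
(`pow_mul_factorial_le_exp`).

The estimate is proved by induction on `k` for `Δ_k` and its strong derivatives up to order `n - k`
(`IterationData.jet_prevK_sub`): the `l`-th derivative is bounded by
`b (θ ε) ^ k * c ^ l * (k + l)! / (1 + l) ^ 2`. The predicate `StrongJet` records such bounds. The
factor `(1 + l)⁻²` makes them submultiplicative under the Leibniz rule, up to the constant `8`
(`binomConv_weight_le`), and a derivative turns the weight for `k` into the one for `k + 1`
(`weight_succ_le`). The differences of the resolvents, hence of the projections, are controlled by
`ε Δ_k` through the second resolvent identity (`IterationData.jet_cauchy_sub`), and `Δ_{k+1}` is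
obtained from the projections by one differentiation (`StrongJet.derivComm_sub`). As long as
`θ ε n ≤ 1 / 2`, summation over `k` shows that all `K_{k ε}` stay bounded, so that the resolvents of
`A_{k ε}` exist, and remain controlled, on the cycles (`LocalData.jet_perturbed`).

The cycles `γ t` change with `t` without any regularity. Locally they may be replaced by a fixed
one, because a contour integral of the resolvent depends only on the way in which the cycle
separates the spectrum (`SeparatesSpectrum.cauchy_eq`). This, the idempotence of the Riesz integral
and its equality with the associated projection follow from one application of Liouville's theorem,
`mul_eq_zero_of_extends`, which avoids the theorem of Cauchy for general cycles.
-/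

namespace Adiabatic

noncomputable section

/-! ### Resolvents: identities, perturbation, holomorphy -/

section Resolvent

variable {X : Type*} [NormedAddCommGroup X] [NormedSpace ℂ X]

theorem isResolventAt_resolvent {A : X →ₗ.[ℂ] X} {z : ℂ} (h : z ∈ resolventSet A) :
    IsResolventAt A z (resolvent A z) := by
  obtain ⟨R, hR⟩ := h
  rwa [hR.resolvent_eq]

theorem IsResolventAt.mem {A : X →ₗ.[ℂ] X} {z : ℂ} {R : X →L[ℂ] X} (h : IsResolventAt A z R) :
    z ∈ resolventSet A := ⟨R, h⟩

/-- `x ∈ D(A)` and `A x = v`: membership of `(x, v)` in the graph of `A`. -/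
def Acts (A : X →ₗ.[ℂ] X) (x v : X) : Prop := ∃ h : x ∈ A.domain, A ⟨x, h⟩ = v

theorem Acts.unique {A : X →ₗ.[ℂ] X} {x v w : X} (hv : Acts A x v) (hw : Acts A x w) : v = w := by
  obtain ⟨h, rfl⟩ := hv
  obtain ⟨_, rfl⟩ := hw
  rfl

theorem acts_addBdd {A : X →ₗ.[ℂ] X} {B : X →L[ℂ] X} {x v : X} :
    Acts (addBdd A B) x v ↔ Acts A x (v - B x) := by
  constructor
  · rintro ⟨h, rfl⟩
    refine ⟨h, ?_⟩
    change _ = (B x + A ⟨x, h⟩) - B x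
    abel
  · rintro ⟨h, e⟩
    refine ⟨h, ?_⟩
    change B x + A ⟨x, h⟩ = v
    rw [e]; abel

theorem acts_smul {A : X →ₗ.[ℂ] X} {c : ℂ} {x v : X} (h : Acts A x v) : Acts (c • A) x (c • v) := by
  obtain ⟨h, rfl⟩ := h
  exact ⟨h, rfl⟩

theorem acts_of_smul {A : X →ₗ.[ℂ] X} {c : ℂ} {x v : X} (hc : c ≠ 0) (h : Acts (c • A) x v) :
    Acts A x (c⁻¹ • v) := by
  obtain ⟨h, rfl⟩ := h
  refine ⟨h, ?_⟩
  change _ = c⁻¹ • (c • A ⟨x, h⟩)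
  rw [inv_smul_smul₀ hc]

theorem isResolventAt_iff_acts {A : X →ₗ.[ℂ] X} {z : ℂ} {R : X →L[ℂ] X} :
    IsResolventAt A z R ↔
      (∀ y, Acts A (R y) (z • R y - y)) ∧ ∀ x v, Acts A x v → R (z • x - v) = x := by
  constructor
  · rintro ⟨h1, h2⟩
    refine ⟨fun y => ?_, ?_⟩
    · obtain ⟨h, hy⟩ := h1 y
      exact ⟨h, eq_sub_iff_add_eq.2 (sub_eq_iff_eq_add'.1 hy).symm⟩
    · rintro x v ⟨h, rfl⟩
      exact h2 ⟨x, h⟩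
  · rintro ⟨h1, h2⟩
    refine ⟨fun y => ?_, fun x => h2 x _ ⟨x.2, rfl⟩⟩
    obtain ⟨h, hy⟩ := h1 y
    exact ⟨h, by rw [hy]; simp⟩

theorem IsResolventAt.injective {A : X →ₗ.[ℂ] X} {z : ℂ} {R : X →L[ℂ] X}
    (h : IsResolventAt A z R) {y : X} (hy : R y = 0) : y = 0 := by
  have h1 := (isResolventAt_iff_acts.1 h).1 y
  rw [hy] at h1
  have h2 : Acts A 0 0 := ⟨A.domain.zero_mem, A.map_zero⟩
  simpa using h1.unique h2

theorem addBdd_zero (A : X →ₗ.[ℂ] X) : addBdd A 0 = A := by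
  unfold addBdd
  simp

/-- The second resolvent identity, for two bounded perturbations of the same operator. -/
theorem resolvent_addBdd_sub {A : X →ₗ.[ℂ] X} {B C R S : X →L[ℂ] X} {z : ℂ}
    (hR : IsResolventAt (addBdd A B) z R) (hS : IsResolventAt (addBdd A C) z S) :
    R - S = R * (B - C) * S := by
  ext y
  have h1 := acts_addBdd.1 ((isResolventAt_iff_acts.1 hS).1 y)
  have h2 := (isResolventAt_iff_acts.1 hR).2 (S y) (z • S y - y - C (S y) + B (S y))
    (acts_addBdd.2 (by simpa using h1))
  have e : y = (z • S y - (z • S y - y - C (S y) + B (S y))) + (B - C) (S y) := by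
    rw [sub_apply]
    abel
  have h3 : R y = S y + R ((B - C) (S y)) := by
    conv_lhs => rw [e]
    rw [map_add, h2]
  simp [h3]

theorem isResolventAt_addBdd_smul_one {A : X →ₗ.[ℂ] X} {z s : ℂ} {R : X →L[ℂ] X} :
    IsResolventAt (addBdd A (s • 1)) z R ↔ IsResolventAt A (z - s) R := by
  rw [isResolventAt_iff_acts, isResolventAt_iff_acts]
  constructor
  · rintro ⟨h1, h2⟩
    refine ⟨fun y => ?_, fun x v hx => ?_⟩
    · convert acts_addBdd.1 (h1 y) using 1
      simp [sub_smul]; abel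
    · have := h2 x (v + s • x) (acts_addBdd.2 (by simpa using hx))
      convert this using 2
      rw [sub_smul]; abel
  · rintro ⟨h1, h2⟩
    refine ⟨fun y => acts_addBdd.2 ?_, fun x v hx => ?_⟩
    · convert h1 y using 1
      simp [sub_smul]; abel
    · have := h2 x _ (acts_addBdd.1 hx)
      convert this using 2
      simp [sub_smul]

/-- The first resolvent identity. -/
theorem resolvent_sub {A : X →ₗ.[ℂ] X} {z w : ℂ} {R S : X →L[ℂ] X}
    (hR : IsResolventAt A z R) (hS : IsResolventAt A w S) : R - S = (w - z) • (R * S) := by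
  have h1 : IsResolventAt (addBdd A ((w - z) • 1)) w R := by
    rw [isResolventAt_addBdd_smul_one]; simpa using hR
  have h2 : IsResolventAt (addBdd A 0) w S := by rwa [addBdd_zero]
  rw [resolvent_addBdd_sub h1 h2]
  ext y
  simp

theorem resolvent_commute {A : X →ₗ.[ℂ] X} {z w : ℂ} (hz : z ∈ resolventSet A)
    (hw : w ∈ resolventSet A) : Commute (resolvent A z) (resolvent A w) := by
  rcases eq_or_ne z w with rfl | hne
  · exact Commute.refl _
  have h1 := resolvent_sub (isResolventAt_resolvent hz) (isResolventAt_resolvent hw)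
  have h2 := resolvent_sub (isResolventAt_resolvent hw) (isResolventAt_resolvent hz)
  have h3 : (w - z) • (resolvent A z * resolvent A w) =
      (w - z) • (resolvent A w * resolvent A z) := by
    rw [← h1, ← neg_sub (resolvent A w), h2, ← neg_smul, neg_sub]
  exact smul_right_injective _ (sub_ne_zero.2 hne.symm) h3

/-- `z - (A + B) = (1 - B R) (z - A)`, so an inverse of `1 - B R` gives the resolvent of
`A + B`. -/
theorem IsResolventAt.addBdd {A : X →ₗ.[ℂ] X} {z : ℂ} {R B G : X →L[ℂ] X}
    (hR : IsResolventAt A z R) (h1 : (1 - B * R) * G = 1) (h2 : G * (1 - B * R) = 1) :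
    IsResolventAt (addBdd A B) z (R * G) := by
  rw [isResolventAt_iff_acts] at hR ⊢
  refine ⟨fun y => acts_addBdd.2 ?_, fun x v hx => ?_⟩
  · have e : G y - B (R (G y)) = y := by
      simpa using congrArg (fun T : X →L[ℂ] X => T y) h1
    have e' : z • (R * G) y - y - B ((R * G) y) = z • R (G y) - G y := by
      change z • R (G y) - y - B (R (G y)) = _
      rw [sub_sub, sub_right_inj]
      exact (sub_eq_iff_eq_add.1 e).symm
    rw [e']
    exact hR.1 (G y)
  · have hx' := hR.2 x _ (acts_addBdd.1 hx)
    set u := z • x - (v - B x) with hu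
    have e : G (u - B (R u)) = u := by
      simpa using congrArg (fun T : X →L[ℂ] X => T u) h2
    have e2 : z • x - v = u - B (R u) := by
      rw [hx', hu]
      abel
    rw [e2]
    change R (G _) = x
    rw [e, hx']

theorem exists_inverse_one_sub [CompleteSpace X] {T : X →L[ℂ] X} (hT : ‖T‖ ≤ 1 / 2) :
    ∃ G : X →L[ℂ] X, (1 - T) * G = 1 ∧ G * (1 - T) = 1 ∧ ‖G‖ ≤ 2 := by
  have h : ‖T‖ < 1 := by linarith
  let u := Units.oneSub T h
  refine ⟨(↑u⁻¹ : X →L[ℂ] X), u.mul_inv, u.inv_mul, ?_⟩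
  have e : (↑u⁻¹ : X →L[ℂ] X) = 1 + T * ↑u⁻¹ := by
    have := u.mul_inv
    have h3 : (1 - T) * (↑u⁻¹ : X →L[ℂ] X) = 1 := this
    rw [sub_mul, one_mul] at h3
    exact eq_add_of_sub_eq h3
  have h1 : ‖(1 : X →L[ℂ] X)‖ ≤ 1 := ContinuousLinearMap.norm_id_le
  have h2 : ‖(↑u⁻¹ : X →L[ℂ] X)‖ ≤ 1 + 1 / 2 * ‖(↑u⁻¹ : X →L[ℂ] X)‖ := by
    conv_lhs => rw [e]
    refine (norm_add_le _ _).trans (add_le_add h1 ((norm_mul_le _ _).trans ?_))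
    gcongr
  linarith

theorem resolvent_addBdd [CompleteSpace X] {A : X →ₗ.[ℂ] X} {z : ℂ} {B : X →L[ℂ] X} {a : ℝ}
    (hz : z ∈ resolventSet A) (ha : ‖resolvent A z‖ ≤ a) (hB : ‖B‖ * a ≤ 1 / 2) :
    z ∈ resolventSet (addBdd A B) ∧ ‖resolvent (addBdd A B) z‖ ≤ 2 * a := by
  have hR := isResolventAt_resolvent hz
  obtain ⟨G, h1, h2, h3⟩ := exists_inverse_one_sub (T := B * resolvent A z)
    ((norm_mul_le _ _).trans ((mul_le_mul_of_nonneg_left ha (norm_nonneg _)).trans hB))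
  have h := hR.addBdd h1 h2
  refine ⟨h.mem, ?_⟩
  rw [h.resolvent_eq, mul_comm]
  exact (norm_mul_le _ _).trans (mul_le_mul ha h3 (norm_nonneg _) ((norm_nonneg _).trans ha))

theorem resolventSet_mem_nhds [CompleteSpace X] {A : X →ₗ.[ℂ] X} {z : ℂ}
    (hz : z ∈ resolventSet A) :
    ∀ᶠ w in 𝓝 z, w ∈ resolventSet A ∧ ‖resolvent A w‖ ≤ 2 * ‖resolvent A z‖ := by
  have h : Tendsto (fun w : ℂ => ‖(z - w) • (1 : X →L[ℂ] X)‖ * ‖resolvent A z‖) (𝓝 z) (𝓝 0) := by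
    have : Continuous (fun w : ℂ => ‖(z - w) • (1 : X →L[ℂ] X)‖ * ‖resolvent A z‖) := by fun_prop
    simpa using this.tendsto z
  filter_upwards [h.eventually (ge_mem_nhds (b := (0 : ℝ)) (a := 1 / 2) (by norm_num))] with w hw
  obtain ⟨h1, h2⟩ := resolvent_addBdd hz le_rfl hw
  have h3 := isResolventAt_addBdd_smul_one.1 (isResolventAt_resolvent h1)
  rw [sub_sub_cancel] at h3
  refine ⟨h3.mem, ?_⟩
  rwa [h3.resolvent_eq]

theorem isOpen_resolventSet [CompleteSpace X] (A : X →ₗ.[ℂ] X) : IsOpen (resolventSet A) := by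
  rw [isOpen_iff_mem_nhds]
  intro z hz
  filter_upwards [resolventSet_mem_nhds hz] with w hw using hw.1

theorem continuousOn_resolvent [CompleteSpace X] (A : X →ₗ.[ℂ] X) :
    ContinuousOn (resolvent A) (resolventSet A) := by
  intro z hz
  refine ContinuousAt.continuousWithinAt ?_
  rw [ContinuousAt, tendsto_iff_norm_sub_tendsto_zero]
  have h : Tendsto (fun w : ℂ => ‖z - w‖ * (2 * ‖resolvent A z‖ * ‖resolvent A z‖)) (𝓝 z) (𝓝 0) := by
    have : Continuous fun w : ℂ => ‖z - w‖ * (2 * ‖resolvent A z‖ * ‖resolvent A z‖) := by fun_prop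
    simpa using this.tendsto z
  refine squeeze_zero' (Eventually.of_forall fun _ => norm_nonneg _) ?_ h
  filter_upwards [resolventSet_mem_nhds hz] with w hw
  rw [resolvent_sub (isResolventAt_resolvent hw.1) (isResolventAt_resolvent hz), norm_smul]
  gcongr
  exact (norm_mul_le _ _).trans (mul_le_mul_of_nonneg_right hw.2 (norm_nonneg _))

theorem hasDerivAt_resolvent [CompleteSpace X] {A : X →ₗ.[ℂ] X} {z : ℂ}
    (hz : z ∈ resolventSet A) :
    HasDerivAt (resolvent A) (-(resolvent A z * resolvent A z)) z := by
  rw [hasDerivAt_iff_tendsto_slope]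
  have hc := (continuousOn_resolvent A).continuousAt ((isOpen_resolventSet A).mem_nhds hz)
  have h1 : Tendsto (fun w => -(resolvent A w * resolvent A z)) (𝓝[≠] z)
      (𝓝 (-(resolvent A z * resolvent A z))) :=
    ((hc.tendsto.mul_const _).neg).mono_left nhdsWithin_le_nhds
  refine h1.congr' ?_
  filter_upwards [self_mem_nhdsWithin, nhdsWithin_le_nhds (resolventSet_mem_nhds hz)] with w hw hw2
  rw [slope_def_module, resolvent_sub (isResolventAt_resolvent hw2.1) (isResolventAt_resolvent hz),
    smul_smul, ← neg_sub w z, mul_neg, inv_mul_cancel₀ (sub_ne_zero.2 hw), neg_smul, one_smul]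

theorem differentiableOn_resolvent [CompleteSpace X] (A : X →ₗ.[ℂ] X) :
    DifferentiableOn ℂ (resolvent A) (resolventSet A) := fun _ hz =>
  (hasDerivAt_resolvent hz).differentiableAt.differentiableWithinAt

end Resolvent

/-! ### Contour integrals over cycles -/

section CycleIntegral

open MeasureTheory

/-- The velocity of the standard parametrization of a closed path. -/
def ClosedPath.velocity (κ : ClosedPath) (τ : ℝ) : ℂ := derivWithin κ.path.extend (Icc 0 1) τ

theorem ClosedPath.intervalIntegrable_velocity (κ : ClosedPath) :
    IntervalIntegrable κ.velocity volume 0 1 := by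
  obtain ⟨N, p, hp, h0, h1, hc⟩ := κ.piecewiseC1
  rw [← h0, ← h1]
  refine IntervalIntegrable.trans_iterate fun i hi => ?_
  rcases (hp (Nat.le_succ i)).eq_or_lt with heq | hlt
  · have heq' : p i = p (i + 1) := heq
    simp [heq']
  have hu : UniqueDiffOn ℝ (Icc (p i) (p (i + 1))) := uniqueDiffOn_Icc hlt
  have h2 : ContinuousOn (derivWithin κ.path.extend (Icc (p i) (p (i + 1))))
      (Icc (p i) (p (i + 1))) := (hc i hi).continuousOn_derivWithin hu le_rfl
  have h3 : IntervalIntegrable (derivWithin κ.path.extend (Icc (p i) (p (i + 1)))) volume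
      (p i) (p (i + 1)) := by
    refine ContinuousOn.intervalIntegrable ?_
    rwa [uIcc_of_le hlt.le]
  refine h3.congr_ae ?_
  rw [uIoc_of_le hlt.le, ← restrict_Ioo_eq_restrict_Ioc]
  filter_upwards [ae_restrict_mem measurableSet_Ioo] with τ hτ
  have e1 : Icc (p i) (p (i + 1)) ∈ 𝓝 τ := Icc_mem_nhds hτ.1 hτ.2
  have e2 : Icc (0 : ℝ) 1 ∈ 𝓝 τ := by
    refine mem_of_superset e1 (Icc_subset_Icc ?_ ?_)
    · rw [← h0]; exact hp (Nat.zero_le _)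
    · rw [← h1]; exact hp hi
  rw [ClosedPath.velocity, derivWithin_of_mem_nhds e1, derivWithin_of_mem_nhds e2]

/-- The length of a cycle, counted with multiplicities. -/
def Cycle.length (γ : Cycle) : ℝ :=
  γ.sum fun κ m => |(m : ℝ)| * ∫ τ in (0 : ℝ)..1, ‖κ.velocity τ‖

variable {F G : Type*} [NormedAddCommGroup F] [NormedSpace ℂ F]
  [NormedAddCommGroup G] [NormedSpace ℂ G]

/-- The normalized contour integral `(2πi)⁻¹ ∫_γ f(z) dz`. -/
def cauchy (γ : Cycle) (f : ℂ → F) : F := (2 * Real.pi * Complex.I : ℂ)⁻¹ • γ.integral f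

theorem cauchy_eq (γ : Cycle) (f : ℂ → F) :
    cauchy γ f = (2 * Real.pi * Complex.I : ℂ)⁻¹ • ∑ κ ∈ γ.support,
      (γ κ : ℂ) • ∫ τ in (0 : ℝ)..1, κ.velocity τ • f (κ.path.extend τ) := by
  unfold cauchy Cycle.integral Finsupp.sum
  congr 1
  refine Finset.sum_congr rfl fun κ _ => ?_
  simp only [curveIntegral_def]
  congr 1
  refine intervalIntegral.integral_congr fun τ _ => ?_
  simp only [curveIntegralFun_def]
  simp [ClosedPath.velocity]

theorem index_eq_cauchy (γ : Cycle) (w : ℂ) : γ.index w = cauchy γ fun z => (z - w)⁻¹ := rfl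

theorem ClosedPath.extend_mem {γ : Cycle} {κ : ClosedPath} (h : κ ∈ γ.support) (τ : ℝ) :
    κ.path.extend τ ∈ γ.ran := by
  refine mem_biUnion h ?_
  exact ⟨projIcc 0 1 zero_le_one τ, rfl⟩

theorem continuous_comp_extend {F : Type*} [NormedAddCommGroup F] {γ : Cycle} {f : ℂ → F} (hf : ContinuousOn f γ.ran)
    {κ : ClosedPath} (h : κ ∈ γ.support) : Continuous fun τ => f (κ.path.extend τ) :=
  hf.comp_continuous κ.path.continuous_extend (ClosedPath.extend_mem h)

theorem intervalIntegrable_path {γ : Cycle} {f : ℂ → F} (hf : ContinuousOn f γ.ran)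
    {κ : ClosedPath} (h : κ ∈ γ.support) :
    IntervalIntegrable (fun τ => κ.velocity τ • f (κ.path.extend τ)) volume 0 1 :=
  κ.intervalIntegrable_velocity.smul_continuousOn (continuous_comp_extend hf h).continuousOn

theorem cauchy_congr {γ : Cycle} {f g : ℂ → F} (h : EqOn f g γ.ran) : cauchy γ f = cauchy γ g := by
  rw [cauchy_eq, cauchy_eq]
  congr 1
  refine Finset.sum_congr rfl fun κ hκ => ?_
  congr 1
  refine intervalIntegral.integral_congr fun τ _ => ?_
  simp only [h (ClosedPath.extend_mem hκ τ)]

theorem cauchy_add {γ : Cycle} {f g : ℂ → F} (hf : ContinuousOn f γ.ran)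
    (hg : ContinuousOn g γ.ran) : cauchy γ (fun z => f z + g z) = cauchy γ f + cauchy γ g := by
  simp only [cauchy_eq, ← smul_add, ← Finset.sum_add_distrib]
  congr 1
  refine Finset.sum_congr rfl fun κ hκ => ?_
  rw [← intervalIntegral.integral_add (intervalIntegrable_path hf hκ)
    (intervalIntegrable_path hg hκ)]
  simp only [smul_add]

theorem cauchy_clm [CompleteSpace F] [CompleteSpace G] {γ : Cycle} {f : ℂ → F}
    (hf : ContinuousOn f γ.ran) (L : F →L[ℂ] G) :
    cauchy γ (fun z => L (f z)) = L (cauchy γ f) := by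
  simp only [cauchy_eq, map_smul, map_sum]
  congr 1
  refine Finset.sum_congr rfl fun κ hκ => ?_
  rw [← L.intervalIntegral_comp_comm (intervalIntegrable_path hf hκ)]
  simp only [map_smul]

theorem cauchy_sub [CompleteSpace F] {γ : Cycle} {f g : ℂ → F} (hf : ContinuousOn f γ.ran)
    (hg : ContinuousOn g γ.ran) : cauchy γ (fun z => f z - g z) = cauchy γ f - cauchy γ g := by
  have h := cauchy_clm hg (-ContinuousLinearMap.id ℂ F)
  have h2 : cauchy γ (fun z => f z + -g z) = cauchy γ f + cauchy γ (fun z => -g z) :=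
    cauchy_add hf hg.neg
  simp only [neg_apply, ContinuousLinearMap.id_apply] at h
  simp only [sub_eq_add_neg]
  rw [h2, h]

theorem norm_two_pi_I_inv_le : ‖(2 * Real.pi * Complex.I : ℂ)⁻¹‖ ≤ 1 := by
  rw [norm_inv]
  refine inv_le_one_of_one_le₀ ?_
  simp only [norm_mul, Complex.norm_I, mul_one, Complex.norm_real, Complex.norm_ofNat]
  rw [Real.norm_of_nonneg Real.pi_pos.le]
  linarith [Real.pi_gt_three]

theorem norm_cauchy_le {γ : Cycle} {f : ℂ → F} {C : ℝ}
    (h : ∀ z ∈ γ.ran, ‖f z‖ ≤ C) : ‖cauchy γ f‖ ≤ γ.length * C := by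
  rw [cauchy_eq, norm_smul, Cycle.length, Finsupp.sum, Finset.sum_mul]
  refine (mul_le_of_le_one_left (norm_nonneg _) norm_two_pi_I_inv_le).trans ?_
  refine (norm_sum_le _ _).trans (Finset.sum_le_sum fun κ hκ => ?_)
  rw [norm_smul, mul_assoc, Complex.norm_intCast]
  refine mul_le_mul_of_nonneg_left ?_ (abs_nonneg _)
  rw [← intervalIntegral.integral_mul_const]
  refine intervalIntegral.norm_integral_le_of_norm_le zero_le_one
    (Eventually.of_forall fun τ _ => ?_) (κ.intervalIntegrable_velocity.norm.mul_const C)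
  rw [norm_smul]
  exact mul_le_mul_of_nonneg_left (h _ (ClosedPath.extend_mem hκ τ)) (norm_nonneg _)

/-- Dominated convergence for contour integrals. -/
theorem tendsto_cauchy {ι : Type*} {l : Filter ι} [l.IsCountablyGenerated] {γ : Cycle}
    {f : ι → ℂ → F} {g : ℂ → F} {C : ℝ}
    (hf : ∀ᶠ s in l, ContinuousOn (f s) γ.ran) (hC : ∀ᶠ s in l, ∀ z ∈ γ.ran, ‖f s z‖ ≤ C)
    (h : ∀ z ∈ γ.ran, Tendsto (fun s => f s z) l (𝓝 (g z))) :
    Tendsto (fun s => cauchy γ (f s)) l (𝓝 (cauchy γ g)) := by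
  simp only [cauchy_eq]
  refine Tendsto.const_smul (tendsto_finsetSum _ fun κ hκ => Tendsto.const_smul ?_ _) _
  refine intervalIntegral.tendsto_integral_filter_of_dominated_convergence
    (fun τ => ‖κ.velocity τ‖ * C) ?_ ?_ (κ.intervalIntegrable_velocity.norm.mul_const C) ?_
  · filter_upwards [hf] with s hs
    rw [uIoc_of_le zero_le_one]
    exact (intervalIntegrable_path hs hκ).aestronglyMeasurable
  · filter_upwards [hC] with s hs
    refine Eventually.of_forall fun τ _ => ?_
    rw [norm_smul]
    exact mul_le_mul_of_nonneg_left (hs _ (ClosedPath.extend_mem hκ τ)) (norm_nonneg _)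
  · exact Eventually.of_forall fun τ _ => (h _ (ClosedPath.extend_mem hκ τ)).const_smul _

theorem Cycle.isCompact_ran (γ : Cycle) : IsCompact γ.ran :=
  γ.support.isCompact_biUnion fun κ _ => isCompact_range κ.path.continuous

/-- The Cauchy transform of a continuous function is holomorphic off the cycle. -/
theorem differentiableAt_cauchyTransform [CompleteSpace F] {γ : Cycle} {f : ℂ → F}
    (hf : ContinuousOn f γ.ran) {w : ℂ} (hw : w ∉ γ.ran) :
    DifferentiableAt ℂ (fun w => cauchy γ fun z => (z - w)⁻¹ • f z) w := by
  obtain ⟨δ, hδ, hball⟩ := Metric.isOpen_iff.1 γ.isCompact_ran.isClosed.isOpen_compl w hw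
  have hd : ∀ v ∈ Metric.ball w (δ / 2), ∀ z ∈ γ.ran, δ / 2 ≤ ‖z - v‖ := by
    intro v hv z hz
    by_contra hlt
    refine hball (a := z) ?_ hz
    rw [Metric.mem_ball, dist_eq_norm] at hv ⊢
    calc ‖z - w‖ ≤ ‖z - v‖ + ‖v - w‖ := by
          simpa using norm_add_le (z - v) (v - w)
      _ < δ := by linarith
  have hne : ∀ v ∈ Metric.ball w (δ / 2), ∀ z ∈ γ.ran, z - v ≠ 0 := fun v hv z hz h => by
    have := hd v hv z hz
    rw [h, norm_zero] at this
    linarith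
  have hcont : ∀ v ∈ Metric.ball w (δ / 2), ContinuousOn (fun z : ℂ => (z - v)⁻¹) γ.ran :=
    fun v hv => (continuousOn_id.sub continuousOn_const).inv₀ (hne v hv)
  have hw0 : w ∈ Metric.ball w (δ / 2) := Metric.mem_ball_self (by linarith)
  have hev : ∀ᶠ v in 𝓝[≠] w, v ∈ Metric.ball w (δ / 2) :=
    nhdsWithin_le_nhds (Metric.ball_mem_nhds w (by linarith))
  obtain ⟨K, hK⟩ := γ.isCompact_ran.exists_bound_of_continuousOn hf
  refine HasDerivAt.differentiableAt
    (f' := cauchy γ fun z => ((z - w)⁻¹ * (z - w)⁻¹) • f z) ?_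
  rw [hasDerivAt_iff_tendsto_slope]
  have ht : Tendsto (fun v => cauchy γ fun z => ((z - v)⁻¹ * (z - w)⁻¹) • f z) (𝓝[≠] w)
      (𝓝 (cauchy γ fun z => ((z - w)⁻¹ * (z - w)⁻¹) • f z)) := by
    refine tendsto_cauchy (C := ((δ / 2)⁻¹ * (δ / 2)⁻¹) * K) ?_ ?_ ?_
    · filter_upwards [hev] with v hv
      exact ((hcont v hv).mul (hcont w hw0)).smul hf
    · filter_upwards [hev] with v hv z hz
      have hK' := hK z hz
      rw [norm_smul, norm_mul, norm_inv, norm_inv]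
      have h1 := hd v hv z hz
      have h2 := hd w hw0 z hz
      gcongr
    · intro z hz
      refine Tendsto.mono_left ?_ nhdsWithin_le_nhds
      have : ContinuousAt (fun v => ((z - v)⁻¹ * (z - w)⁻¹) • f z) w := by
        have h0 := hne w hw0 z hz
        exact (((continuousAt_const.sub continuousAt_id).inv₀ h0).mul continuousAt_const).smul
          continuousAt_const
      exact this.tendsto
  refine ht.congr' ?_
  filter_upwards [hev, self_mem_nhdsWithin] with v hv hvw
  have hvw' : v - w ≠ 0 := sub_ne_zero.2 hvw
  have e0 : (cauchy γ fun z => (z - v)⁻¹ • f z - (z - w)⁻¹ • f z) =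
      (cauchy γ fun z => (z - v)⁻¹ • f z) - cauchy γ fun z => (z - w)⁻¹ • f z :=
    cauchy_sub ((hcont v hv).smul hf) ((hcont w hw0).smul hf)
  rw [slope_def_module, ← e0]
  have e := cauchy_clm (γ := γ) (f := fun z => (z - v)⁻¹ • f z - (z - w)⁻¹ • f z)
    (((hcont v hv).smul hf).sub ((hcont w hw0).smul hf)) ((v - w)⁻¹ • ContinuousLinearMap.id ℂ F)
  simp only [smul_apply, ContinuousLinearMap.id_apply] at e
  rw [← e]
  refine cauchy_congr fun z hz => ?_
  have h1 := hne v hv z hz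
  have h2 := hne w hw0 z hz
  rw [← sub_smul, smul_smul]
  congr 1
  field_simp
  ring

/-- The Cauchy transform of a continuous function vanishes at infinity. -/
theorem tendsto_cauchyTransform {γ : Cycle} {f : ℂ → F} (hf : ContinuousOn f γ.ran) :
    Tendsto (fun w => cauchy γ fun z => (z - w)⁻¹ • f z) (Bornology.cobounded ℂ) (𝓝 0) := by
  obtain ⟨K, hK⟩ := γ.isCompact_ran.exists_bound_of_continuousOn hf
  obtain ⟨ρ, hρ⟩ := γ.isCompact_ran.isBounded.exists_norm_le
  have h1 : Tendsto (fun w : ℂ => γ.length * ((‖w‖ - ρ)⁻¹ * K)) (Bornology.cobounded ℂ)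
      (𝓝 (γ.length * (0 * K))) := by
    refine Tendsto.const_mul _ (Tendsto.mul_const _ ?_)
    exact tendsto_inv_atTop_zero.comp
      (tendsto_atTop_add_const_right _ _ tendsto_norm_cobounded_atTop)
  rw [zero_mul, mul_zero] at h1
  refine squeeze_zero_norm' ?_ h1
  have h2 : ∀ᶠ w : ℂ in Bornology.cobounded ℂ, ρ + 1 ≤ ‖w‖ :=
    tendsto_norm_cobounded_atTop.eventually_ge_atTop _
  filter_upwards [h2] with w hw
  refine norm_cauchy_le fun z hz => ?_
  have hz' := hρ z hz
  have hK' := hK z hz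
  rw [norm_smul, norm_inv]
  have h3 : ‖w‖ - ρ ≤ ‖z - w‖ := by
    have := norm_sub_norm_le w z
    rw [norm_sub_rev] at this
    linarith
  have h4 : 0 < ‖w‖ - ρ := by linarith
  gcongr

end CycleIntegral

/-! ### Riesz projections -/

section Riesz

variable {X : Type*} [NormedAddCommGroup X] [NormedSpace ℂ X]

/-- `w ↦ (w - A)⁻¹ Q` extends holomorphically from the resolvent set to the set `S`. -/
def InnerExtends (A : X →ₗ.[ℂ] X) (S : Set ℂ) (Q : X →L[ℂ] X) : Prop :=
  ∃ f : ℂ → X →L[ℂ] X, DifferentiableOn ℂ f (S ∪ resolventSet A) ∧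
    ∀ w ∈ resolventSet A, f w = resolvent A w * Q

/-- `w ↦ (w - A)⁻¹ Q` extends holomorphically from the resolvent set to the set `S`, and the
extension vanishes at infinity. -/
def OuterExtends (A : X →ₗ.[ℂ] X) (S : Set ℂ) (Q : X →L[ℂ] X) : Prop :=
  ∃ f : ℂ → X →L[ℂ] X, DifferentiableOn ℂ f (S ∪ resolventSet A) ∧
    (∀ w ∈ resolventSet A, f w = resolvent A w * Q) ∧ Tendsto f (Bornology.cobounded ℂ) (𝓝 0)

/-- The two extensions of `w ↦ (w - A)⁻¹ Q' Q` glue to an entire function vanishing at infinity,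
hence to zero by Liouville's theorem. -/
theorem mul_eq_zero_of_extends [CompleteSpace X] {A : X →ₗ.[ℂ] X} {S T : Set ℂ}
    {Q Q' : X →L[ℂ] X} (hS : IsOpen S) (hT : IsOpen T) (hd : Disjoint S T)
    (hcover : ∀ w, w ∈ S ∨ w ∈ T ∨ w ∈ resolventSet A) (hT' : T ∈ Bornology.cobounded ℂ)
    {w₀ : ℂ} (hw₀ : w₀ ∈ resolventSet A) (hQ : InnerExtends A S Q) (hQ' : OuterExtends A T Q')
    (hcomm : ∀ w ∈ resolventSet A, Commute Q' (resolvent A w)) : Q' * Q = 0 := by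
  classical
  obtain ⟨f, hf, hfe⟩ := hQ
  obtain ⟨h, hh, hhe, hlim⟩ := hQ'
  set Ω := resolventSet A with hΩ
  have hΩo : IsOpen Ω := isOpen_resolventSet A
  let F : ℂ → X →L[ℂ] X := fun w => if w ∈ T ∪ Ω then h w * Q else Q' * f w
  have hFT : EqOn F (fun w => h w * Q) (T ∪ Ω) := fun w hw => if_pos hw
  have hFΩ : ∀ w ∈ Ω, h w * Q = Q' * f w := fun w hw => by
    rw [hhe w hw, hfe w hw, ← mul_assoc, (hcomm w hw).eq]
  have hFS : EqOn F (fun w => Q' * f w) (S ∪ Ω) := by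
    intro w hw
    by_cases hw' : w ∈ T ∪ Ω
    · have hwΩ : w ∈ Ω := by
        rcases hw with hw | hw
        · rcases hw' with hw' | hw'
          · exact absurd hw' (disjoint_left.1 hd hw)
          · exact hw'
        · exact hw
      rw [hFT hw']
      exact hFΩ w hwΩ
    · exact if_neg hw'
  have hdiff : Differentiable ℂ F := by
    intro w
    have hTd : ∀ w ∈ T ∪ Ω, DifferentiableAt ℂ F w := by
      intro w hw
      have h1 : DifferentiableOn ℂ F (T ∪ Ω) :=
        (hh.mul_const Q).congr hFT
      exact h1.differentiableAt ((hT.union hΩo).mem_nhds hw)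
    rcases hcover w with hw | hw | hw
    · have h1 : DifferentiableOn ℂ F (S ∪ Ω) := (hf.const_mul Q').congr hFS
      exact h1.differentiableAt ((hS.union hΩo).mem_nhds (Or.inl hw))
    · exact hTd w (Or.inl hw)
    · exact hTd w (Or.inr hw)
  have hF0 : Tendsto F (cocompact ℂ) (𝓝 0) := by
    rw [← Metric.cobounded_eq_cocompact]
    have h1 : Tendsto (fun w => h w * Q) (Bornology.cobounded ℂ) (𝓝 (0 * Q)) := hlim.mul_const Q
    rw [zero_mul] at h1
    refine h1.congr' ?_
    filter_upwards [hT'] with w hw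
    exact (hFT (Or.inl hw)).symm
  have h0 := hdiff.apply_eq_of_tendsto_cocompact w₀ hF0
  rw [hFT (Or.inr hw₀)] at h0
  have h1 : resolvent A w₀ * (Q' * Q) = 0 := by
    rw [← mul_assoc, ← hhe w₀ hw₀]; exact h0
  ext y
  exact (isResolventAt_resolvent hw₀).injective (congrArg (fun B : X →L[ℂ] X => B y) h1)

section Cycles

variable [CompleteSpace X] {A : X →ₗ.[ℂ] X} {γ : Cycle}

theorem commute_cauchy_resolvent (hγ : γ.ran ⊆ resolventSet A) {Q : X →L[ℂ] X}
    (hQ : ∀ w ∈ resolventSet A, Commute Q (resolvent A w)) :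
    Commute Q (cauchy γ (resolvent A)) := by
  have hc := (continuousOn_resolvent A).mono hγ
  have h1 := cauchy_clm hc (ContinuousLinearMap.mul ℂ (X →L[ℂ] X) Q)
  have h2 := cauchy_clm hc ((ContinuousLinearMap.mul ℂ (X →L[ℂ] X)).flip Q)
  simp only [ContinuousLinearMap.flip_apply, ContinuousLinearMap.mul_apply'] at h1 h2
  rw [Commute, SemiconjBy, ← h1, ← h2]
  exact cauchy_congr fun z hz => (hQ z (hγ hz)).eq

theorem cauchy_resolvent_commute (hγ : γ.ran ⊆ resolventSet A) {w : ℂ} (hw : w ∈ resolventSet A) :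
    Commute (cauchy γ (resolvent A)) (resolvent A w) :=
  (commute_cauchy_resolvent hγ fun _ hz => resolvent_commute hw hz).symm

/-- The Cauchy transform of the resolvent along a cycle in the resolvent set. -/
theorem cauchyTransform_resolvent (hγ : γ.ran ⊆ resolventSet A) {w : ℂ} (hw : w ∈ resolventSet A)
    (hw' : w ∉ γ.ran) :
    cauchy γ (fun z => (z - w)⁻¹ • resolvent A z) =
      γ.index w • resolvent A w - resolvent A w * cauchy γ (resolvent A) := by
  have hc := (continuousOn_resolvent A).mono hγ
  have hne : ∀ z ∈ γ.ran, z - w ≠ 0 := fun z hz h => hw' (by rwa [← sub_eq_zero.1 h])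
  have hci : ContinuousOn (fun z : ℂ => (z - w)⁻¹) γ.ran :=
    (continuousOn_id.sub continuousOn_const).inv₀ hne
  have h1 := cauchy_clm hc (ContinuousLinearMap.mul ℂ (X →L[ℂ] X) (resolvent A w))
  have h2 := cauchy_clm hci (ContinuousLinearMap.toSpanSingleton ℂ (resolvent A w))
  simp only [ContinuousLinearMap.mul_apply', ContinuousLinearMap.toSpanSingleton_apply] at h1 h2
  have h0 : (cauchy γ fun z => (z - w)⁻¹ • resolvent A w - resolvent A w * resolvent A z) =
      (cauchy γ fun z => (z - w)⁻¹ • resolvent A w) -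
        cauchy γ fun z => resolvent A w * resolvent A z :=
    cauchy_sub (hci.smul continuousOn_const) (continuousOn_const.mul hc)
  rw [index_eq_cauchy, ← h1, ← h2, ← h0]
  refine cauchy_congr fun z hz => ?_
  have h3 := resolvent_sub (isResolventAt_resolvent hw) (isResolventAt_resolvent (hγ hz))
  have h4 := hne z hz
  change (z - w)⁻¹ • resolvent A z = (z - w)⁻¹ • resolvent A w - resolvent A w * resolvent A z
  have h5 : resolvent A w * resolvent A z = (z - w)⁻¹ • (resolvent A w - resolvent A z) := by
    rw [h3, inv_smul_smul₀ h4]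
  rw [h5, ← smul_sub, sub_sub_cancel]

/-- Off the cycle, the Cauchy transform of the resolvent is `(w - A)⁻¹ (n(γ, w) - E)`, where `E` is the
Riesz integral; where the index is `1` it extends `(w - A)⁻¹ (1 - E)`. -/
theorem innerExtends_cauchy (hγ : γ.ran ⊆ resolventSet A) {S : Set ℂ} (hS : IsOpen S)
    (hd : Disjoint S γ.ran) (hind : ∀ w ∈ S, γ.index w = 1) :
    InnerExtends A S (1 - cauchy γ (resolvent A)) := by
  classical
  have hc := (continuousOn_resolvent A).mono hγ
  refine ⟨fun w => if w ∈ resolventSet A then resolvent A w * (1 - cauchy γ (resolvent A))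
    else cauchy γ fun z => (z - w)⁻¹ • resolvent A z, ?_, fun w hw => if_pos hw⟩
  refine DifferentiableOn.union_of_isOpen ?_ ?_ hS (isOpen_resolventSet A)
  · have h1 : DifferentiableOn ℂ (fun w => cauchy γ fun z => (z - w)⁻¹ • resolvent A z) S :=
      fun w hw => (differentiableAt_cauchyTransform hc
        (disjoint_left.1 hd hw)).differentiableWithinAt
    refine h1.congr fun w hw => ?_
    split_ifs with h
    · rw [cauchyTransform_resolvent hγ h (disjoint_left.1 hd hw), hind w hw, one_smul, mul_sub,
        mul_one]
    · rfl
  · refine ((differentiableOn_resolvent A).mul_const (1 - cauchy γ (resolvent A))).congr ?_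
    intro w hw
    exact if_pos hw

/-- Where the index is `0`, minus the Cauchy transform of the resolvent extends `(w - A)⁻¹ E`, and it
vanishes at infinity. -/
theorem outerExtends_cauchy (hγ : γ.ran ⊆ resolventSet A) {S : Set ℂ} (hS : IsOpen S)
    (hS' : S ∈ Bornology.cobounded ℂ)
    (hd : Disjoint S γ.ran) (hind : ∀ w ∈ S, γ.index w = 0) :
    OuterExtends A S (cauchy γ (resolvent A)) := by
  classical
  have hc := (continuousOn_resolvent A).mono hγ
  have key : EqOn (fun w => if w ∈ resolventSet A then resolvent A w * cauchy γ (resolvent A)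
      else -cauchy γ fun z => (z - w)⁻¹ • resolvent A z)
      (fun w => -cauchy γ fun z => (z - w)⁻¹ • resolvent A z) S := by
    intro w hw
    simp only
    split_ifs with h
    · rw [cauchyTransform_resolvent hγ h (disjoint_left.1 hd hw), hind w hw, zero_smul, zero_sub,
        neg_neg]
    · rfl
  refine ⟨fun w => if w ∈ resolventSet A then resolvent A w * cauchy γ (resolvent A)
    else -cauchy γ fun z => (z - w)⁻¹ • resolvent A z, ?_, fun w hw => if_pos hw, ?_⟩
  · refine DifferentiableOn.union_of_isOpen ?_ ?_ hS (isOpen_resolventSet A)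
    · have h1 : DifferentiableOn ℂ (fun w => cauchy γ fun z => (z - w)⁻¹ • resolvent A z) S :=
        fun w hw => (differentiableAt_cauchyTransform hc
          (disjoint_left.1 hd hw)).differentiableWithinAt
      exact h1.neg.congr key
    · refine ((differentiableOn_resolvent A).mul_const (cauchy γ (resolvent A))).congr ?_
      intro w hw
      exact if_pos hw
  · have h1 := (tendsto_cauchyTransform hc).neg
    rw [neg_zero] at h1
    refine h1.congr' ?_
    filter_upwards [hS'] with w hw
    exact (key hw).symm

end Cycles

section Associated

variable {A : X →ₗ.[ℂ] X} {σ : Set ℂ} {P : X →L[ℂ] X}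

theorem acts_partIn {M : Submodule ℂ X} {y v : M} (h : Acts (partIn A M) y v) :
    Acts A (y : X) (v : X) := by
  obtain ⟨⟨h1, h2⟩, rfl⟩ := h
  exact ⟨h1, rfl⟩

/-- The corestriction of `Q` to its range. -/
def toRange (Q : X →L[ℂ] X) : X →L[ℂ] (Q : X →ₗ[ℂ] X).range :=
  Q.codRestrict _ fun x => ⟨x, rfl⟩

/-- The resolvent of the part of `A` in the range of `Q`, as an operator in the whole space. -/
def partResolvent (A : X →ₗ.[ℂ] X) (Q : X →L[ℂ] X) (w : ℂ) : X →L[ℂ] X :=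
  ((Q : X →ₗ[ℂ] X).range.subtypeL ∘L resolvent (partIn A (Q : X →ₗ[ℂ] X).range) w) ∘L toRange Q

theorem partResolvent_eq {Q : X →L[ℂ] X} {w : ℂ} (hw : w ∈ resolventSet A)
    (hw' : w ∈ resolventSet (partIn A (Q : X →ₗ[ℂ] X).range)) :
    partResolvent A Q w = resolvent A w * Q := by
  ext x
  have h1 := (isResolventAt_iff_acts.1 (isResolventAt_resolvent hw')).1 (toRange Q x)
  have h2 := (isResolventAt_iff_acts.1 (isResolventAt_resolvent hw)).2 _ _ (acts_partIn h1)
  change (resolvent (partIn A (Q : X →ₗ[ℂ] X).range) w (toRange Q x) : X) = resolvent A w (Q x)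
  rw [← h2]
  congr 1
  simp only [Submodule.coe_sub, Submodule.coe_smul, sub_sub_cancel]
  rfl

theorem completeSpace_range [CompleteSpace X] {Q : X →L[ℂ] X} (hQ : IsIdempotentElem Q) :
    CompleteSpace (Q : X →ₗ[ℂ] X).range := by
  have : IsClosed ((Q : X →ₗ[ℂ] X).range : Set X) := by
    have e : ((Q : X →ₗ[ℂ] X).range : Set X) = {x | Q x = x} := by
      ext x
      constructor
      · rintro ⟨y, rfl⟩
        exact congrArg (fun T : X →L[ℂ] X => T y) hQ.eq
      · intro h
        exact ⟨x, h⟩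
    rw [e]
    exact isClosed_eq Q.continuous continuous_id
  exact this.completeSpace_coe

theorem differentiableOn_partResolvent [CompleteSpace X] {Q : X →L[ℂ] X}
    (hQ : IsIdempotentElem Q) :
    DifferentiableOn ℂ (partResolvent A Q)
      (resolventSet (partIn A (Q : X →ₗ[ℂ] X).range)) := by
  have := completeSpace_range hQ
  have h := differentiableOn_resolvent (partIn A (Q : X →ₗ[ℂ] X).range)
  exact ((differentiableOn_const _).clm_comp h).clm_comp (differentiableOn_const _)

/-- The resolvent of an everywhere defined operator vanishes at infinity: by the open mapping theorem
an everywhere defined operator with a nonempty resolvent set is bounded. -/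
theorem tendsto_resolvent_of_domain_eq_top [CompleteSpace X] (hA : A.domain = ⊤)
    (hρ : ∀ᶠ w in Bornology.cobounded ℂ, w ∈ resolventSet A) :
    Tendsto (resolvent A) (Bornology.cobounded ℂ) (𝓝 0) := by
  obtain ⟨w₀, hw₀⟩ := hρ.exists
  have hR := isResolventAt_resolvent hw₀
  have hinj : Function.Injective (resolvent A w₀) :=
    (injective_iff_map_eq_zero _).2 fun y hy => hR.injective hy
  have hsurj : Function.Surjective (resolvent A w₀) := fun y =>
    ⟨_, hR.2 ⟨y, by rw [hA]; trivial⟩⟩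
  let e := ContinuousLinearEquiv.ofBijective (resolvent A w₀)
    (LinearMap.ker_eq_bot.2 hinj) (LinearMap.range_eq_top.2 hsurj)
  have he : ∀ y, resolvent A w₀ (e.symm y) = y := fun y => e.apply_symm_apply y
  let T : X →L[ℂ] X := e.symm
  have hacts : ∀ y, Acts A y (w₀ • y - T y) := fun y => by
    have := (isResolventAt_iff_acts.1 hR).1 (e.symm y)
    rwa [he] at this
  have h1 : Tendsto (fun w : ℂ => (‖w‖ - (‖w₀‖ + ‖T‖))⁻¹) (Bornology.cobounded ℂ) (𝓝 0) :=
    tendsto_inv_atTop_zero.comp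
      (tendsto_atTop_add_const_right _ _ tendsto_norm_cobounded_atTop)
  refine squeeze_zero_norm' ?_ h1
  have h2 : ∀ᶠ w : ℂ in Bornology.cobounded ℂ, ‖w₀‖ + ‖T‖ + 1 ≤ ‖w‖ :=
    tendsto_norm_cobounded_atTop.eventually_ge_atTop _
  filter_upwards [hρ, h2] with w hw hw2
  have hpos : 0 < ‖w‖ - (‖w₀‖ + ‖T‖) := by linarith
  refine ContinuousLinearMap.opNorm_le_bound _ (inv_nonneg.2 hpos.le) fun y => ?_
  have h3 := ((isResolventAt_iff_acts.1 (isResolventAt_resolvent hw)).1 y).unique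
    (hacts (resolvent A w y))
  have h4 : w • resolvent A w y = w₀ • resolvent A w y - T (resolvent A w y) + y := by
    rw [← h3]; simp
  have h5 : ‖w‖ * ‖resolvent A w y‖ ≤
      ‖w₀‖ * ‖resolvent A w y‖ + ‖T‖ * ‖resolvent A w y‖ + ‖y‖ := by
    rw [← norm_smul, h4]
    refine (norm_add_le _ _).trans (add_le_add_left ((norm_sub_le _ _).trans ?_) _)
    rw [norm_smul]
    exact add_le_add_right (T.le_opNorm _) _
  rw [inv_mul_eq_div, le_div_iff₀ hpos]
  nlinarith

/-- The extension is the resolvent of the part of `A` in `(1 - P) X`, whose spectrum is `σ(A) \ σ`. -/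
theorem IsAssociatedProjection.innerExtends [CompleteSpace X]
    (h : IsAssociatedProjection A σ P) {S : Set ℂ} (hS' : S \ σ ⊆ resolventSet A) :
    InnerExtends A S (1 - P) := by
  have hρ : ∀ w, w ∈ σ ∨ w ∈ resolventSet A →
      w ∈ resolventSet (partIn A ((1 - P : X →L[ℂ] X) : X →ₗ[ℂ] X).range) := by
    intro w hw
    by_contra hcon
    have : w ∈ spectrum A \ σ := h.spectrum_compl ▸ hcon
    exact hw.elim this.2 this.1
  refine ⟨partResolvent A (1 - P), ?_, fun w hw => partResolvent_eq hw (hρ w (Or.inr hw))⟩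
  refine (differentiableOn_partResolvent h.isProj.one_sub).mono ?_
  rintro w (hw | hw)
  · refine hρ w ?_
    by_cases hwσ : w ∈ σ
    · exact Or.inl hwσ
    · exact Or.inr (hS' ⟨hw, hwσ⟩)
  · exact hρ w (Or.inr hw)

/-- The extension is the resolvent of the part of `A` in `P X`; this part is everywhere defined since
`P D(A) = P X`, so that its resolvent vanishes at infinity. -/
theorem IsAssociatedProjection.outerExtends [CompleteSpace X]
    (h : IsAssociatedProjection A σ P) (hσ : Bornology.IsBounded σ) (hσ' : σ ⊆ spectrum A)
    {S : Set ℂ} (hS' : Disjoint S σ) : OuterExtends A S P := by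
  have := completeSpace_range h.isProj
  have hρ : ∀ w, w ∉ σ → w ∈ resolventSet (partIn A (P : X →ₗ[ℂ] X).range) := by
    intro w hw
    by_contra hcon
    exact hw (h.spectrum_range ▸ hcon)
  have hρ' : ∀ w ∈ resolventSet A, w ∉ σ := fun w hw hw' => hσ' hw' hw
  refine ⟨partResolvent A P, (differentiableOn_partResolvent h.isProj).mono ?_,
    fun w hw => partResolvent_eq hw (hρ w (hρ' w hw)), ?_⟩
  · rintro w (hw | hw)
    · exact hρ w (disjoint_left.1 hS' hw)
    · exact hρ w (hρ' w hw)
  · have hdom : (partIn A (P : X →ₗ[ℂ] X).range).domain = ⊤ := by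
      rw [eq_top_iff]
      rintro ⟨y, hy⟩ -
      have hy' := hy
      rw [← h.map_domain] at hy'
      obtain ⟨x, hx, rfl⟩ := hy'
      obtain ⟨h1, h2⟩ := h.commutes ⟨x, hx⟩
      exact ⟨h1, ⟨_, h2.symm⟩⟩
    have h1 := tendsto_resolvent_of_domain_eq_top hdom (by
      filter_upwards [Bornology.isBounded_def.1 hσ] with w hw using hρ w hw)
    have h2 : Tendsto (partResolvent A P) (Bornology.cobounded ℂ)
        (𝓝 (((P : X →ₗ[ℂ] X).range.subtypeL ∘L 0) ∘L toRange P)) :=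
      (((continuous_const.clm_comp continuous_id).clm_comp continuous_const).tendsto 0).comp h1
    simpa using h2

theorem IsAssociatedProjection.commute_resolvent (h : IsAssociatedProjection A σ P) {w : ℂ}
    (hw : w ∈ resolventSet A) : Commute P (resolvent A w) := by
  have hR := isResolventAt_iff_acts.1 (isResolventAt_resolvent hw)
  ext y
  obtain ⟨h1, h2⟩ := hR.1 y
  obtain ⟨h3, h4⟩ := h.commutes ⟨_, h1⟩
  have h5 := hR.2 _ _ ⟨h3, h4⟩
  change P (resolvent A w y) = resolvent A w (P y)
  rw [← h5]
  congr 1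
  simp only [h2, map_sub, map_smul]
  simp

end Associated

section Separation

/-- The cycle `γ` runs outside of `S ∪ T`, winds once around `S` and does not wind around `T`. -/
structure Encloses (γ : Cycle) (S T : Set ℂ) : Prop where
  index_one : ∀ w ∈ S, γ.index w = 1
  index_zero : ∀ w ∈ T, γ.index w = 0
  disjoint_left : Disjoint S γ.ran
  disjoint_right : Disjoint T γ.ran

/-- The spectrum of `A` is contained in the union of the disjoint open sets `S` and `T`, where `S`
is nonempty and `T` is a neighbourhood of infinity. -/
structure SeparatesSpectrum (A : X →ₗ.[ℂ] X) (S T : Set ℂ) : Prop where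
  isOpen_left : IsOpen S
  isOpen_right : IsOpen T
  disjoint : Disjoint S T
  nonempty : S.Nonempty
  cobounded : T ∈ Bornology.cobounded ℂ
  cover : ∀ w, w ∈ S ∨ w ∈ T ∨ w ∈ resolventSet A

variable {A : X →ₗ.[ℂ] X} {γ γ' : Cycle} {S T : Set ℂ}

/-- A bounded operator commuting with the resolvent maps the domain into itself and commutes with the
operator there. -/
theorem Acts.of_commute {w : ℂ} {Q : X →L[ℂ] X} (hw : w ∈ resolventSet A)
    (hQ : Commute Q (resolvent A w)) {x v : X} (h : Acts A x v) : Acts A (Q x) (Q v) := by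
  have hR := isResolventAt_iff_acts.1 (isResolventAt_resolvent hw)
  have h1 := hR.2 x v h
  have h2 := hR.1 (Q (w • x - v))
  have h3 : resolvent A w (Q (w • x - v)) = Q x := by
    conv_rhs => rw [← h1]
    exact (congrArg (fun B : X →L[ℂ] X => B (w • x - v)) hQ.eq).symm
  rw [h3, map_sub, map_smul, sub_sub_cancel] at h2
  exact h2

theorem Encloses.ran_subset (h : Encloses γ S T) (hA : SeparatesSpectrum A S T) :
    γ.ran ⊆ resolventSet A := fun z hz => by
  rcases hA.cover z with hz' | hz' | hz'
  · exact absurd hz (Set.disjoint_left.1 h.disjoint_left hz')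
  · exact absurd hz (Set.disjoint_left.1 h.disjoint_right hz')
  · exact hz'

theorem eq_of_mul_one_sub_eq_zero {E E' : X →L[ℂ] X} (h : E * (1 - E') = 0)
    (h' : E' * (1 - E) = 0) (hc : Commute E E') : E = E' := by
  rw [mul_sub, mul_one, sub_eq_zero] at h h'
  rw [h, hc.eq, ← h']

theorem Encloses.ran_nonempty (h : Encloses γ S T) (hS : S.Nonempty) : γ.ran.Nonempty := by
  obtain ⟨w, hw⟩ := hS
  by_contra hcon
  have h1 := h.index_one w hw
  have h2 : cauchy γ (fun z => (z - w)⁻¹) = cauchy γ fun _ => (0 : ℂ) :=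
    cauchy_congr (by rw [not_nonempty_iff_eq_empty.1 hcon]; exact fun _ hz => hz.elim)
  have h3 : ‖cauchy γ fun _ => (0 : ℂ)‖ ≤ γ.length * 0 := norm_cauchy_le fun z _ => by simp
  rw [mul_zero, norm_le_zero_iff] at h3
  rw [index_eq_cauchy, h2, h3] at h1
  exact zero_ne_one h1

variable [CompleteSpace X]

/-- The integral along `γ'` extends in the outer region `T` and the complement of the integral along `γ`
in the inner region `S`, so their product vanishes. -/
theorem SeparatesSpectrum.mul_one_sub (hA : SeparatesSpectrum A S T) (h : Encloses γ S T)
    (h' : Encloses γ' S T) :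
    cauchy γ' (resolvent A) * (1 - cauchy γ (resolvent A)) = 0 := by
  have hγ := h.ran_subset hA
  have hγ' := h'.ran_subset hA
  obtain ⟨w₀, hw₀⟩ := h.ran_nonempty hA.nonempty
  exact mul_eq_zero_of_extends hA.isOpen_left hA.isOpen_right hA.disjoint hA.cover hA.cobounded
    (hγ hw₀) (innerExtends_cauchy hγ hA.isOpen_left h.disjoint_left h.index_one)
    (outerExtends_cauchy hγ' hA.isOpen_right hA.cobounded h'.disjoint_right h'.index_zero)
    fun w hw => cauchy_resolvent_commute hγ' hw

/-- The contour integral of the resolvent does not depend on the enclosing cycle. -/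
theorem SeparatesSpectrum.cauchy_eq (hA : SeparatesSpectrum A S T) (h : Encloses γ S T)
    (h' : Encloses γ' S T) : cauchy γ (resolvent A) = cauchy γ' (resolvent A) :=
  eq_of_mul_one_sub_eq_zero (hA.mul_one_sub h' h) (hA.mul_one_sub h h')
    (commute_cauchy_resolvent (h'.ran_subset hA) fun _ hw =>
      cauchy_resolvent_commute (h.ran_subset hA) hw)

theorem SeparatesSpectrum.isIdempotentElem (hA : SeparatesSpectrum A S T) (h : Encloses γ S T) :
    IsIdempotentElem (cauchy γ (resolvent A)) := by
  have h1 := hA.mul_one_sub h h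
  rw [mul_sub, mul_one, sub_eq_zero] at h1
  exact h1.symm

/-- The projection associated with the part of the spectrum in `S` is the Riesz projection. -/
theorem SeparatesSpectrum.cauchy_eq_associated (hA : SeparatesSpectrum A S T)
    (h : Encloses γ S T) {σ : Set ℂ} {P : X →L[ℂ] X} (hP : IsAssociatedProjection A σ P)
    (hσ : Bornology.IsBounded σ) (hσ' : σ ⊆ spectrum A) (hS : S \ σ ⊆ resolventSet A)
    (hT : Disjoint T σ) : cauchy γ (resolvent A) = P := by
  have hγ := h.ran_subset hA
  obtain ⟨w₀, hw₀⟩ := h.ran_nonempty hA.nonempty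
  refine eq_of_mul_one_sub_eq_zero ?_ ?_
    (commute_cauchy_resolvent hγ fun _ hw => hP.commute_resolvent hw).symm
  · exact mul_eq_zero_of_extends hA.isOpen_left hA.isOpen_right hA.disjoint hA.cover hA.cobounded
      (hγ hw₀) (hP.innerExtends hS)
      (outerExtends_cauchy hγ hA.isOpen_right hA.cobounded h.disjoint_right h.index_zero)
      fun w hw => cauchy_resolvent_commute hγ hw
  · exact mul_eq_zero_of_extends hA.isOpen_left hA.isOpen_right hA.disjoint hA.cover hA.cobounded
      (hγ hw₀) (innerExtends_cauchy hγ hA.isOpen_left h.disjoint_left h.index_one)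
      (hP.outerExtends hσ hσ' hT) fun w hw => hP.commute_resolvent hw

end Separation

end Riesz

/-! ### Strongly differentiable operator functions with bounds on the derivatives -/

section StrongJets

variable {X : Type*} [NormedAddCommGroup X] [NormedSpace ℂ X]

/-- The operator function `B` is `m` times strongly continuously differentiable on `S`, its
derivatives are bounded operators, and the `l`-th one has norm at most `f l`, for `l ≤ m`. -/
def StrongJet : ℕ → (ℕ → ℝ) → Set ℝ → (ℝ → X →L[ℂ] X) → Prop
  | 0, f, S, B => (∀ t ∈ S, ‖B t‖ ≤ f 0) ∧ ∀ x, ContinuousOn (fun t => B t x) S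
  | m + 1, f, S, B => (∀ t ∈ S, ‖B t‖ ≤ f 0) ∧ ∃ B' : ℝ → X →L[ℂ] X,
      (∀ x, ∀ t ∈ S, HasDerivWithinAt (fun s => B s x) (B' t x) S t) ∧
        StrongJet m (fun l => f (l + 1)) S B'

namespace StrongJet

variable {m : ℕ} {f g : ℕ → ℝ} {S T : Set ℝ} {B C : ℝ → X →L[ℂ] X}

theorem norm_le (h : StrongJet m f S B) : ∀ t ∈ S, ‖B t‖ ≤ f 0 := by
  cases m with
  | zero => exact h.1
  | succ m => exact h.1

theorem continuousOn (h : StrongJet m f S B) (x : X) : ContinuousOn (fun t => B t x) S := by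
  cases m with
  | zero => exact h.2 x
  | succ m =>
    obtain ⟨-, B', h1, -⟩ := h
    exact fun t ht => (h1 x t ht).continuousWithinAt

theorem congr (h : StrongJet m f S B) (e : EqOn C B S) : StrongJet m f S C := by
  have hn : ∀ t ∈ S, ‖C t‖ ≤ f 0 := fun t ht => by rw [e ht]; exact h.norm_le t ht
  cases m with
  | zero => exact ⟨hn, fun x => (h.2 x).congr fun t ht => by rw [e ht]⟩
  | succ m =>
    obtain ⟨-, B', h1, h2⟩ := h
    exact ⟨hn, B', fun x t ht => (h1 x t ht).congr (fun s hs => by rw [e hs]) (by rw [e ht]), h2⟩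

theorem mono_bound (h : StrongJet m f S B) (hfg : ∀ l ≤ m, f l ≤ g l) : StrongJet m g S B := by
  induction m generalizing f g B with
  | zero => exact ⟨fun t ht => (h.1 t ht).trans (hfg 0 le_rfl), h.2⟩
  | succ m ih =>
    obtain ⟨h0, B', h1, h2⟩ := h
    exact ⟨fun t ht => (h0 t ht).trans (hfg 0 (Nat.zero_le _)), B', h1,
      ih h2 fun l hl => hfg _ (Nat.succ_le_succ hl)⟩

theorem mono_set (h : StrongJet m f S B) (hT : T ⊆ S) : StrongJet m f T B := by
  induction m generalizing f B with
  | zero => exact ⟨fun t ht => h.1 t (hT ht), fun x => (h.2 x).mono hT⟩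
  | succ m ih =>
    obtain ⟨h0, B', h1, h2⟩ := h
    exact ⟨fun t ht => h0 t (hT ht), B', fun x t ht => (h1 x t (hT ht)).mono hT, ih h2⟩

theorem of_succ (h : StrongJet (m + 1) f S B) : StrongJet m f S B := by
  induction m generalizing f B with
  | zero => exact ⟨h.norm_le, h.continuousOn⟩
  | succ m ih =>
    obtain ⟨h0, B', h1, h2⟩ := h
    exact ⟨h0, B', h1, ih h2⟩

theorem mono_order (h : StrongJet m f S B) {k : ℕ} (hk : k ≤ m) : StrongJet k f S B := by
  induction m with
  | zero => rwa [Nat.le_zero.1 hk]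
  | succ m ih =>
    rcases hk.eq_or_lt with rfl | hlt
    · exact h
    · exact ih h.of_succ (Nat.lt_succ_iff.1 hlt)

theorem of_hasDerivWithinAt {B' : ℝ → X →L[ℂ] X} (h : StrongJet (m + 1) f S B)
    (hS : UniqueDiffOn ℝ S)
    (hB' : ∀ x, ∀ t ∈ S, HasDerivWithinAt (fun s => B s x) (B' t x) S t) :
    StrongJet m (fun l => f (l + 1)) S B' := by
  obtain ⟨-, C, h1, h2⟩ := h
  refine h2.congr fun t ht => ?_
  ext x
  exact (hS t ht).eq_deriv _ (hB' x t ht) (h1 x t ht)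

theorem zero (hf : ∀ l, 0 ≤ f l) : StrongJet m f S (fun _ => (0 : X →L[ℂ] X)) := by
  induction m generalizing f with
  | zero => exact ⟨fun t _ => by simpa using hf 0, fun x => by simpa using continuousOn_const⟩
  | succ m ih =>
    refine ⟨fun t _ => by simpa using hf 0, fun _ => 0, fun x t _ => ?_, ih fun l => hf _⟩
    simpa using hasDerivWithinAt_const t S (0 : X)

theorem add (hB : StrongJet m f S B) (hC : StrongJet m g S C) :
    StrongJet m (fun l => f l + g l) S (fun t => B t + C t) := by
  have hn : ∀ t ∈ S, ‖B t + C t‖ ≤ f 0 + g 0 := fun t ht =>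
    (norm_add_le _ _).trans (add_le_add (hB.norm_le t ht) (hC.norm_le t ht))
  induction m generalizing f g B C with
  | zero => exact ⟨hn, fun x => (hB.2 x).add (hC.2 x)⟩
  | succ m ih =>
    obtain ⟨-, B', h1, h2⟩ := hB
    obtain ⟨-, C', h3, h4⟩ := hC
    refine ⟨hn, fun t => B' t + C' t, fun x t ht => (h1 x t ht).add (h3 x t ht), ?_⟩
    exact ih h2 h4 fun t ht =>
      (norm_add_le _ _).trans (add_le_add (h2.norm_le t ht) (h4.norm_le t ht))

theorem smul (hB : StrongJet m f S B) (c : ℂ) :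
    StrongJet m (fun l => ‖c‖ * f l) S (fun t => c • B t) := by
  have hn : ∀ t ∈ S, ‖c • B t‖ ≤ ‖c‖ * f 0 := fun t ht => by
    rw [norm_smul]; exact mul_le_mul_of_nonneg_left (hB.norm_le t ht) (norm_nonneg _)
  induction m generalizing f B with
  | zero => exact ⟨hn, fun x => (hB.2 x).const_smul c⟩
  | succ m ih =>
    obtain ⟨-, B', h1, h2⟩ := hB
    refine ⟨hn, fun t => c • B' t, fun x t ht => (h1 x t ht).const_smul c, ih h2 fun t ht => ?_⟩
    rw [norm_smul]; exact mul_le_mul_of_nonneg_left (h2.norm_le t ht) (norm_nonneg _)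

theorem neg (hB : StrongJet m f S B) : StrongJet m f S (fun t => -B t) := by
  have h := hB.smul (-1)
  simpa using h

theorem sub (hB : StrongJet m f S B) (hC : StrongJet m g S C) :
    StrongJet m (fun l => f l + g l) S (fun t => B t - C t) := by
  simpa only [sub_eq_add_neg] using hB.add hC.neg

theorem sum {ι : Type*} {s : Finset ι} {F : ι → ℕ → ℝ} {D : ι → ℝ → X →L[ℂ] X}
    (h : ∀ i ∈ s, StrongJet m (F i) S (D i)) :
    StrongJet m (fun l => ∑ i ∈ s, F i l) S (fun t => ∑ i ∈ s, D i t) := by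
  classical
  induction s using Finset.induction_on with
  | empty => simpa using zero (f := fun _ => 0) fun _ => le_rfl
  | insert i s hi ih =>
    simp only [Finset.sum_insert hi]
    exact (h i (Finset.mem_insert_self _ _)).add
      (ih fun j hj => h j (Finset.mem_insert_of_mem hj))

end StrongJet

/-- A bounded strongly convergent family of operators, applied to a convergent family of
vectors. -/
theorem tendsto_clm_apply {ι : Type*} {l : Filter ι} {B : ι → X →L[ℂ] X} {B₀ : X →L[ℂ] X}
    {v : ι → X} {v₀ : X} {K : ℝ} (hK : ∀ᶠ s in l, ‖B s‖ ≤ K)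
    (hB : Tendsto (fun s => B s v₀) l (𝓝 (B₀ v₀))) (hv : Tendsto v l (𝓝 v₀)) :
    Tendsto (fun s => B s (v s)) l (𝓝 (B₀ v₀)) := by
  have h1 : Tendsto (fun s => K * ‖v s - v₀‖) l (𝓝 0) := by
    have := (tendsto_iff_norm_sub_tendsto_zero.1 hv).const_mul K
    rwa [mul_zero] at this
  have h2 : Tendsto (fun s => B s (v s - v₀)) l (𝓝 0) := by
    refine squeeze_zero_norm' ?_ h1
    filter_upwards [hK] with s hs
    exact (ContinuousLinearMap.le_opNorm _ _).trans
      (mul_le_mul_of_nonneg_right hs (norm_nonneg _))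
  have h3 := h2.add hB
  simpa using h3

/-- The product rule for strongly differentiable operator functions. -/
theorem hasDerivWithinAt_clm_apply {S : Set ℝ} {t K : ℝ} {B : ℝ → X →L[ℂ] X} {v : ℝ → X}
    {B' : X} {v' : X} (hK : ∀ s ∈ S, ‖B s‖ ≤ K)
    (hc : ContinuousWithinAt (fun s => B s v') S t)
    (hB : HasDerivWithinAt (fun s => B s (v t)) B' S t) (hv : HasDerivWithinAt v v' S t) :
    HasDerivWithinAt (fun s => B s (v s)) (B' + B t v') S t := by
  rw [hasDerivWithinAt_iff_tendsto_slope] at hB hv ⊢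
  have hle : 𝓝[S \ {t}] t ≤ 𝓝[S] t := nhdsWithin_mono _ sdiff_subset
  have hK' : ∀ᶠ s in 𝓝[S \ {t}] t, ‖B s‖ ≤ K := by
    filter_upwards [self_mem_nhdsWithin] with s hs using hK s hs.1
  have h1 := hB.add (tendsto_clm_apply hK' (hc.tendsto.mono_left hle) hv)
  refine h1.congr fun s => ?_
  rw [slope_def_module, slope_def_module, slope_def_module,
    ContinuousLinearMap.map_smul_of_tower, ← smul_add, map_sub]
  congr 1
  abel

/-- The binomial convolution of two sequences. -/
def binomConv (f g : ℕ → ℝ) (l : ℕ) : ℝ :=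
  ∑ p ∈ Finset.HasAntidiagonal.antidiagonal l, (l.choose p.1 : ℝ) * (f p.1 * g p.2)

theorem binomConv_succ (f g : ℕ → ℝ) (l : ℕ) :
    binomConv f g (l + 1) =
      binomConv (fun i => f (i + 1)) g l + binomConv f (fun i => g (i + 1)) l := by
  unfold binomConv
  have h := Finset.sum_antidiagonal_choose_succ_mul (R := ℝ) (fun i j => f i * g j) l
  rw [h, add_comm]
  congr 1
  refine Finset.sum_congr rfl fun p hp => ?_
  rw [Nat.choose_symm_of_eq_add (Finset.HasAntidiagonal.mem_antidiagonal.1 hp).symm]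

namespace StrongJet

variable {m : ℕ} {f g : ℕ → ℝ} {S : Set ℝ} {B C : ℝ → X →L[ℂ] X}

/-- The Leibniz rule. -/
theorem mul (hB : StrongJet m f S B) (hC : StrongJet m g S C) :
    StrongJet m (binomConv f g) S (fun t => B t * C t) := by
  have hn : ∀ {f g : ℕ → ℝ} {B C : ℝ → X →L[ℂ] X}, (∀ t ∈ S, ‖B t‖ ≤ f 0) →
      (∀ t ∈ S, ‖C t‖ ≤ g 0) → ∀ t ∈ S, ‖B t * C t‖ ≤ binomConv f g 0 := by
    intro f g B C h1 h2 t ht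
    simp only [binomConv, Finset.HasAntidiagonal.antidiagonal_zero, Finset.sum_singleton, Nat.choose_self,
      Nat.cast_one, one_mul]
    exact (norm_mul_le _ _).trans
      (mul_le_mul (h1 t ht) (h2 t ht) (norm_nonneg _) ((norm_nonneg _).trans (h1 t ht)))
  induction m generalizing f g B C with
  | zero =>
    refine ⟨hn hB.1 hC.1, fun x t ht => ?_⟩
    refine tendsto_clm_apply (B := B) (B₀ := B t) (K := f 0) ?_ (hB.2 (C t x) t ht) (hC.2 x t ht)
    filter_upwards [self_mem_nhdsWithin] with s hs using hB.1 s hs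
  | succ m ih =>
    have hB0 := hB.of_succ
    have hC0 := hC.of_succ
    have hBc := hB.continuousOn
    obtain ⟨hBn, B', h1, h2⟩ := hB
    obtain ⟨hCn, C', h3, h4⟩ := hC
    refine ⟨hn hBn hCn, fun t => B' t * C t + B t * C' t, fun x t ht => ?_, ?_⟩
    · exact hasDerivWithinAt_clm_apply hBn (hBc _ t ht) (h1 _ t ht) (h3 x t ht)
    · simp only [binomConv_succ]
      exact (ih h2 hC0).add (ih hB0 h4)

/-- Pointwise inverses of a strongly differentiable function are strongly differentiable. -/
theorem exists_inverse {D : ℝ → X →L[ℂ] X} {K : ℝ} (hB : StrongJet m f S B)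
    (h1 : ∀ t ∈ S, D t * B t = 1) (h2 : ∀ t ∈ S, B t * D t = 1) (hK : ∀ t ∈ S, ‖D t‖ ≤ K) :
    ∃ g, StrongJet m g S D := by
  have hdiff : ∀ s ∈ S, ∀ t ∈ S, ∀ x, D s x - D t x = -D s (B s (D t x) - B t (D t x)) := by
    intro s hs t ht x
    have e1 : D s (B s (D t x)) = D t x :=
      congrArg (fun E : X →L[ℂ] X => E (D t x)) (h1 s hs)
    have e2 : B t (D t x) = x := congrArg (fun E : X →L[ℂ] X => E x) (h2 t ht)
    rw [map_sub, e1, e2, neg_sub]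
  have hcont : ∀ x, ContinuousOn (fun t => D t x) S := by
    intro x t ht
    rw [ContinuousWithinAt, tendsto_iff_norm_sub_tendsto_zero]
    have h3 : Tendsto (fun s => K * ‖B s (D t x) - B t (D t x)‖) (𝓝[S] t) (𝓝 0) := by
      have := (tendsto_iff_norm_sub_tendsto_zero.1 (hB.continuousOn (D t x) t ht)).const_mul K
      rwa [mul_zero] at this
    refine squeeze_zero' (Eventually.of_forall fun _ => norm_nonneg _) ?_ h3
    filter_upwards [self_mem_nhdsWithin] with s hs
    rw [hdiff s hs t ht, norm_neg]
    exact (ContinuousLinearMap.le_opNorm _ _).trans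
      (mul_le_mul_of_nonneg_right (hK s hs) (norm_nonneg _))
  induction m generalizing f with
  | zero => exact ⟨fun _ => K, hK, hcont⟩
  | succ m ih =>
    obtain ⟨g, hg⟩ := ih hB.of_succ
    obtain ⟨-, B', h3, h4⟩ := hB
    have h5 := ((hg.mul h4).mul hg).neg
    refine ⟨fun l => Nat.casesOn l K fun l => binomConv (binomConv g fun i => f (i + 1)) g l,
      hK, fun t => -(D t * B' t * D t), fun x t ht => ?_, h5⟩
    rw [hasDerivWithinAt_iff_tendsto_slope]
    have hle : 𝓝[S \ {t}] t ≤ 𝓝[S] t := nhdsWithin_mono _ sdiff_subset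
    have hK' : ∀ᶠ s in 𝓝[S \ {t}] t, ‖D s‖ ≤ K := by
      filter_upwards [self_mem_nhdsWithin] with s hs using hK s hs.1
    have h6 := (tendsto_clm_apply hK' ((hcont _ t ht).tendsto.mono_left hle)
      (hasDerivWithinAt_iff_tendsto_slope.1 (h3 (D t x) t ht))).neg
    refine h6.congr' ?_
    filter_upwards [self_mem_nhdsWithin] with s hs
    rw [slope_def_module, slope_def_module, hdiff s hs.1 t ht,
      ContinuousLinearMap.map_smul_of_tower, smul_neg]

/-- Differentiation under the contour integral, for a family depending on the integration variable
in a Lipschitz continuous way. -/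
theorem cauchy [CompleteSpace X] {γ : Cycle} {F : ℂ → ℝ → X →L[ℂ] X} (hS : UniqueDiffOn ℝ S)
    (hconv : Convex ℝ S) (hF : ∀ z ∈ γ.ran, StrongJet m f S (F z))
    (hL : ∀ z ∈ γ.ran, ∀ z' ∈ γ.ran,
      StrongJet m (fun l => ‖z - z'‖ * g l) S fun t => F z t - F z' t) :
    StrongJet m (fun l => γ.length * f l) S fun t => Adiabatic.cauchy γ fun z => F z t := by
  have hcont : ∀ {m : ℕ} {g : ℕ → ℝ} {F : ℂ → ℝ → X →L[ℂ] X}, (∀ z ∈ γ.ran, ∀ z' ∈ γ.ran,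
      StrongJet m (fun l => ‖z - z'‖ * g l) S fun t => F z t - F z' t) →
      ∀ t ∈ S, ContinuousOn (fun z => F z t) γ.ran := by
    intro m g F hL t ht z hz
    rw [ContinuousWithinAt, tendsto_iff_norm_sub_tendsto_zero]
    have h3 : Tendsto (fun z' => ‖z' - z‖ * g 0) (𝓝[γ.ran] z) (𝓝 0) := by
      have : Continuous fun z' => ‖z' - z‖ * g 0 := by fun_prop
      have h := this.tendsto z
      rw [sub_self, norm_zero, zero_mul] at h
      exact h.mono_left nhdsWithin_le_nhds
    refine squeeze_zero' (Eventually.of_forall fun _ => norm_nonneg _) ?_ h3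
    filter_upwards [self_mem_nhdsWithin] with z' hz'
    exact (hL z' hz' z hz).norm_le t ht
  have happ : ∀ {G : ℂ → X →L[ℂ] X}, ContinuousOn G γ.ran → ∀ x,
      Adiabatic.cauchy γ G x = Adiabatic.cauchy γ fun z => G z x := fun {G} hG x =>
    (cauchy_clm hG (ContinuousLinearMap.apply ℂ X x)).symm
  have happc : ∀ {G : ℂ → X →L[ℂ] X}, ContinuousOn G γ.ran → ∀ x,
      ContinuousOn (fun z => G z x) γ.ran := fun {G} hG x => hG.clm_apply continuousOn_const
  induction m generalizing f g F with
  | zero =>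
    refine ⟨fun t ht => norm_cauchy_le fun z hz => (hF z hz).1 t ht, fun x t ht => ?_⟩
    have h1 : Tendsto (fun s => Adiabatic.cauchy γ fun z => F z s x) (𝓝[S] t)
        (𝓝 (Adiabatic.cauchy γ fun z => F z t x)) := by
      refine tendsto_cauchy (C := f 0 * ‖x‖) ?_ ?_ fun z hz => (hF z hz).2 x t ht
      · filter_upwards [self_mem_nhdsWithin] with s hs using happc (hcont hL s hs) x
      · filter_upwards [self_mem_nhdsWithin] with s hs z hz
        exact (ContinuousLinearMap.le_opNorm _ _).trans
          (mul_le_mul_of_nonneg_right ((hF z hz).1 s hs) (norm_nonneg _))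
    rw [← happ (hcont hL t ht)] at h1
    refine h1.congr' ?_
    filter_upwards [self_mem_nhdsWithin] with s hs using (happ (hcont hL s hs) x).symm
  | succ m ih =>
    have hF1 := fun z hz => (hF z hz).2
    choose! F' hF' hF'' using hF1
    have hL' : ∀ z ∈ γ.ran, ∀ z' ∈ γ.ran,
        StrongJet m (fun l => ‖z - z'‖ * g (l + 1)) S fun t => F' z t - F' z' t :=
      fun z hz z' hz' => (hL z hz z' hz').of_hasDerivWithinAt hS fun x t ht =>
        (hF' z hz x t ht).sub (hF' z' hz' x t ht)
    refine ⟨fun t ht => norm_cauchy_le fun z hz => (hF z hz).1 t ht,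
      fun t => Adiabatic.cauchy γ fun z => F' z t, fun x t ht => ?_, ih hF'' hL'⟩
    rw [hasDerivWithinAt_iff_tendsto_slope]
    have hle : 𝓝[S \ {t}] t ≤ 𝓝[S] t := nhdsWithin_mono _ sdiff_subset
    have h1 : Tendsto (fun s => Adiabatic.cauchy γ fun z => slope (fun s => F z s x) t s)
        (𝓝[S \ {t}] t) (𝓝 (Adiabatic.cauchy γ fun z => F' z t x)) := by
      refine tendsto_cauchy (C := f 1 * ‖x‖) ?_ ?_
        fun z hz => hasDerivWithinAt_iff_tendsto_slope.1 (hF' z hz x t ht)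
      · filter_upwards [self_mem_nhdsWithin] with s hs
        simp only [slope_def_module]
        exact ((happc (hcont hL s hs.1) x).sub (happc (hcont hL t ht) x)).const_smul _
      · filter_upwards [self_mem_nhdsWithin] with s hs z hz
        have h2 := hconv.norm_image_sub_le_of_norm_hasDerivWithin_le (C := f 1 * ‖x‖)
          (fun r hr => hF' z hz x r hr) (fun r hr => (ContinuousLinearMap.le_opNorm _ _).trans
            (mul_le_mul_of_nonneg_right ((hF'' z hz).norm_le r hr) (norm_nonneg _))) ht hs.1
        have h3 : 0 < ‖s - t‖ := norm_pos_iff.2 (sub_ne_zero.2 hs.2)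
        rw [slope_def_module, norm_smul, norm_inv, inv_mul_eq_div, div_le_iff₀ h3]
        exact h2
    have happ2 := happ (hcont hL' t ht) x
    rw [← happ2] at h1
    refine h1.congr' ?_
    filter_upwards [self_mem_nhdsWithin] with s hs
    have e1 : (Adiabatic.cauchy γ fun z => F z s x - F z t x) =
        (Adiabatic.cauchy γ fun z => F z s x) - Adiabatic.cauchy γ fun z => F z t x :=
      cauchy_sub (happc (hcont hL s hs.1) x) (happc (hcont hL t ht) x)
    have e2 := cauchy_clm (γ := γ) (f := fun z => F z s x - F z t x)
      ((happc (hcont hL s hs.1) x).sub (happc (hcont hL t ht) x))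
      (((s - t : ℝ) : ℂ)⁻¹ • ContinuousLinearMap.id ℂ X)
    simp only [smul_apply, ContinuousLinearMap.id_apply] at e2
    rw [slope_def_module, happ (hcont hL s hs.1), happ (hcont hL t ht), ← e1]
    simp only [slope_def_module, ← Complex.ofReal_inv, Complex.coe_smul] at e2 ⊢
    exact e2

/-- Strong differentiability is a local property. -/
theorem of_locally
    (h : ∀ t ∈ S, ∃ J ⊆ S, J ∈ 𝓝[S] t ∧ UniqueDiffOn ℝ J ∧ StrongJet m f J B) :
    StrongJet m f S B := by
  have hn : ∀ t ∈ S, ‖B t‖ ≤ f 0 := fun t ht => by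
    obtain ⟨J, -, h1, -, h2⟩ := h t ht
    exact h2.norm_le t (mem_of_mem_nhdsWithin ht h1)
  choose! J hJS hJ hJu hJB using h
  induction m generalizing f B with
  | zero =>
    exact ⟨hn, fun x t ht => ((hJB t ht).2 x t
      (mem_of_mem_nhdsWithin ht (hJ t ht))).mono_of_mem_nhdsWithin (hJ t ht)⟩
  | succ m ih =>
    have hJB' := fun t ht => (hJB t ht).2
    choose! B' h1 h2 using hJB'
    have hd : ∀ x, ∀ t ∈ S, HasDerivWithinAt (fun s => B s x) (B' t t x) S t := fun x t ht =>
      (h1 t ht x t (mem_of_mem_nhdsWithin ht (hJ t ht))).mono_of_mem_nhdsWithin (hJ t ht)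
    have h3 : ∀ t ∈ S, StrongJet m (fun l => f (l + 1)) (J t) fun t => B' t t := by
      intro t ht
      refine (h2 t ht).congr fun s hs => ?_
      ext x
      exact (hJu t ht s hs).eq_deriv _ ((hd x s (hJS t ht hs)).mono (hJS t ht)) (h1 t ht x s hs)
    exact ⟨hn, fun t => B' t t, hd, ih (fun t ht => (h3 t ht).norm_le t
      (mem_of_mem_nhdsWithin ht (hJ t ht))) h3⟩

theorem strongContDiffOn_one (h : StrongJet 1 f S B) (hS : UniqueDiffOn ℝ S) :
    StrongContDiffOn 1 B S := by
  intro x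
  obtain ⟨-, B', h1, h2⟩ := h
  have h3 : ContDiffOn ℝ (0 + 1) (fun t => B t x) S := by
    rw [contDiffOn_succ_iff_derivWithin hS]
    refine ⟨fun t ht => (h1 x t ht).differentiableWithinAt, by simp, ?_⟩
    rw [contDiffOn_zero]
    exact (h2.2 x).congr fun t ht => (h1 x t ht).derivWithin (hS t ht)
  simpa using h3

end StrongJet

/-- Strong derivatives are bounded operators, by the Banach–Steinhaus theorem. -/
theorem exists_strong_derivative [CompleteSpace X] {S : Set ℝ} {t : ℝ} {B : ℝ → X →L[ℂ] X}
    (hS : UniqueDiffWithinAt ℝ S t)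
    (h : ∀ x, DifferentiableWithinAt ℝ (fun s => B s x) S t) :
    ∃ T : X →L[ℂ] X, ∀ x, HasDerivWithinAt (fun s => B s x) (T x) S t := by
  have hne : (𝓝[S \ {t}] t).NeBot := by
    rw [uniqueDiffWithinAt_iff_accPt] at hS
    exact accPt_principal_iff_nhdsWithin.1 hS
  have h1 : Tendsto (fun s x => (((s - t)⁻¹ : ℝ) • (B s - B t)) x) (𝓝[S \ {t}] t)
      (𝓝 fun x => derivWithin (fun s => B s x) S t) := by
    rw [tendsto_pi_nhds]
    intro x
    exact hasDerivWithinAt_iff_tendsto_slope.1 (h x).hasDerivWithinAt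
  refine ⟨continuousLinearMapOfTendsto _ h1, fun x => (h x).hasDerivWithinAt⟩

theorem exists_norm_bound_of_strongly_continuous [CompleteSpace X] {Y : Type*} [TopologicalSpace Y]
    {S : Set Y} (hS : IsCompact S) {B : Y → X →L[ℂ] X}
    (h : ∀ x, ContinuousOn (fun t => B t x) S) : ∃ K, ∀ t ∈ S, ‖B t‖ ≤ K := by
  obtain ⟨K, hK⟩ := banach_steinhaus (g := fun t : S => B t) fun x => by
    obtain ⟨C, hC⟩ := hS.exists_bound_of_continuousOn (h x)
    exact ⟨C, fun t => hC t t.2⟩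
  exact ⟨K, fun t ht => hK ⟨t, ht⟩⟩

/-- On a compact set the strong derivatives are uniformly bounded, by the Banach–Steinhaus theorem. -/
theorem StrongContDiffOn.exists_strongJet [CompleteSpace X] {m : ℕ} {S : Set ℝ}
    {B : ℝ → X →L[ℂ] X} (hS : UniqueDiffOn ℝ S) (hc : IsCompact S)
    (h : StrongContDiffOn m B S) : ∃ f, StrongJet m f S B := by
  induction m generalizing B with
  | zero =>
    have h1 : ∀ x, ContinuousOn (fun t => B t x) S := fun x => (h x).continuousOn
    obtain ⟨K, hK⟩ := exists_norm_bound_of_strongly_continuous hc h1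
    exact ⟨fun _ => K, hK, h1⟩
  | succ m ih =>
    have h1 : ∀ x, ContinuousOn (fun t => B t x) S := fun x => (h x).continuousOn
    obtain ⟨K, hK⟩ := exists_norm_bound_of_strongly_continuous hc h1
    have h2 : ∀ x, ContDiffOn ℝ (m + 1) (fun t => B t x) S := fun x => by
      have := h x
      simpa using this
    have h3 := fun x => (contDiffOn_succ_iff_derivWithin hS).1 (h2 x)
    have h4 : ∀ t ∈ S, ∃ T : X →L[ℂ] X, ∀ x, HasDerivWithinAt (fun s => B s x) (T x) S t :=
      fun t ht => exists_strong_derivative (hS t ht) fun x => (h3 x).1 t ht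
    choose! B' hB' using h4
    obtain ⟨f, hf⟩ := ih (B := B') fun x => (h3 x).2.2.congr fun t ht =>
      ((hB' t ht x).derivWithin (hS t ht)).symm
    exact ⟨fun l => Nat.casesOn l K f, hK, B', fun x t ht => hB' t ht x, hf⟩

theorem StrongJet.of_strongDerivBound {m : ℕ} {f g : ℕ → ℝ} {S T : Set ℝ} {B : ℝ → X →L[ℂ] X}
    (h : StrongJet m f S B) (hS : UniqueDiffOn ℝ S) (hT : T ⊆ S) (hg : ∀ l, 0 ≤ g l)
    (hb : ∀ l ≤ m, ∀ t ∈ T, StrongDerivBound l B S t (g l)) : StrongJet m g T B := by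
  have hn : ∀ t ∈ T, ‖B t‖ ≤ g 0 := fun t ht =>
    ContinuousLinearMap.opNorm_le_bound _ (hg 0) fun x => by
      simpa using hb 0 (Nat.zero_le _) t ht x
  induction m generalizing f g B with
  | zero => exact ⟨hn, fun x => (h.2 x).mono hT⟩
  | succ m ih =>
    obtain ⟨-, B', h1, h2⟩ := h
    have h3 : ∀ l ≤ m, ∀ t ∈ T, StrongDerivBound l B' S t (g (l + 1)) := by
      intro l hl t ht x
      have h4 := hb (l + 1) (Nat.succ_le_succ hl) t ht x
      rw [iteratedDerivWithin_succ'] at h4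
      have e : EqOn (derivWithin (fun s => B s x) S) (fun s => B' s x) S := fun s hs =>
        (h1 x s hs).derivWithin (hS s hs)
      rwa [iteratedDerivWithin_congr e (hT ht)] at h4
    refine ⟨hn, B', fun x t ht => (h1 x t (hT ht)).mono hT,
      ih h2 (fun l => hg _) h3 fun t ht => ?_⟩
    exact ContinuousLinearMap.opNorm_le_bound _ (hg 1) fun x => by
      simpa using h3 0 (Nat.zero_le _) t ht x

theorem StrongJet.norm_sub_le {f : ℕ → ℝ} {S : Set ℝ} {B : ℝ → X →L[ℂ] X}
    (h : StrongJet 1 f S B) (hS : Convex ℝ S) {s t : ℝ} (hs : s ∈ S) (ht : t ∈ S) :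
    ‖B t - B s‖ ≤ f 1 * ‖t - s‖ := by
  obtain ⟨-, B', h1, h2⟩ := h
  have h0 : 0 ≤ f 1 := (norm_nonneg _).trans (h2.norm_le s hs)
  refine ContinuousLinearMap.opNorm_le_bound _ (by positivity) fun x => ?_
  have h3 := hS.norm_image_sub_le_of_norm_hasDerivWithin_le (C := f 1 * ‖x‖)
    (fun r hr => h1 x r hr) (fun r hr => (ContinuousLinearMap.le_opNorm _ _).trans
      (mul_le_mul_of_nonneg_right (h2.norm_le r hr) (norm_nonneg _))) hs ht
  rw [sub_apply]
  linarith

theorem uniqueDiffOn_unitInterval : UniqueDiffOn ℝ (Icc (0 : ℝ) 1) := uniqueDiffOn_Icc zero_lt_one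

theorem strongDeriv_eq {B : ℝ → X →L[ℂ] X} {T : X →L[ℂ] X} {t : ℝ} (ht : t ∈ Icc (0 : ℝ) 1)
    (h : ∀ x, HasDerivWithinAt (fun s => B s x) (T x) (Icc 0 1) t) : strongDeriv B t = T := by
  have hex : ∃ T : X →L[ℂ] X, ∀ x, HasDerivWithinAt (fun s => B s x) (T x) (Icc 0 1) t := ⟨T, h⟩
  rw [strongDeriv, dif_pos hex]
  ext x
  exact (uniqueDiffOn_unitInterval t ht).eq_deriv _ (hex.choose_spec x) (h x)

theorem StrongJet.hasDerivWithinAt_strongDeriv {m : ℕ} {f : ℕ → ℝ} {B : ℝ → X →L[ℂ] X}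
    (h : StrongJet (m + 1) f (Icc 0 1) B) (x : X) {t : ℝ} (ht : t ∈ Icc (0 : ℝ) 1) :
    HasDerivWithinAt (fun s => B s x) (strongDeriv B t x) (Icc 0 1) t := by
  obtain ⟨-, B', h1, -⟩ := h
  rw [strongDeriv_eq ht fun x => h1 x t ht]
  exact h1 x t ht

theorem StrongJet.strongDeriv {m : ℕ} {f : ℕ → ℝ} {B : ℝ → X →L[ℂ] X}
    (h : StrongJet (m + 1) f (Icc 0 1) B) :
    StrongJet m (fun l => f (l + 1)) (Icc 0 1) (strongDeriv B) :=
  h.of_hasDerivWithinAt uniqueDiffOn_unitInterval fun x _ ht =>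
    h.hasDerivWithinAt_strongDeriv x ht

end StrongJets

/-! ### Weights and the binomial convolution -/

section Weights

open scoped Nat

/-- The weight `c ^ l * (k + l)! / (1 + l) ^ 2`, which measures the `l`-th derivative at the
`k`-th stage of the iteration. -/
def weight (c : ℝ) (k l : ℕ) : ℝ := c ^ l * (((k + l)! : ℕ) / (1 + l : ℝ) ^ 2)

theorem weight_nonneg {c : ℝ} (hc : 0 ≤ c) (k l : ℕ) : 0 ≤ weight c k l := by
  unfold weight; positivity

theorem weight_zero_right (c : ℝ) (k : ℕ) : weight c k 0 = (k ! : ℕ) := by simp [weight]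

theorem sum_range_inv_sq_le (l : ℕ) :
    ∑ i ∈ Finset.range (l + 1), 1 / (1 + i : ℝ) ^ 2 ≤ 2 - 1 / (1 + l : ℝ) := by
  induction l with
  | zero => norm_num
  | succ l ih =>
    rw [Finset.sum_range_succ]
    have h : 1 / (1 + (l + 1 : ℕ) : ℝ) ^ 2 ≤ 1 / (1 + l : ℝ) - 1 / (1 + (l + 1 : ℕ) : ℝ) := by
      push_cast
      rw [div_sub_div _ _ (by positivity) (by positivity),
        div_le_div_iff₀ (by positivity) (by positivity)]
      nlinarith
    linarith

theorem sum_antidiagonal_inv_sq_le (l : ℕ) :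
    ∑ p ∈ Finset.HasAntidiagonal.antidiagonal l,
      1 / (1 + p.1 : ℝ) ^ 2 * (1 / (1 + p.2 : ℝ) ^ 2) ≤ 8 / (1 + l : ℝ) ^ 2 := by
  have h1 : ∀ p ∈ Finset.HasAntidiagonal.antidiagonal l,
      1 / (1 + p.1 : ℝ) ^ 2 * (1 / (1 + p.2 : ℝ) ^ 2) ≤
        2 / (1 + l : ℝ) ^ 2 * (1 / (1 + p.1 : ℝ) ^ 2 + 1 / (1 + p.2 : ℝ) ^ 2) := by
    rintro ⟨i, j⟩ hp
    have hl : (l : ℝ) = i + j := by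
      have := Finset.HasAntidiagonal.mem_antidiagonal.1 hp
      exact_mod_cast this.symm
    rw [hl]
    simp only
    rw [div_add_div _ _ (by positivity) (by positivity), div_mul_div_comm, div_mul_div_comm,
      div_le_div_iff₀ (by positivity) (by positivity)]
    have h2 : (1 + (i + j : ℝ)) ^ 2 ≤ 2 * ((1 + i : ℝ) ^ 2 + (1 + j : ℝ) ^ 2) := by
      nlinarith [sq_nonneg ((i : ℝ) - j), Nat.cast_nonneg (α := ℝ) i, Nat.cast_nonneg (α := ℝ) j]
    have h3 : 0 ≤ (1 + i : ℝ) ^ 2 * (1 + j : ℝ) ^ 2 := by positivity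
    nlinarith [mul_le_mul_of_nonneg_left h2 h3]
  refine (Finset.sum_le_sum h1).trans ?_
  rw [← Finset.mul_sum, Finset.sum_add_distrib]
  have h2 : ∑ p ∈ Finset.HasAntidiagonal.antidiagonal l, 1 / (1 + p.1 : ℝ) ^ 2 =
      ∑ i ∈ Finset.range (l + 1), 1 / (1 + i : ℝ) ^ 2 :=
    Finset.Nat.sum_antidiagonal_eq_sum_range_succ (fun i _ => 1 / (1 + i : ℝ) ^ 2) l
  have h3 : ∑ p ∈ Finset.HasAntidiagonal.antidiagonal l, 1 / (1 + p.2 : ℝ) ^ 2 =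
      ∑ i ∈ Finset.range (l + 1), 1 / (1 + i : ℝ) ^ 2 := by
    rw [← h2]
    exact Finset.Nat.sum_antidiagonal_swap (f := fun p : ℕ × ℕ => 1 / (1 + p.1 : ℝ) ^ 2) (n := l)
  have h4 := sum_range_inv_sq_le l
  have h5 : 0 ≤ 1 / (1 + l : ℝ) := by positivity
  rw [h2, h3]
  calc _ ≤ 2 / (1 + l : ℝ) ^ 2 * 4 := by gcongr; linarith
    _ = 8 / (1 + l : ℝ) ^ 2 := by ring

/-- `C(k + l, k) ≤ C(i + j + k + l, i + k)`, by Vandermonde's identity. -/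
theorem choose_mul_factorial_le (i j k l : ℕ) :
    (k + l).choose k * ((i + k)! * (j + l)!) ≤ (i + j + (k + l))! := by
  have h1 : (k + l).choose k ≤ (i + j + (k + l)).choose (i + k) := by
    have h := Nat.add_choose_eq (i + j) (k + l) (i + k)
    rw [h]
    have h2 : (i, k) ∈ Finset.HasAntidiagonal.antidiagonal (i + k) :=
      Finset.HasAntidiagonal.mem_antidiagonal.2 rfl
    refine le_trans ?_ (Finset.single_le_sum (f := fun p : ℕ × ℕ =>
      (i + j).choose p.1 * (k + l).choose p.2) (fun _ _ => Nat.zero_le _) h2)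
    exact Nat.le_mul_of_pos_left _ (Nat.choose_pos (Nat.le_add_right _ _))
  have h3 : (i + j + (k + l)).choose (i + k) * ((i + k)! * (j + l)!) = (i + j + (k + l))! := by
    have e : i + j + (k + l) = (i + k) + (j + l) := by ring
    rw [e, ← mul_assoc, Nat.choose_symm_add]
    exact Nat.add_choose_mul_factorial_mul_factorial _ _
  calc _ ≤ (i + j + (k + l)).choose (i + k) * ((i + k)! * (j + l)!) :=
        Nat.mul_le_mul_right _ h1
    _ = _ := h3

/-- The weights are submultiplicative for the binomial convolution, up to a factor `8`. -/
theorem binomConv_weight_le {c a b : ℝ} (hc : 0 ≤ c) (ha : 0 ≤ a) (hb : 0 ≤ b) (j k l : ℕ) :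
    binomConv (fun i => a * weight c j i) (fun i => b * weight c k i) l ≤
      8 * a * b * weight c (j + k) l := by
  unfold binomConv
  have h1 : ∀ p ∈ Finset.HasAntidiagonal.antidiagonal l,
      (l.choose p.1 : ℝ) * (a * weight c j p.1 * (b * weight c k p.2)) ≤
        a * b * c ^ l * ((j + k + l)! : ℕ) *
          (1 / (1 + p.1 : ℝ) ^ 2 * (1 / (1 + p.2 : ℝ) ^ 2)) := by
    rintro ⟨p, q⟩ hp
    obtain rfl : p + q = l := Finset.HasAntidiagonal.mem_antidiagonal.1 hp
    have h2 : (((p + q).choose p : ℕ) : ℝ) * (((j + p)! : ℕ) * ((k + q)! : ℕ)) ≤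
        ((j + k + (p + q))! : ℕ) := by
      exact_mod_cast choose_mul_factorial_le j k p q
    simp only [weight]
    calc _ = a * b * c ^ (p + q) * (((p + q).choose p : ℕ) * (((j + p)! : ℕ) * ((k + q)! : ℕ))) *
          (1 / (1 + p : ℝ) ^ 2 * (1 / (1 + q : ℝ) ^ 2)) := by rw [pow_add]; ring
      _ ≤ _ := by gcongr
  refine (Finset.sum_le_sum h1).trans ?_
  rw [← Finset.mul_sum]
  refine (mul_le_mul_of_nonneg_left (sum_antidiagonal_inv_sq_le l) (by positivity)).trans ?_
  rw [weight]
  apply le_of_eq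
  ring

/-- A derivative costs a factor `c` and raises the stage by one. -/
theorem weight_succ_le {c : ℝ} (hc : 0 ≤ c) (k l : ℕ) :
    weight c k (l + 1) ≤ c * weight c (k + 1) l := by
  unfold weight
  have e : k + (l + 1) = k + 1 + l := by ring
  rw [e, pow_succ]
  have : (1 + l : ℝ) ^ 2 ≤ (1 + (l + 1 : ℕ) : ℝ) ^ 2 := by
    gcongr; simp
  calc _ = c ^ l * c * (((k + 1 + l)! : ℕ) / (1 + (l + 1 : ℕ) : ℝ) ^ 2) := rfl
    _ ≤ c ^ l * c * (((k + 1 + l)! : ℕ) / (1 + l : ℝ) ^ 2) := by gcongr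
    _ = _ := by ring

/-- Up to order `n - k`, the factorials of the `k`-th stage are absorbed by powers of `n`. -/
theorem pow_mul_weight_le {c x : ℝ} (hc : 0 ≤ c) (hx : 0 ≤ x) {k l n : ℕ} (h : k + l ≤ n) :
    x ^ k * weight c k l ≤ (x * n) ^ k * weight c 0 l := by
  have h1 : (k + l)! ≤ l ! * n ^ k := by
    calc (k + l)! = (l + k)! := by rw [add_comm]
      _ ≤ l ! * (l + k) ^ k := by
          rw [← Nat.factorial_mul_ascFactorial]
          exact Nat.mul_le_mul_left _ (Nat.ascFactorial_le_pow_add l k)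
      _ ≤ l ! * n ^ k := by gcongr; omega
  have h2 : (((k + l)! : ℕ) : ℝ) ≤ (l ! : ℕ) * (n : ℝ) ^ k := by exact_mod_cast h1
  unfold weight
  rw [zero_add]
  calc _ ≤ x ^ k * (c ^ l * (((l ! : ℕ) * (n : ℝ) ^ k) / (1 + l : ℝ) ^ 2)) := by gcongr
    _ = _ := by rw [mul_pow]; ring

variable {X : Type*} [NormedAddCommGroup X] [NormedSpace ℂ X]

theorem StrongJet.mul_weight {m j k : ℕ} {a b c : ℝ} {S : Set ℝ} {B C : ℝ → X →L[ℂ] X}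
    (hB : StrongJet m (fun l => a * weight c j l) S B)
    (hC : StrongJet m (fun l => b * weight c k l) S C) (hc : 0 ≤ c) (ha : 0 ≤ a) (hb : 0 ≤ b) :
    StrongJet m (fun l => 8 * a * b * weight c (j + k) l) S (fun t => B t * C t) :=
  (hB.mul hC).mono_bound fun l _ => binomConv_weight_le hc ha hb j k l

theorem StrongJet.strongDeriv_weight {m k : ℕ} {a c : ℝ} {B : ℝ → X →L[ℂ] X}
    (hB : StrongJet (m + 1) (fun l => a * weight c k l) (Icc 0 1) B) (hc : 0 ≤ c) (ha : 0 ≤ a) :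
    StrongJet m (fun l => a * c * weight c (k + 1) l) (Icc 0 1) (Adiabatic.strongDeriv B) :=
  hB.strongDeriv.mono_bound fun l _ => by
    rw [mul_assoc]; exact mul_le_mul_of_nonneg_left (weight_succ_le hc k l) ha

end Weights

/-! ### Uniform local bounds from the regularity condition -/

section LocalData

variable {X : Type*} [NormedAddCommGroup X] [NormedSpace ℂ X]

/-- Uniform control of the operators `A(t)`, `t ∈ J`: their spectra are separated by the disjoint
open sets `S` and `T`, the resolvents are bounded by `a` outside of `S ∪ T`, both the fixed cycle
`Γ` and the cycles `γ t` enclose `S`, and the derivatives up to order `n` of the resolvents on `Γ`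
are controlled by the weights. -/
structure LocalData (n : ℕ) (A : ℝ → X →ₗ.[ℂ] X) (γ : ℝ → Cycle) (a c ℓ : ℝ) (J : Set ℝ)
    (Γ : Cycle) (S T : Set ℂ) : Prop where
  uniqueDiffOn : UniqueDiffOn ℝ J
  convex : Convex ℝ J
  length_le : Γ.length ≤ ℓ
  isOpen_left : IsOpen S
  isOpen_right : IsOpen T
  disjoint : Disjoint S T
  nonempty : S.Nonempty
  cobounded : T ∈ Bornology.cobounded ℂ
  encloses : Encloses Γ S T
  encloses_cycle : ∀ t ∈ J, Encloses (γ t) S T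
  resolvent_le : ∀ t ∈ J, ∀ z, z ∉ S → z ∉ T →
    z ∈ resolventSet (A t) ∧ ‖resolvent (A t) z‖ ≤ a
  jet : ∀ z ∈ Γ.ran, StrongJet n (fun l => a * weight c 0 l) J fun t => resolvent (A t) z

/-- The quantitative assumptions of the iteration: local control of the resolvents around every
point of `[0, 1]` with common constants, and control of the derivatives of `[P', P]`. -/
structure IterationData (n : ℕ) (A : ℝ → X →ₗ.[ℂ] X) (γ : ℝ → Cycle) (P : ℝ → X →L[ℂ] X)
    (a b c ℓ : ℝ) : Prop where
  exists_local : ∀ t ∈ Icc (0 : ℝ) 1, ∃ J ⊆ Icc (0 : ℝ) 1, ∃ Γ S T, J ∈ 𝓝[Icc 0 1] t ∧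
    LocalData n A γ a c ℓ J Γ S T
  cauchy_eq : ∀ t ∈ Icc (0 : ℝ) 1, cauchy (γ t) (resolvent (A t)) = P t
  jet : StrongJet n (fun l => b * weight c 0 l) (Icc 0 1) (derivComm P)

theorem weight_mono {c c' : ℝ} (hc : 0 ≤ c) (h : c ≤ c') (k l : ℕ) :
    weight c k l ≤ weight c' k l := by
  unfold weight; gcongr

theorem LocalData.mono {n : ℕ} {A : ℝ → X →ₗ.[ℂ] X} {γ : ℝ → Cycle} {a c ℓ a' c' ℓ' : ℝ}
    {J : Set ℝ} {Γ : Cycle} {S T : Set ℂ} (h : LocalData n A γ a c ℓ J Γ S T) (ha0 : 0 ≤ a)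
    (hc0 : 0 ≤ c) (ha : a ≤ a') (hc : c ≤ c') (hℓ : ℓ ≤ ℓ') :
    LocalData n A γ a' c' ℓ' J Γ S T :=
  { h with
    length_le := h.length_le.trans hℓ
    resolvent_le := fun t ht z hz hz' =>
      ⟨(h.resolvent_le t ht z hz hz').1, (h.resolvent_le t ht z hz hz').2.trans ha⟩
    jet := fun z hz => (h.jet z hz).mono_bound fun l _ =>
      mul_le_mul ha (weight_mono hc0 hc 0 l) (weight_nonneg hc0 0 l) (ha0.trans ha) }

/-- If the resolvent at one point depends continuously on the operator, then so does the resolvent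
at another point; this quantitative form bounds the latter. -/
theorem norm_resolvent_le_of_close {A A₀ : X →ₗ.[ℂ] X} {z z₁ : ℂ} {a₀ a₁ D : ℝ}
    (hz : z ∈ resolventSet A) (hz₁ : z₁ ∈ resolventSet A) (hz0 : z ∈ resolventSet A₀)
    (hz₁0 : z₁ ∈ resolventSet A₀) (h0 : ‖resolvent A₀ z‖ ≤ a₀) (h1 : ‖resolvent A z₁‖ ≤ a₁)
    (hD : ‖z - z₁‖ ≤ D)
    (hclose : D * ‖resolvent A z₁ - resolvent A₀ z₁‖ * (1 + D * a₀) ≤ 1 / 2) :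
    ‖resolvent A z‖ ≤ a₁ * (2 * (1 + D * a₀)) := by
  set R := resolvent A z
  set R₁ := resolvent A z₁
  set Q := resolvent A₀ z
  set Q₁ := resolvent A₀ z₁
  have e1 : R₁ - R = (z - z₁) • (R₁ * R) :=
    resolvent_sub (isResolventAt_resolvent hz₁) (isResolventAt_resolvent hz)
  have e2 : R - R₁ = (z₁ - z) • (R * R₁) :=
    resolvent_sub (isResolventAt_resolvent hz) (isResolventAt_resolvent hz₁)
  have e3 : Q₁ - Q = (z - z₁) • (Q₁ * Q) :=
    resolvent_sub (isResolventAt_resolvent hz₁0) (isResolventAt_resolvent hz0)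
  set G : X →L[ℂ] X := 1 - (z - z₁) • R with hG
  set G₀ : X →L[ℂ] X := 1 - (z - z₁) • Q with hG₀
  have hR : R = R₁ * G := by
    rw [hG, mul_sub, mul_one, mul_smul_comm, ← e1, sub_sub_cancel]
  have hGi : G * (1 + (z - z₁) • R₁) = 1 := by
    have e2' : (z - z₁) • (R * R₁) = R₁ - R := by
      rw [← neg_sub z₁ z, neg_smul, ← e2, neg_sub]
    rw [hG, sub_mul, one_mul, mul_add, mul_one, smul_mul_smul_comm, mul_smul, e2', smul_sub]
    abel
  have hG₀i : (1 + (z - z₁) • Q₁) * G₀ = 1 := by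
    rw [hG₀, mul_sub, mul_one, add_mul, one_mul, smul_mul_smul_comm, mul_smul, ← e3, smul_sub]
    abel
  have hD0 : 0 ≤ D := (norm_nonneg _).trans hD
  have ha0 : 0 ≤ a₀ := (norm_nonneg _).trans h0
  have hG₀n : ‖G₀‖ ≤ 1 + D * a₀ := by
    refine (norm_sub_le _ _).trans (add_le_add ContinuousLinearMap.norm_id_le ?_)
    rw [norm_smul]
    exact mul_le_mul hD h0 (norm_nonneg _) hD0
  have hGe : G = G₀ - G * ((z - z₁) • (R₁ - Q₁)) * G₀ := by
    have : (z - z₁) • (R₁ - Q₁) = (1 + (z - z₁) • R₁) - (1 + (z - z₁) • Q₁) := by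
      rw [smul_sub]; abel
    rw [this, mul_sub G, hGi, sub_mul 1, one_mul, mul_assoc, hG₀i, mul_one, sub_sub_cancel]
  have hGn : ‖G‖ ≤ (1 + D * a₀) + ‖G‖ * (1 / 2) := by
    conv_lhs => rw [hGe]
    refine (norm_sub_le _ _).trans (add_le_add hG₀n ?_)
    refine (norm_mul_le _ _).trans ?_
    calc _ ≤ (‖G‖ * (D * ‖R₁ - Q₁‖)) * (1 + D * a₀) := by
          refine mul_le_mul ((norm_mul_le _ _).trans ?_) hG₀n (norm_nonneg _) (by positivity)
          rw [norm_smul]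
          gcongr
      _ = ‖G‖ * (D * ‖R₁ - Q₁‖ * (1 + D * a₀)) := by ring
      _ ≤ _ := mul_le_mul_of_nonneg_left hclose (norm_nonneg _)
  rw [hR]
  exact (norm_mul_le _ _).trans (mul_le_mul h1 (by linarith) (norm_nonneg _)
    ((norm_nonneg _).trans h1))

open Metric in
/-- The geometry of the spectra `σ(t)` for `t` close to `t₀`, in units of a seventh of the gap. -/
theorem HigherOrderCondition.geometry {n : ℕ∞} {A : ℝ → X →ₗ.[ℂ] X} {σ : ℝ → Set ℂ}
    {P : ℝ → X →L[ℂ] X} {r : ℝ} {γ : ℝ → Cycle} {J : ℝ → Set ℝ}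
    (H : HigherOrderCondition n A σ P (7 * r) γ J) {t₀ t : ℝ} (ht₀ : t₀ ∈ Icc (0 : ℝ) 1)
    (ht : t ∈ J t₀) :
    Encloses (γ t) (thickening (2 * r) (σ t₀)) (cthickening (5 * r) (σ t₀))ᶜ ∧
    (∀ z, z ∉ thickening (2 * r) (σ t₀) → z ∉ (cthickening (5 * r) (σ t₀))ᶜ →
      z ∈ resolventSet (A t)) ∧
    thickening (2 * r) (σ t₀) \ σ t ⊆ resolventSet (A t) ∧
    Disjoint (cthickening (5 * r) (σ t₀))ᶜ (σ t) := by
  have htI := H.interval_subset t₀ ht₀ ht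
  have hr : 0 < r := by have := H.gap_pos; linarith
  have e1 : 7 * r / 7 = r := by ring
  have e3 : 3 * (7 * r) / 7 = 3 * r := by ring
  have e4 : 4 * (7 * r) / 7 = 4 * r := by ring
  obtain ⟨h1, h2⟩ := H.interval_close t₀ ht₀ t ht
  have hran := H.cycle_ran t htI
  have hone := H.cycle_index_one t htI
  have hzero := H.cycle_index_zero t htI
  have hgap := H.gap t htI
  rw [e1] at h1 h2
  rw [e3, e4] at hran
  rw [e3] at hone
  rw [e4] at hzero
  have hS : thickening (2 * r) (σ t₀) ⊆ thickening (3 * r) (σ t) := by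
    refine (thickening_subset_of_subset _ h2).trans ((thickening_thickening_subset _ _ _).trans ?_)
    exact thickening_mono (by linarith) _
  have hT : cthickening (4 * r) (σ t) ⊆ cthickening (5 * r) (σ t₀) := by
    refine (cthickening_subset_of_subset _ h1).trans
      ((cthickening_thickening_subset (by linarith) _ _).trans ?_)
    exact cthickening_mono (by linarith) _
  have hT' : cthickening (5 * r) (σ t₀) ⊆ thickening (7 * r) (σ t) := by
    refine (cthickening_subset_of_subset _ h2).trans
      ((cthickening_thickening_subset (by linarith) _ _).trans ?_)
    exact cthickening_subset_thickening' (by linarith) (by linarith) _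
  have hσS : σ t ⊆ thickening (2 * r) (σ t₀) := h1.trans (thickening_mono (by linarith) _)
  have hσT : σ t ⊆ cthickening (5 * r) (σ t₀) := h1.trans
    (thickening_subset_cthickening_of_le (by linarith) _)
  refine ⟨⟨fun w hw => hone w (hS hw), fun w hw => hzero w fun hw' => hw (hT hw'), ?_, ?_⟩,
    fun z hz hz' => hgap ⟨hT' (not_not.1 hz'), fun h => hz (hσS h)⟩,
    fun z hz => hgap ⟨thickening_mono (by linarith) _ (hS hz.1), hz.2⟩, ?_⟩
  · exact disjoint_left.2 fun z hz hz' => (hran hz').2 (hS hz)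
  · exact disjoint_left.2 fun z hz hz' => hz (hT (hran hz').1)
  · exact disjoint_left.2 fun z hz hz' => hz (hσT hz')

theorem StrongContDiffOn.of_le {n m : ℕ∞} {B : ℝ → X →L[ℂ] X} {S : Set ℝ}
    (h : StrongContDiffOn n B S) (hm : m ≤ n) : StrongContDiffOn m B S := fun x =>
  (h x).of_le (by exact_mod_cast hm)

open Metric in
/-- Local data around `t₀`. The regularity condition bounds the derivatives of the resolvents, but not
the resolvents themselves; these are controlled near `t₀` by compactness of the annular region around
`σ(t₀)`, because the resolvent at one point of the cycle `γ t₀` is Lipschitz continuous in `t`. -/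
theorem HigherOrderCondition.exists_localData [CompleteSpace X] {n : ℕ∞}
    {A : ℝ → X →ₗ.[ℂ] X} {σ : ℝ → Set ℂ} {P : ℝ → X →L[ℂ] X} {r : ℝ} {γ : ℝ → Cycle}
    {J : ℝ → Set ℝ} (hn : 1 ≤ n) (H : HigherOrderCondition n A σ P (7 * r) γ J) {t₀ : ℝ}
    (ht₀ : t₀ ∈ Icc (0 : ℝ) 1) :
    ∃ a b c ℓ : ℝ, 0 ≤ a ∧ 0 ≤ b ∧ 0 ≤ c ∧ ∃ J' ⊆ Icc (0 : ℝ) 1, ∃ Γ S T, J' ∈ 𝓝[Icc 0 1] t₀ ∧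
      (∀ m : ℕ, (m : ℕ∞) ≤ n → LocalData m A γ a c ℓ J' Γ S T) ∧
      (∀ t ∈ J', cauchy (γ t) (resolvent (A t)) = P t) ∧
      ∀ l : ℕ, (l : ℕ∞) ≤ n → ∀ t ∈ J', StrongDerivBound l (derivComm P) (Icc 0 1) t
        (b * weight c 0 l) := by
  have hr : 0 < r := by have := H.gap_pos; linarith
  obtain ⟨u, v, huv, hJ⟩ := H.interval t₀ ht₀
  have hJn := H.interval_nhds t₀ ht₀
  have hmem : t₀ ∈ J t₀ := mem_of_mem_nhdsWithin ht₀ hJn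
  obtain ⟨a₂, b, c, ha₂, hb, hc, hbR, hbK⟩ := H.bounds t₀ ht₀
  set S := thickening (2 * r) (σ t₀) with hS
  set T := (cthickening (5 * r) (σ t₀))ᶜ with hT
  have geom := fun t ht => H.geometry (t := t) ht₀ ht
  have hSne : S.Nonempty := (H.nonempty t₀ ht₀).mono (self_subset_thickening (by linarith) _)
  have hcomp : IsCompact (cthickening (5 * r) (σ t₀)) := (H.compact t₀ ht₀).cthickening
  have hTc : T ∈ Bornology.cobounded ℂ := Bornology.isBounded_def.1 hcomp.isBounded
  have hST : Disjoint S T := disjoint_left.2 fun z hz hz' =>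
    hz' (thickening_subset_cthickening_of_le (by linarith) _ hz)
  have henc := (geom t₀ hmem).1
  obtain ⟨z₁, hz₁⟩ := henc.ran_nonempty hSne
  have hz₁S : z₁ ∉ S := fun h => disjoint_left.1 henc.disjoint_left h hz₁
  have hz₁T : z₁ ∉ T := fun h => disjoint_left.1 henc.disjoint_right h hz₁
  -- the compact annular region around `σ t₀`
  have hK : IsCompact (cthickening (5 * r) (σ t₀) \ S) := hcomp.diff isOpen_thickening
  have hKρ : cthickening (5 * r) (σ t₀) \ S ⊆ resolventSet (A t₀) := fun z hz =>
    (geom t₀ hmem).2.1 z hz.2 (fun h => h hz.1)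
  obtain ⟨a₀, ha₀⟩ := hK.exists_bound_of_continuousOn ((continuousOn_resolvent (A t₀)).mono hKρ)
  obtain ⟨D₀, hD₀⟩ := hK.isBounded.exists_norm_le
  have hz₁K : z₁ ∈ cthickening (5 * r) (σ t₀) \ S := ⟨not_not.1 hz₁T, hz₁S⟩
  set D := D₀ + ‖z₁‖ with hDdef
  have hD0 : 0 ≤ D := add_nonneg ((norm_nonneg _).trans (hD₀ z₁ hz₁K)) (norm_nonneg _)
  have ha₀0 : 0 ≤ a₀ := (norm_nonneg _).trans (ha₀ z₁ hz₁K)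
  have hud : UniqueDiffOn ℝ (J t₀) := by rw [hJ]; exact uniqueDiffOn_Icc huv
  have hcv : Convex ℝ (J t₀) := by rw [hJ]; exact convex_Icc u v
  have hcj : IsCompact (J t₀) := by rw [hJ]; exact isCompact_Icc
  obtain ⟨f, hf⟩ := StrongContDiffOn.exists_strongJet (m := 1) hud hcj
    ((H.resolvent_contDiff t₀ ht₀ z₁ hz₁).of_le (by exact_mod_cast hn))
  have hf0 : 0 ≤ f 0 := (norm_nonneg _).trans (hf.norm_le t₀ hmem)
  -- a neighbourhood on which `(z₁ - A(t))⁻¹` is close to `(z₁ - A(t₀))⁻¹`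
  set δ := (2 * (D * (|f 1| + 1) * (1 + D * a₀)) + 1)⁻¹ with hδ
  have hδ0 : 0 < δ := by positivity
  set J' := J t₀ ∩ Icc (t₀ - δ) (t₀ + δ) with hJ'
  have hJ'e : J' = Icc (max u (t₀ - δ)) (min v (t₀ + δ)) := by rw [hJ', hJ, Icc_inter_Icc]
  have hJ'J : J' ⊆ J t₀ := inter_subset_left
  have hmem' := hmem
  rw [hJ] at hmem'
  have hlt : max u (t₀ - δ) < min v (t₀ + δ) := by
    rw [max_lt_iff, lt_min_iff, lt_min_iff]
    exact ⟨⟨huv, by linarith [hmem'.1]⟩, by linarith [hmem'.2], by linarith⟩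
  set a₁ := f 0 * (2 * (1 + D * a₀)) with ha₁
  have ha₁0 : 0 ≤ a₁ := by positivity
  have hbound : ∀ t ∈ J', ∀ z, z ∉ S → z ∉ T →
      z ∈ resolventSet (A t) ∧ ‖resolvent (A t) z‖ ≤ a₁ := by
    intro t ht z hz hz'
    have hzρ := (geom t (hJ'J ht)).2.1
    have hzK : z ∈ cthickening (5 * r) (σ t₀) \ S := ⟨not_not.1 hz', hz⟩
    refine ⟨hzρ z hz hz', norm_resolvent_le_of_close (A₀ := A t₀) (z₁ := z₁) (D := D) (a₀ := a₀)
      (hzρ z hz hz')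
      (hzρ z₁ hz₁S hz₁T) (hKρ hzK) (hKρ hz₁K) (ha₀ z hzK) (hf.norm_le t (hJ'J ht)) ?_ ?_⟩
    · exact (norm_sub_le _ _).trans (add_le_add_left (hD₀ z hzK) _)
    · have h1 := hf.norm_sub_le hcv hmem (hJ'J ht)
      have h2 : ‖t - t₀‖ ≤ δ := by
        rw [Real.norm_eq_abs, abs_le]
        constructor <;> linarith [ht.2.1, ht.2.2]
      have h3 : ‖resolvent (A t) z₁ - resolvent (A t₀) z₁‖ ≤ (|f 1| + 1) * δ := by
        refine h1.trans (mul_le_mul ?_ h2 (norm_nonneg _) (by positivity))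
        linarith [le_abs_self (f 1)]
      calc _ ≤ D * ((|f 1| + 1) * δ) * (1 + D * a₀) := by gcongr
        _ = (D * (|f 1| + 1) * (1 + D * a₀)) * δ := by ring
        _ ≤ 1 / 2 := by
          rw [hδ, ← div_eq_mul_inv, div_le_div_iff₀ (by positivity) (by norm_num)]
          linarith
  refine ⟨max a₁ a₂, b, c, (γ t₀).length, le_max_of_le_left ha₁0, hb.le, hc.le, J',
    hJ'J.trans (H.interval_subset t₀ ht₀), γ t₀, S, T, ?_, ?_, ?_, ?_⟩
  · exact inter_mem hJn (mem_nhdsWithin_of_mem_nhds (Icc_mem_nhds (by linarith) (by linarith)))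
  · intro m hm
    refine ⟨?_, ?_, le_rfl, isOpen_thickening, isClosed_cthickening.isOpen_compl, hST, hSne, hTc,
      henc, fun t ht => (geom t (hJ'J ht)).1, fun t ht z hz hz' => ?_, fun z hz => ?_⟩
    · rw [hJ'e]; exact uniqueDiffOn_Icc hlt
    · rw [hJ'e]; exact convex_Icc _ _
    · exact ⟨(hbound t ht z hz hz').1, (hbound t ht z hz hz').2.trans (le_max_left _ _)⟩
    · obtain ⟨g, hg⟩ := StrongContDiffOn.exists_strongJet (m := m) hud hcj
        ((H.resolvent_contDiff t₀ ht₀ z hz).of_le hm)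
      refine hg.of_strongDerivBound hud hJ'J
        (fun l => mul_nonneg (le_max_of_le_left ha₁0) (weight_nonneg hc.le 0 l)) ?_
      intro l hl t ht
      rcases Nat.eq_zero_or_pos l with rfl | hl0
      · intro x
        rw [iteratedDerivWithin_zero, weight_zero_right, Nat.factorial_zero, Nat.cast_one, mul_one]
        refine (ContinuousLinearMap.le_opNorm _ _).trans
          (mul_le_mul_of_nonneg_right ?_ (norm_nonneg _))
        exact (hbound t ht z (fun h => disjoint_left.1 henc.disjoint_left h hz)
          (fun h => disjoint_left.1 henc.disjoint_right h hz)).2.trans (le_max_left _ _)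
      · intro x
        refine (hbR l hl0 (le_trans (by exact_mod_cast hl) hm) t (hJ'J ht) z hz x).trans ?_
        refine mul_le_mul_of_nonneg_right ?_ (norm_nonneg _)
        rw [weight, zero_add, mul_assoc]
        gcongr
        exact le_max_right _ _
  · intro t ht
    have htI := H.interval_subset t₀ ht₀ (hJ'J ht)
    obtain ⟨h1, h2, h3, h4⟩ := geom t (hJ'J ht)
    have hsep : SeparatesSpectrum (A t) S T :=
      ⟨isOpen_thickening, isClosed_cthickening.isOpen_compl, hST, hSne, hTc, fun w => by
        by_cases hw : w ∈ S
        · exact Or.inl hw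
        by_cases hw' : w ∈ T
        · exact Or.inr (Or.inl hw')
        exact Or.inr (Or.inr (h2 w hw hw'))⟩
    exact hsep.cauchy_eq_associated h1 (H.projection t htI) (H.compact t htI).isBounded
      (H.subset_spectrum t htI) h3 h4
  · intro l hl t ht x
    have := hbK l hl t (hJ'J ht) x
    simp only [weight, zero_add, ← mul_assoc b]
    exact this

theorem HigherOrderCondition.exists_iterationData [CompleteSpace X] {n : ℕ∞}
    {A : ℝ → X →ₗ.[ℂ] X} {σ : ℝ → Set ℂ} {P : ℝ → X →L[ℂ] X} {r₀ : ℝ} {γ : ℝ → Cycle}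
    {J : ℝ → Set ℝ} (hn : 1 ≤ n) (H : HigherOrderCondition n A σ P r₀ γ J) :
    ∃ a b c ℓ : ℝ, 0 < a ∧ 0 < b ∧ 0 < c ∧ 0 < ℓ ∧
      ∀ m : ℕ, (m : ℕ∞) ≤ n → IterationData m A γ P a b c ℓ := by
  obtain ⟨r, rfl⟩ : ∃ r, r₀ = 7 * r := ⟨r₀ / 7, by ring⟩
  have hloc := fun t₀ ht₀ => H.exists_localData (t₀ := t₀) hn ht₀
  choose! a b c ℓ ha hb hc J' hJ' Γ S T hnhds hdata hcauchy hderiv using hloc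
  obtain ⟨F, hF, hcover⟩ := isCompact_Icc.elim_nhdsWithin_subcover
    (fun t => {s | J' t ∈ 𝓝[Icc (0 : ℝ) 1] s})
    fun t ht => eventually_eventually_nhdsWithin.2 (hnhds t ht)
  have hbd : ∀ φ : ℝ → ℝ, ∃ K, 0 < K ∧ ∀ t ∈ F, φ t ≤ K := fun φ => by
    obtain ⟨K, hK⟩ := (F.image φ).exists_le
    exact ⟨max K 1, by positivity, fun t ht =>
      (hK _ (Finset.mem_image_of_mem φ ht)).trans (le_max_left _ _)⟩
  obtain ⟨a', ha', haa⟩ := hbd a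
  obtain ⟨b', hb', hbb⟩ := hbd b
  obtain ⟨c', hc', hcc⟩ := hbd c
  obtain ⟨ℓ', hℓ', hℓℓ⟩ := hbd ℓ
  refine ⟨a', b', c', ℓ', ha', hb', hc', hℓ', fun m hm => ⟨fun t ht => ?_, fun t ht => ?_, ?_⟩⟩
  · obtain ⟨s, hs, hst⟩ := mem_iUnion₂.1 (hcover ht)
    have hsI := hF s hs
    exact ⟨J' s, hJ' s hsI, Γ s, S s, T s, hst, (hdata s hsI m hm).mono (ha s hsI) (hc s hsI)
      (haa s hs) (hcc s hs) (hℓℓ s hs)⟩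
  · exact hcauchy t ht t (mem_of_mem_nhdsWithin ht (hnhds t ht))
  · have hP : StrongContDiffOn (m + 1 : ℕ) P (Icc 0 1) :=
      H.projection_contDiff.of_le (by push_cast; gcongr)
    obtain ⟨f, hf⟩ := hP.exists_strongJet uniqueDiffOn_unitInterval isCompact_Icc
    have hK := (hf.strongDeriv.mul hf.of_succ).sub (hf.of_succ.mul hf.strongDeriv)
    refine StrongJet.of_strongDerivBound (B := derivComm P) hK uniqueDiffOn_unitInterval
      Subset.rfl (fun l => mul_nonneg hb'.le (weight_nonneg hc'.le 0 l)) fun l hl t ht x => ?_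
    obtain ⟨s, hs, hst⟩ := mem_iUnion₂.1 (hcover ht)
    have hsI := hF s hs
    refine (hderiv s hsI l (le_trans (by exact_mod_cast hl) hm) t
      (mem_of_mem_nhdsWithin ht hst) x).trans (mul_le_mul_of_nonneg_right ?_ (norm_nonneg _))
    exact mul_le_mul (hbb s hs) (weight_mono (hc s hsI) (hcc s hs) 0 l)
      (weight_nonneg (hc s hsI) 0 l) hb'.le

end LocalData

/-! ### The iteration -/

section Iteration

variable {X : Type*} [NormedAddCommGroup X] [NormedSpace ℂ X]

theorem StrongJet.const {m : ℕ} {f : ℕ → ℝ} {S : Set ℝ} {B : X →L[ℂ] X} (hf : ∀ l, ‖B‖ ≤ f l) :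
    StrongJet m f S fun _ => B := by
  cases m with
  | zero => exact ⟨fun _ _ => hf 0, fun _ => continuousOn_const⟩
  | succ m =>
    refine ⟨fun _ _ => hf 0, fun _ => 0, fun x t _ => ?_,
      StrongJet.zero fun l => (norm_nonneg _).trans (hf _)⟩
    simpa using hasDerivWithinAt_const t S (B x)

/-- An a priori bound for solutions of the fixed point equation `D = R + Y D` with small `Y`:
iterating the equation improves any initial bound. -/
theorem StrongJet.of_fixedPoint {m : ℕ} {g : ℕ → ℝ} {a c y : ℝ} {S : Set ℝ}
    {D R Y : ℝ → X →L[ℂ] X} (hc : 0 < c) (ha : 0 < a) (hy : 0 ≤ y) (hy1 : 16 * y ≤ 1)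
    (hD : StrongJet m g S D) (hR : StrongJet m (fun l => a * weight c 0 l) S R)
    (hY : StrongJet m (fun l => y * weight c 0 l) S Y) (h : ∀ t ∈ S, D t = R t + Y t * D t) :
    StrongJet m (fun l => 3 * a * weight c 0 l) S D := by
  have hw : ∀ l, 0 < weight c 0 l := fun l => by unfold weight; positivity
  set F := ∑ l ∈ Finset.range (m + 1), |g l| / weight c 0 l with hF
  have hF0 : 0 ≤ F := Finset.sum_nonneg fun l _ => div_nonneg (abs_nonneg _) (hw l).le
  have hgF : ∀ l ≤ m, g l ≤ F * weight c 0 l := by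
    intro l hl
    have h1 : |g l| / weight c 0 l ≤ F :=
      Finset.single_le_sum (f := fun l => |g l| / weight c 0 l)
        (fun l _ => div_nonneg (abs_nonneg _) (hw l).le)
        (Finset.mem_range.2 (Nat.lt_succ_of_le hl))
    rw [div_le_iff₀ (hw l)] at h1
    exact (le_abs_self _).trans h1
  have hiter : ∀ j : ℕ, StrongJet m (fun l => (2 * a + F / 2 ^ j) * weight c 0 l) S D := by
    intro j
    induction j with
    | zero =>
      refine hD.mono_bound fun l hl => (hgF l hl).trans ?_
      rw [pow_zero, div_one]
      exact mul_le_mul_of_nonneg_right (by linarith) (hw l).le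
    | succ j ih =>
      have hj : 0 ≤ F / 2 ^ j := by positivity
      have h1 := (hR.add (hY.mul_weight ih hc.le hy (by linarith))).congr h
      refine h1.mono_bound fun l _ => ?_
      rw [add_zero, ← add_mul]
      refine mul_le_mul_of_nonneg_right ?_ (hw l).le
      have h2 : 8 * y * (2 * a + F / 2 ^ j) ≤ 1 / 2 * (2 * a + F / 2 ^ j) :=
        mul_le_mul_of_nonneg_right (by linarith) (by linarith)
      have h3 : F / 2 ^ (j + 1) = F / 2 ^ j / 2 := by rw [pow_succ]; field_simp
      linarith
  obtain ⟨j, hj⟩ := pow_unbounded_of_one_lt (F / a) (one_lt_two (α := ℝ))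
  refine (hiter j).mono_bound fun l _ => mul_le_mul_of_nonneg_right ?_ (hw l).le
  have : F / 2 ^ j ≤ a := by
    rw [div_le_iff₀ (by positivity), mul_comm, ← div_le_iff₀ ha]
    exact hj.le
  linarith

variable {n m : ℕ} {A : ℝ → X →ₗ.[ℂ] X} {γ : ℝ → Cycle} {P : ℝ → X →L[ℂ] X}
  {a b c ℓ ε : ℝ}

/-- The perturbation `A(t) - ε K(t)`. -/
def perturbed (A : ℝ → X →ₗ.[ℂ] X) (ε : ℝ) (K : ℝ → X →L[ℂ] X) (t : ℝ) : X →ₗ.[ℂ] X :=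
  addBdd (A t) (-((ε : ℂ) • K t))

/-- The operators `K_{k-1 ε}`, with `K_{-1 ε} = 0`. -/
def prevK (γ : ℝ → Cycle) (A : ℝ → X →ₗ.[ℂ] X) (ε : ℝ) : ℕ → ℝ → X →L[ℂ] X
  | 0 => fun _ => 0
  | k + 1 => iterK γ A ε k

theorem iterA_eq (γ : ℝ → Cycle) (A : ℝ → X →ₗ.[ℂ] X) (ε : ℝ) (k : ℕ) :
    iterA γ A ε k = perturbed A ε (prevK γ A ε k) := by
  cases k with
  | zero =>
    funext t
    simp only [iterA, perturbed, prevK, smul_zero, neg_zero, addBdd_zero]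
  | succ k => rfl

theorem strongDeriv_congr {Q : ℝ → X →L[ℂ] X} (h : EqOn P Q (Icc 0 1)) {t : ℝ}
    (ht : t ∈ Icc (0 : ℝ) 1) : strongDeriv P t = strongDeriv Q t := by
  have key : ∀ {P Q : ℝ → X →L[ℂ] X}, EqOn P Q (Icc 0 1) → ∀ T : X →L[ℂ] X,
      (∀ x, HasDerivWithinAt (fun s => Q s x) (T x) (Icc 0 1) t) →
        ∀ x, HasDerivWithinAt (fun s => P s x) (T x) (Icc 0 1) t := fun {P Q} h T hT x =>
    (hT x).congr (fun s hs => by rw [h hs]) (by rw [h ht])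
  by_cases hex : ∃ T : X →L[ℂ] X, ∀ x, HasDerivWithinAt (fun s => Q s x) (T x) (Icc 0 1) t
  · obtain ⟨T, hT⟩ := hex
    rw [strongDeriv_eq ht hT, strongDeriv_eq ht (key h T hT)]
  · have hex' : ¬ ∃ T : X →L[ℂ] X, ∀ x, HasDerivWithinAt (fun s => P s x) (T x) (Icc 0 1) t :=
      fun ⟨T, hT⟩ => hex ⟨T, key h.symm T hT⟩
    rw [strongDeriv, strongDeriv, dif_neg hex, dif_neg hex']

theorem derivComm_congr {Q : ℝ → X →L[ℂ] X} (h : EqOn P Q (Icc 0 1)) :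
    EqOn (derivComm P) (derivComm Q) (Icc 0 1) := fun t ht => by
  rw [derivComm, derivComm, strongDeriv_congr h ht, h ht]

theorem LocalData.notMem {J : Set ℝ} {Γ : Cycle} {S T : Set ℂ}
    (h : LocalData n A γ a c ℓ J Γ S T) {z : ℂ} (hz : z ∈ Γ.ran) :
    z ∉ S ∧ z ∉ T :=
  ⟨fun h' => disjoint_left.1 h.encloses.disjoint_left h' hz,
    fun h' => disjoint_left.1 h.encloses.disjoint_right h' hz⟩

theorem iterP_eq (γ : ℝ → Cycle) (A : ℝ → X →ₗ.[ℂ] X) (ε : ℝ) (k : ℕ) :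
    iterP γ A ε k = fun t => cauchy (γ t) (resolvent (perturbed A ε (prevK γ A ε k) t)) := by
  rw [← iterA_eq]
  rfl

/-- The `K_{k ε}` are uniformly controlled if their successive differences are: these form a series
dominated by a geometric one with ratio `θ ε n ≤ 1 / 2`. -/
theorem jet_prevK {θ : ℝ} (hb : 0 < b) (hc : 0 < c) (hθ : 0 ≤ θ * ε) (hθ1 : θ * ε * n ≤ 1 / 2) {k : ℕ}
    (hmk : m + k ≤ n + 1)
    (h : ∀ j < k, StrongJet (n - j) (fun l => b * (θ * ε) ^ j * weight c j l) (Icc 0 1)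
      fun t => prevK γ A ε (j + 1) t - prevK γ A ε j t) :
    StrongJet m (fun l => 2 * b * weight c 0 l) (Icc 0 1) (prevK γ A ε k) := by
  have h1 : StrongJet m (fun l => ∑ j ∈ Finset.range k, b * (θ * ε) ^ j * weight c j l) (Icc 0 1)
      fun t => ∑ j ∈ Finset.range k, (prevK γ A ε (j + 1) t - prevK γ A ε j t) :=
    StrongJet.sum fun j hj => by
      have hj := Finset.mem_range.1 hj
      exact (h j hj).mono_order (by omega)
  refine (h1.congr fun t _ => ?_).mono_bound fun l hl => ?_
  · rw [Finset.sum_range_sub (fun j => prevK γ A ε j t)]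
    simp [prevK]
  · have h2 : ∀ j ∈ Finset.range k, b * (θ * ε) ^ j * weight c j l ≤
        b * weight c 0 l * (1 / 2) ^ j := by
      intro j hj
      have hj := Finset.mem_range.1 hj
      have h3 := pow_mul_weight_le hc.le hθ (k := j) (l := l) (n := n) (by omega)
      have h4 : (θ * ε * n) ^ j ≤ (1 / 2) ^ j := pow_le_pow_left₀ (by positivity) hθ1 j
      have h5 := weight_nonneg hc.le 0 l
      calc _ = b * ((θ * ε) ^ j * weight c j l) := by ring
        _ ≤ b * ((1 / 2) ^ j * weight c 0 l) := 
            mul_le_mul_of_nonneg_left (h3.trans (mul_le_mul_of_nonneg_right h4 h5)) hb.le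
        _ = _ := by ring
    refine (Finset.sum_le_sum h2).trans ?_
    rw [← Finset.mul_sum]
    have h6 : ∑ j ∈ Finset.range k, (1 / 2 : ℝ) ^ j ≤ 2 := sum_geometric_two_le k
    have h5 := weight_nonneg hc.le 0 l
    nlinarith [mul_nonneg hb.le h5]

/-- `[Q', Q] - [P', P] = [D', Q] + [P', D]` with `D = Q - P`. -/
theorem StrongJet.derivComm_sub {Q : ℝ → X →L[ℂ] X} {p d : ℝ} {k : ℕ} (hc : 0 ≤ c) (hp : 0 ≤ p)
    (hd : 0 ≤ d) (hP : StrongJet (m + 1) (fun l => p * weight c 0 l) (Icc 0 1) P)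
    (hQ : StrongJet (m + 1) (fun l => p * weight c 0 l) (Icc 0 1) Q)
    (hD : StrongJet (m + 1) (fun l => d * weight c k l) (Icc 0 1) fun t => Q t - P t) :
    StrongJet m (fun l => 32 * c * p * d * weight c (k + 1) l) (Icc 0 1)
      fun t => derivComm Q t - derivComm P t := by
  have hD' := hD.strongDeriv_weight hc hd
  have hP' := hP.strongDeriv_weight hc hp
  have hdc : 0 ≤ d * c := mul_nonneg hd hc
  have hpc : 0 ≤ p * c := mul_nonneg hp hc
  have h1 := (hD'.mul_weight hQ.of_succ hc hdc hp).sub (hQ.of_succ.mul_weight hD' hc hp hdc)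
  have h2 := (hP'.mul_weight hD.of_succ hc hpc hd).sub (hD.of_succ.mul_weight hP' hc hd hpc)
  refine ((h1.add h2).congr fun t ht => ?_).mono_bound fun l _ => ?_
  · have e : Adiabatic.strongDeriv (fun t => Q t - P t) t =
        Adiabatic.strongDeriv Q t - Adiabatic.strongDeriv P t :=
      strongDeriv_eq ht fun x =>
        (hQ.hasDerivWithinAt_strongDeriv x ht).sub (hP.hasDerivWithinAt_strongDeriv x ht)
    simp only [e, derivComm]
    noncomm_ring
  · have e : 0 + 1 + k = k + 1 := by ring
    have e' : k + (0 + 1) = k + 1 := by ring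
    have e'' : 0 + (k + 1) = k + 1 := by ring
    rw [e, e', e'']
    apply le_of_eq
    ring

variable [CompleteSpace X]

section Local

variable {J : Set ℝ} {Γ : Cycle} {S T : Set ℂ} {K K' : ℝ → X →L[ℂ] X}

theorem LocalData.perturbed_resolvent (h : LocalData n A γ a c ℓ J Γ S T) (ha : 0 < a)
    (hε : 0 < ε) (hε1 : 256 * ε * a * b ≤ 1) (hK : StrongJet m (fun l => 2 * b * weight c 0 l) J K)
    {t : ℝ} (ht : t ∈ J) {z : ℂ} (hz : z ∉ S) (hz' : z ∉ T) :
    z ∈ resolventSet (perturbed A ε K t) ∧ ‖resolvent (perturbed A ε K t) z‖ ≤ 2 * a := by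
  obtain ⟨h1, h2⟩ := h.resolvent_le t ht z hz hz'
  refine resolvent_addBdd h1 h2 ?_
  have h3 := hK.norm_le t ht
  rw [weight_zero_right, Nat.factorial_zero, Nat.cast_one, mul_one] at h3
  rw [norm_neg, norm_smul, Complex.norm_real, Real.norm_of_nonneg hε.le]
  calc ε * ‖K t‖ * a ≤ ε * (2 * b) * a := by gcongr
    _ ≤ 1 / 2 := by nlinarith [mul_pos hε ha]

theorem LocalData.separatesSpectrum (h : LocalData n A γ a c ℓ J Γ S T) (ha : 0 < a)
    (hε : 0 < ε) (hε1 : 256 * ε * a * b ≤ 1) (hK : StrongJet m (fun l => 2 * b * weight c 0 l) J K)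
    {t : ℝ} (ht : t ∈ J) : SeparatesSpectrum (perturbed A ε K t) S T :=
  ⟨h.isOpen_left, h.isOpen_right, h.disjoint, h.nonempty, h.cobounded, fun w => by
    by_cases hw : w ∈ S
    · exact Or.inl hw
    by_cases hw' : w ∈ T
    · exact Or.inr (Or.inl hw')
    exact Or.inr (Or.inr (h.perturbed_resolvent ha hε hε1 hK ht hw hw').1)⟩

/-- The resolvents of `A - ε K` are as smooth as those of `A` and as `K`. Smoothness comes from the
formula `(z - A + ε K)⁻¹ = R (1 + ε K R)⁻¹`, but the bounds obtained in this way are not of the form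
of the weights; these come from the fixed point equation `R' = R - ε R K R'`. -/
theorem LocalData.jet_perturbed (h : LocalData n A γ a c ℓ J Γ S T) (hmn : m ≤ n) (ha : 0 < a)
    (hb : 0 < b) (hc : 0 < c) (hε : 0 < ε) (hε1 : 256 * ε * a * b ≤ 1)
    (hK : StrongJet m (fun l => 2 * b * weight c 0 l) J K) {z : ℂ} (hz : z ∈ Γ.ran) :
    StrongJet m (fun l => 3 * a * weight c 0 l) J fun t => resolvent (perturbed A ε K t) z := by
  obtain ⟨hzS, hzT⟩ := h.notMem hz
  have hR := (h.jet z hz).mono_order hmn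
  have hres : ∀ t ∈ J, IsResolventAt (addBdd (A t) 0) z (resolvent (A t) z) := fun t ht => by
    rw [addBdd_zero]; exact isResolventAt_resolvent (h.resolvent_le t ht z hzS hzT).1
  have hres' : ∀ t ∈ J, IsResolventAt (perturbed A ε K t) z (resolvent (perturbed A ε K t) z) :=
    fun t ht => isResolventAt_resolvent (h.perturbed_resolvent ha hε hε1 hK ht hzS hzT).1
  set R : ℝ → X →L[ℂ] X := fun t => resolvent (A t) z with hRdef
  set R' : ℝ → X →L[ℂ] X := fun t => resolvent (perturbed A ε K t) z with hR'def
  have e1 : ∀ t ∈ J, R t - R' t = R t * ((ε : ℂ) • K t) * R' t := fun t ht => by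
    have := resolvent_addBdd_sub (hres t ht) (hres' t ht)
    rwa [sub_neg_eq_add, zero_add] at this
  have e2 : ∀ t ∈ J, R t - R' t = R' t * ((ε : ℂ) • K t) * R t := fun t ht => by
    have := resolvent_addBdd_sub (hres' t ht) (hres t ht)
    rw [sub_zero, mul_neg, neg_mul] at this
    rw [← neg_sub, this, neg_neg]
  -- the inverse of `1 + ε K R` is `1 - ε K R'`
  have hK' := hK.smul (ε : ℂ)
  have hone : StrongJet m (fun _ => ‖(1 : X →L[ℂ] X)‖) J fun _ => (1 : X →L[ℂ] X) :=
    StrongJet.const fun _ => le_rfl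
  obtain ⟨g, hg⟩ := (hone.add (hK'.mul hR)).exists_inverse
    (D := fun t => 1 - ((ε : ℂ) • K t) * R' t) (K := 1 + ε * (2 * b) * (2 * a))
    (fun t ht => by
      have e : (1 - (ε : ℂ) • K t * R' t) * (1 + (ε : ℂ) • K t * R t) =
          1 + (ε : ℂ) • K t * (R t - R' t - R' t * ((ε : ℂ) • K t) * R t) := by
        generalize (ε : ℂ) • K t = L
        noncomm_ring
      rw [e, e2 t ht, sub_self, mul_zero, add_zero])
    (fun t ht => by
      have e : (1 + (ε : ℂ) • K t * R t) * (1 - (ε : ℂ) • K t * R' t) =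
          1 + (ε : ℂ) • K t * (R t - R' t - R t * ((ε : ℂ) • K t) * R' t) := by
        generalize (ε : ℂ) • K t = L
        noncomm_ring
      rw [e, e1 t ht, sub_self, mul_zero, add_zero])
    (fun t ht => by
      refine (norm_sub_le _ _).trans (add_le_add ContinuousLinearMap.norm_id_le ?_)
      refine (norm_mul_le _ _).trans ?_
      have h3 := hK.norm_le t ht
      rw [weight_zero_right, Nat.factorial_zero, Nat.cast_one, mul_one] at h3
      rw [norm_smul, Complex.norm_real, Real.norm_of_nonneg hε.le]
      have h4 : ‖R' t‖ ≤ 2 * a := (h.perturbed_resolvent ha hε hε1 hK ht hzS hzT).2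
      gcongr)
  have hR' : StrongJet m _ J R' := (hR.mul hg).congr fun t ht => by
    simp only
    rw [mul_sub, mul_one, ← mul_assoc, ← e1 t ht, sub_sub_cancel]
  have hw := fun l => weight_nonneg hc.le 0 l
  have hKε : StrongJet m (fun l => ε * (2 * b) * weight c 0 l) J fun t => (ε : ℂ) • K t :=
    hK'.mono_bound fun l _ => by
      rw [Complex.norm_real, Real.norm_of_nonneg hε.le]
      exact (by ring : _ = _).le
  have hY := (hR.mul_weight hKε hc.le ha.le (by positivity)).neg
  refine hR'.of_fixedPoint (y := 8 * a * (ε * (2 * b))) hc ha (by positivity) (by linarith) hR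
    hY fun t ht => ?_
  rw [neg_mul, ← e1 t ht, neg_sub, add_sub_cancel]

theorem LocalData.jet_perturbed_sub (h : LocalData n A γ a c ℓ J Γ S T) (hmn : m ≤ n) (ha : 0 < a)
    (hb : 0 < b) (hc : 0 < c) (hε : 0 < ε) (hε1 : 256 * ε * a * b ≤ 1)
    (hK : StrongJet m (fun l => 2 * b * weight c 0 l) J K) {z z' : ℂ} (hz : z ∈ Γ.ran)
    (hz' : z' ∈ Γ.ran) :
    StrongJet m (fun l => ‖z - z'‖ * (8 * (3 * a) * (3 * a) * weight c 0 l)) J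
      fun t => resolvent (perturbed A ε K t) z - resolvent (perturbed A ε K t) z' := by
  have h1 := h.jet_perturbed hmn ha hb hc hε hε1 hK hz
  have h2 := h.jet_perturbed hmn ha hb hc hε hε1 hK hz'
  have h3 := (h1.mul_weight h2 hc.le (by positivity) (by positivity)).smul (z' - z)
  rw [norm_sub_rev] at h3
  refine h3.congr fun t ht => ?_
  exact resolvent_sub
    (isResolventAt_resolvent (h.perturbed_resolvent ha hε hε1 hK ht (h.notMem hz).1
      (h.notMem hz).2).1)
    (isResolventAt_resolvent (h.perturbed_resolvent ha hε hε1 hK ht (h.notMem hz').1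
      (h.notMem hz').2).1)

end Local

section Global

variable {K K' : ℝ → X →L[ℂ] X}

/-- The Riesz projections of the perturbed operators are as smooth as the perturbation. -/
theorem IterationData.jet_cauchy (h : IterationData n A γ P a b c ℓ) (hmn : m ≤ n) (ha : 0 < a)
    (hb : 0 < b) (hc : 0 < c) (hε : 0 < ε) (hε1 : 256 * ε * a * b ≤ 1)
    (hK : StrongJet m (fun l => 2 * b * weight c 0 l) (Icc 0 1) K) :
    StrongJet m (fun l => 3 * a * ℓ * weight c 0 l) (Icc 0 1)
      fun t => cauchy (γ t) (resolvent (perturbed A ε K t)) := by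
  refine StrongJet.of_locally fun t₀ ht₀ => ?_
  obtain ⟨J, hJ, Γ, S, T, hJn, hL⟩ := h.exists_local t₀ ht₀
  refine ⟨J, hJ, hJn, hL.uniqueDiffOn, ?_⟩
  have hKJ := hK.mono_set hJ
  have h1 := StrongJet.cauchy (γ := Γ) hL.uniqueDiffOn hL.convex
    (fun z hz => hL.jet_perturbed hmn ha hb hc hε hε1 hKJ hz)
    (fun z hz z' hz' => hL.jet_perturbed_sub hmn ha hb hc hε hε1 hKJ hz hz')
  refine (h1.congr fun t ht => ?_).mono_bound fun l _ => ?_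
  · exact (hL.separatesSpectrum ha hε hε1 hKJ ht).cauchy_eq (hL.encloses_cycle t ht) hL.encloses
  · have := mul_le_mul_of_nonneg_right hL.length_le
      (mul_nonneg (by positivity : 0 ≤ 3 * a) (weight_nonneg hc.le 0 l))
    linarith

/-- The dependence of the Riesz projections on the perturbation. -/
theorem IterationData.jet_cauchy_sub (h : IterationData n A γ P a b c ℓ) (hmn : m ≤ n)
    (ha : 0 < a) (hb : 0 < b) (hc : 0 < c) (hε : 0 < ε) (hε1 : 256 * ε * a * b ≤ 1)
    (hK : StrongJet m (fun l => 2 * b * weight c 0 l) (Icc 0 1) K)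
    (hK' : StrongJet m (fun l => 2 * b * weight c 0 l) (Icc 0 1) K') {δ : ℝ} {k : ℕ} (hδ : 0 ≤ δ)
    (hd : StrongJet m (fun l => δ * weight c k l) (Icc 0 1) fun t => K' t - K t) :
    StrongJet m (fun l => 576 * a ^ 2 * ℓ * ε * δ * weight c k l) (Icc 0 1)
      fun t => cauchy (γ t) (resolvent (perturbed A ε K' t)) -
        cauchy (γ t) (resolvent (perturbed A ε K t)) := by
  refine StrongJet.of_locally fun t₀ ht₀ => ?_
  obtain ⟨J, hJ, Γ, S, T, hJn, hL⟩ := h.exists_local t₀ ht₀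
  refine ⟨J, hJ, hJn, hL.uniqueDiffOn, ?_⟩
  have hKJ := hK.mono_set hJ
  have hKJ' := hK'.mono_set hJ
  have hdJ := hd.mono_set hJ
  have hF : ∀ z ∈ Γ.ran, StrongJet m (fun l => 576 * a ^ 2 * ε * δ * weight c k l) J
      fun t => resolvent (perturbed A ε K' t) z - resolvent (perturbed A ε K t) z := by
    intro z hz
    have h1 := hL.jet_perturbed hmn ha hb hc hε hε1 hKJ hz
    have h2 := hL.jet_perturbed hmn ha hb hc hε hε1 hKJ' hz
    have h3 := h2.mul_weight hdJ hc.le (by positivity) hδ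
    have h4 := h3.mul_weight h1 hc.le (by positivity) (by positivity)
    refine ((h4.smul (-(ε : ℂ))).congr fun t ht => ?_).mono_bound fun l _ => ?_
    · obtain ⟨hzS, hzT⟩ := hL.notMem hz
      refine (resolvent_addBdd_sub
        (isResolventAt_resolvent (hL.perturbed_resolvent ha hε hε1 hKJ' ht hzS hzT).1)
        (isResolventAt_resolvent (hL.perturbed_resolvent ha hε hε1 hKJ ht hzS hzT).1)).trans ?_
      have e : -((ε : ℂ) • K' t) - -((ε : ℂ) • K t) = -(ε : ℂ) • (K' t - K t) := by
        rw [neg_smul, smul_sub]; abel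
      rw [e, mul_smul_comm, smul_mul_assoc]
      rfl
    · rw [norm_neg, Complex.norm_real, Real.norm_of_nonneg hε.le, zero_add, add_zero]
      apply le_of_eq
      ring
  have h1 := StrongJet.cauchy (γ := Γ)
    (g := fun l => 8 * (3 * a) * (3 * a) * weight c 0 l + 8 * (3 * a) * (3 * a) * weight c 0 l)
    hL.uniqueDiffOn hL.convex hF (fun z hz z' hz' => by
      have h5 := (hL.jet_perturbed_sub hmn ha hb hc hε hε1 hKJ' hz hz').sub
        (hL.jet_perturbed_sub hmn ha hb hc hε hε1 hKJ hz hz')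
      refine (h5.congr fun t ht => ?_).mono_bound fun l _ => ?_
      · abel
      · rw [mul_add])
  refine (h1.congr fun t ht => ?_).mono_bound fun l _ => ?_
  · have s1 := hL.separatesSpectrum ha hε hε1 hKJ ht
    have s2 := hL.separatesSpectrum ha hε hε1 hKJ' ht
    rw [s1.cauchy_eq (hL.encloses_cycle t ht) hL.encloses,
      s2.cauchy_eq (hL.encloses_cycle t ht) hL.encloses]
    exact (cauchy_sub ((continuousOn_resolvent _).mono (hL.encloses.ran_subset s2))
      ((continuousOn_resolvent _).mono (hL.encloses.ran_subset s1))).symm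
  · have := mul_le_mul_of_nonneg_right hL.length_le
      (mul_nonneg (by positivity : 0 ≤ 576 * a ^ 2 * ε * δ) (weight_nonneg hc.le k l))
    linarith

end Global

/-- The growth rate `θ` of the iteration: passing from one stage to the next costs a factor `θ ε`. It is
the product `32 c * (3 a ℓ) * (576 a² ℓ)` of the constants in `StrongJet.derivComm_sub`,
`IterationData.jet_cauchy` and `IterationData.jet_cauchy_sub`. -/
def growth (a c ℓ : ℝ) : ℝ := 55296 * c * a ^ 3 * ℓ ^ 2

/-- The key estimate: the successive differences of the operators `K_{k ε}` and their derivatives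
are bounded by `(θ ε)^k`, up to the weights. -/
theorem IterationData.jet_prevK_sub (h : IterationData n A γ P a b c ℓ) (ha : 0 < a) (hb : 0 < b)
    (hc : 0 < c) (hℓ : 0 < ℓ) (hε : 0 < ε) (hε1 : 256 * ε * a * b ≤ 1)
    (hθ1 : growth a c ℓ * ε * n ≤ 1 / 2) (k : ℕ) (hk : k ≤ n) :
    StrongJet (n - k) (fun l => b * (growth a c ℓ * ε) ^ k * weight c k l) (Icc 0 1)
      fun t => prevK γ A ε (k + 1) t - prevK γ A ε k t := by
  have hθ : 0 ≤ growth a c ℓ * ε := by unfold growth; positivity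
  induction k using Nat.strong_induction_on with
  | _ k ih =>
    cases k with
    | zero =>
      refine (h.jet.congr fun t ht => ?_).mono_bound fun l _ => by rw [pow_zero, mul_one]
      simp only [prevK, sub_zero, iterK]
      refine derivComm_congr (fun s hs => ?_) ht
      exact h.cauchy_eq s hs
    | succ k =>
      have ih' : ∀ j < k + 1, StrongJet (n - j)
          (fun l => b * (growth a c ℓ * ε) ^ j * weight c j l) (Icc 0 1)
          fun t => prevK γ A ε (j + 1) t - prevK γ A ε j t := fun j hj => ih j hj (by omega)
      obtain ⟨m, hm⟩ : ∃ m, n - k = m + 1 := ⟨n - k - 1, by omega⟩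
      have hm' : n - (k + 1) = m := by omega
      have hK := jet_prevK (m := m + 1) hb hc hθ hθ1 (k := k) (by omega)
        fun j hj => ih' j (by omega)
      have hK' := jet_prevK (m := m + 1) hb hc hθ hθ1 (k := k + 1) (by omega) ih'
      have hδ := ih' k (by omega)
      rw [hm] at hδ
      have hδ0 : 0 ≤ b * (growth a c ℓ * ε) ^ k := by positivity
      have hmn : m + 1 ≤ n := by omega
      have h1 := h.jet_cauchy hmn ha hb hc hε hε1 hK
      have h2 := h.jet_cauchy hmn ha hb hc hε hε1 hK'
      have h3 := h.jet_cauchy_sub hmn ha hb hc hε hε1 hK hK' hδ0 hδ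
      rw [hm']
      have h4 := StrongJet.derivComm_sub hc.le (by positivity) (by positivity) h1 h2 h3
      refine (h4.congr fun t _ => ?_).mono_bound fun l _ => ?_
      · change derivComm (iterP γ A ε (k + 1)) t - derivComm (iterP γ A ε k) t = _
        rw [iterP_eq γ A ε (k + 1), iterP_eq γ A ε k]
      · apply le_of_eq
        rw [pow_succ, growth]
        ring

/-- The outcome of the iteration at the last stage `n`. -/
theorem IterationData.iterate (h : IterationData n A γ P a b c ℓ) (hn : 1 ≤ n) (ha : 0 < a)
    (hb : 0 < b) (hc : 0 < c) (hℓ : 0 < ℓ) (hε : 0 < ε) (hε1 : 256 * ε * a * b ≤ 1)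
    (hθ1 : growth a c ℓ * ε * n ≤ 1 / 2) :
    IterWellDefined γ A ε n ∧
    (∀ t ∈ Icc (0 : ℝ) 1, ‖iterP γ A ε n t - P t‖ ≤ 1152 * a ^ 2 * b * ℓ * ε) ∧
    StrongJet 1 (fun l => 3 * a * ℓ * weight c 0 l) (Icc 0 1) (iterP γ A ε n) ∧
    (∀ t ∈ Icc (0 : ℝ) 1, IsIdempotentElem (iterP γ A ε n t)) ∧
    (∀ t ∈ Icc (0 : ℝ) 1, ∀ x v, Acts (iterA γ A ε n t) x v →
      Acts (iterA γ A ε n t) (iterP γ A ε n t x) (iterP γ A ε n t v)) ∧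
    ∀ t ∈ Icc (0 : ℝ) 1, ‖iterK γ A ε n t - prevK γ A ε n t‖ ≤
      b * (growth a c ℓ * ε) ^ n * n.factorial := by
  have hθ : 0 ≤ growth a c ℓ * ε := by unfold growth; positivity
  have hΔ := h.jet_prevK_sub ha hb hc hℓ hε hε1 hθ1
  have hK1 : ∀ k ≤ n, StrongJet 1 (fun l => 2 * b * weight c 0 l) (Icc 0 1) (prevK γ A ε k) :=
    fun k hk => jet_prevK hb hc hθ hθ1 (by omega) fun j hj => hΔ j (by omega)
  have hP1 : ∀ k ≤ n, StrongJet 1 (fun l => 3 * a * ℓ * weight c 0 l) (Icc 0 1) (iterP γ A ε k) :=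
    fun k hk => by
      rw [iterP_eq]
      exact h.jet_cauchy hn ha hb hc hε hε1 (hK1 k hk)
  have hsep : ∀ k ≤ n, ∀ t ∈ Icc (0 : ℝ) 1, ∃ S T, SeparatesSpectrum (iterA γ A ε k t) S T ∧
      Encloses (γ t) S T := by
    intro k hk t ht
    obtain ⟨J, hJ, Γ, S, T, hJn, hL⟩ := h.exists_local t ht
    have htJ := mem_of_mem_nhdsWithin ht hJn
    refine ⟨S, T, ?_, hL.encloses_cycle t htJ⟩
    rw [iterA_eq]
    exact hL.separatesSpectrum ha hε hε1 ((hK1 k hk).mono_set hJ) htJ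
  refine ⟨fun j hj => ⟨fun t ht => ?_, (hP1 j hj).strongContDiffOn_one uniqueDiffOn_unitInterval⟩,
    fun t ht => ?_, hP1 n le_rfl, fun t ht => ?_, fun t ht x v hxv => ?_, fun t ht => ?_⟩
  · obtain ⟨S, T, h1, h2⟩ := hsep j hj t ht
    exact h2.ran_subset h1
  · have h1 : ∀ k < n, ‖iterP γ A ε (k + 1) t - iterP γ A ε k t‖ ≤
        576 * a ^ 2 * ℓ * ε * b * (1 / 2) ^ k := by
      intro k hk
      have hδ0 : 0 ≤ b * (growth a c ℓ * ε) ^ k := by positivity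
      have h2 := (h.jet_cauchy_sub hn ha hb hc hε hε1 (hK1 k hk.le) (hK1 (k + 1) hk) hδ0
        ((hΔ k hk.le).mono_order (by omega))).norm_le t ht
      have h3 := pow_mul_weight_le hc.le hθ (k := k) (l := 0) (n := n) (by omega)
      have h4 : (growth a c ℓ * ε * n) ^ k ≤ (1 / 2) ^ k := pow_le_pow_left₀ (by positivity) hθ1 k
      have h5 : weight c 0 0 = 1 := by simp [weight_zero_right]
      rw [h5, mul_one] at h3
      rw [iterP_eq γ A ε (k + 1), iterP_eq γ A ε k]
      refine h2.trans ?_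
      calc _ = 576 * a ^ 2 * ℓ * ε * b * ((growth a c ℓ * ε) ^ k * weight c k 0) := by ring
        _ ≤ _ := mul_le_mul_of_nonneg_left (h3.trans h4) (by positivity)
    have h0 : iterP γ A ε 0 t = P t := h.cauchy_eq t ht
    rw [← h0, ← Finset.sum_range_sub (fun k => iterP γ A ε k t)]
    refine (norm_sum_le _ _).trans
      ((Finset.sum_le_sum fun k hk => h1 k (Finset.mem_range.1 hk)).trans ?_)
    rw [← Finset.mul_sum]
    have h6 : ∑ j ∈ Finset.range n, (1 / 2 : ℝ) ^ j ≤ 2 := sum_geometric_two_le n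
    have h7 : 0 ≤ 576 * a ^ 2 * ℓ * ε * b := by positivity
    nlinarith
  · obtain ⟨S, T, h1, h2⟩ := hsep n le_rfl t ht
    exact h1.isIdempotentElem h2
  · obtain ⟨S, T, h1, h2⟩ := hsep n le_rfl t ht
    obtain ⟨w, hw⟩ := h2.ran_nonempty h1.nonempty
    exact hxv.of_commute (h2.ran_subset h1 hw)
      (cauchy_resolvent_commute (h2.ran_subset h1) (h2.ran_subset h1 hw))
  · have h1 := (hΔ n le_rfl).norm_le t ht
    rwa [weight_zero_right] at h1

end Iteration

/-! ### Perturbation of evolution systems -/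

section EvolutionSystems

variable {X : Type*} [NormedAddCommGroup X] [NormedSpace ℂ X]

theorem isCompact_triangle : IsCompact {p : ℝ × ℝ | 0 ≤ p.1 ∧ p.1 ≤ p.2 ∧ p.2 ≤ 1} := by
  refine (isCompact_Icc.prod isCompact_Icc : IsCompact (Icc (0 : ℝ) 1 ×ˢ Icc (0 : ℝ) 1)).of_isClosed_subset
    ?_ fun p hp => ⟨⟨hp.1, hp.2.1.trans hp.2.2⟩, ⟨hp.1.trans hp.2.1, hp.2.2⟩⟩
  exact (isClosed_le continuous_const continuous_fst).inter
    ((isClosed_le continuous_fst continuous_snd).inter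
      (isClosed_le continuous_snd continuous_const))

namespace IsEvolutionSystem

variable {B : ℝ → X →ₗ.[ℂ] X} {U : ℝ → ℝ → X →L[ℂ] X} {s t : ℝ}

theorem exists_norm_bound [CompleteSpace X] (h : IsEvolutionSystem B U) :
    ∃ M, ∀ s t : ℝ, 0 ≤ s → s ≤ t → t ≤ 1 → ‖U t s‖ ≤ M := by
  obtain ⟨M, hM⟩ := exists_norm_bound_of_strongly_continuous isCompact_triangle h.continuous
  exact ⟨M, fun s t h0 hst h1 => hM (s, t) ⟨h0, hst, h1⟩⟩

theorem continuousOn_right (h : IsEvolutionSystem B U) (hs : 0 ≤ s) (x : X) :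
    ContinuousOn (fun τ => U τ s x) (Icc s 1) :=
  (h.continuous x).comp (f := fun τ => (s, τ)) (by fun_prop) fun _ hτ => ⟨hs, hτ.1, hτ.2⟩

theorem continuousOn_left (h : IsEvolutionSystem B U) (ht : t ≤ 1) (x : X) :
    ContinuousOn (fun τ => U t τ x) (Icc 0 t) :=
  (h.continuous x).comp (f := fun τ => (τ, t)) (by fun_prop) fun _ hτ => ⟨hτ.1, hτ.2, ht⟩

theorem self_eq_one (h : IsEvolutionSystem B U)
    (hd : ∀ t ∈ Icc (0 : ℝ) 1, Dense ((B t).domain : Set X)) (hs : s ∈ Icc (0 : ℝ) 1) :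
    U s s = 1 := by
  have h1 : ∀ s ∈ Ico (0 : ℝ) 1, U s s = 1 := fun s hs =>
    DFunLike.coe_injective (Continuous.ext_on (hd s ⟨hs.1, hs.2.le⟩) (U s s).continuous
      (1 : X →L[ℂ] X).continuous fun y hy => h.initial s hs y hy)
  rcases hs.2.lt_or_eq with h2 | rfl
  · exact h1 s ⟨hs.1, h2⟩
  ext x
  have h2 : ContinuousOn (fun τ => U τ τ x) (Icc (0 : ℝ) 1) :=
    (h.continuous x).comp (f := fun τ => (τ, τ)) (by fun_prop) fun τ hτ => ⟨hτ.1, le_rfl, hτ.2⟩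
  have h3 : Tendsto (fun τ => U τ τ x) (𝓝[Ico (0 : ℝ) 1] 1) (𝓝 (U 1 1 x)) :=
    (h2 1 hs).tendsto.mono_left (nhdsWithin_mono _ Ico_subset_Icc_self)
  have h4 : (𝓝[Ico (0 : ℝ) 1] 1).NeBot := by
    rw [nhdsWithin_Ico_eq_nhdsLT zero_lt_one]
    infer_instance
  refine tendsto_nhds_unique h3 (tendsto_const_nhds.congr' ?_)
  filter_upwards [self_mem_nhdsWithin] with τ hτ
  rw [h1 τ hτ]

/-- Duhamel's principle: approximate solutions of `x' = B x` are close to exact ones. -/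
theorem norm_sub_le_of_approx (h : IsEvolutionSystem B U)
    (hd : ∀ t ∈ Icc (0 : ℝ) 1, Dense ((B t).domain : Set X)) {M δ : ℝ}
    (hM : ∀ s t : ℝ, 0 ≤ s → s ≤ t → t ≤ 1 → ‖U t s‖ ≤ M) (hs : 0 ≤ s) {x r : ℝ → X}
    (hx : ContinuousOn x (Icc s 1))
    (hx' : ∀ τ ∈ Ico s 1, ∃ v, Acts (B τ) (x τ) v ∧ HasDerivWithinAt x (v + r τ) (Ici τ) τ)
    (hr : ∀ τ ∈ Ico s 1, ‖r τ‖ ≤ δ) (ht : t ∈ Icc s 1) :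
    ‖x t - U t s (x s)‖ ≤ M * δ * (t - s) := by
  have hself : U t t = 1 := h.self_eq_one hd ⟨hs.trans ht.1, ht.2⟩
  have hcont : ContinuousOn (fun τ => U t τ (x τ)) (Icc s t) := fun τ hτ => by
    refine tendsto_clm_apply (B := fun τ => U t τ) (K := M) ?_
      (((h.continuousOn_left ht.2 (x τ)).mono (Icc_subset_Icc_left hs)) τ hτ)
      ((hx.mono (Icc_subset_Icc_right ht.2)) τ hτ)
    filter_upwards [self_mem_nhdsWithin] with σ hσ using hM _ _ (hs.trans hσ.1) hσ.2 ht.2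
  have hderiv : ∀ τ ∈ Ico s t,
      HasDerivWithinAt (fun τ => U t τ (x τ)) (U t τ (r τ)) (Ici τ) τ := by
    intro τ hτ
    have hτ0 : 0 ≤ τ := hs.trans hτ.1
    have hτ1 : τ < 1 := hτ.2.trans_le ht.2
    have hUτ : U τ τ = 1 := h.self_eq_one hd ⟨hτ0, hτ1.le⟩
    obtain ⟨v, ⟨hv, rfl⟩, hv'⟩ := hx' τ ⟨hτ.1, hτ1⟩
    obtain ⟨hw, hw'⟩ := h.solves τ ⟨hτ0, hτ1⟩ (x τ) hv τ ⟨le_rfl, hτ1.le⟩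
    have e : B τ ⟨U τ τ (x τ), hw⟩ = B τ ⟨x τ, hv⟩ := by
      congr 2
      rw [hUτ]
      rfl
    rw [e] at hw'
    -- the deviation from the exact solution starting at `x τ`
    have h1 : HasDerivWithinAt (fun σ => x σ - U σ τ (x τ)) (r τ) (Icc τ t) τ := by
      have := (hv'.mono Icc_subset_Ici_self).sub (hw'.mono (Icc_subset_Icc_right ht.2))
      rwa [add_sub_cancel_left] at this
    have h0 : x τ - U τ τ (x τ) = 0 := by rw [hUτ]; exact sub_self _
    have h2 := hasDerivWithinAt_clm_apply (B := fun σ => U t σ) (B' := 0) (K := M)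
      (fun σ hσ => hM σ t (hτ0.trans hσ.1) hσ.2 ht.2)
      (((h.continuousOn_left ht.2 (r τ)).mono (Icc_subset_Icc_left hτ0)) τ ⟨le_rfl, hτ.2.le⟩)
      (by
        simp only [h0, map_zero]
        exact hasDerivWithinAt_const _ _ _) h1
    rw [zero_add] at h2
    have h3 := h2.add_const (U t τ (x τ))
    refine (h3.congr (fun σ hσ => ?_) ?_).mono_of_mem_nhdsWithin (Icc_mem_nhdsGE hτ.2)
    · have e2 := congrArg (fun T : X →L[ℂ] X => T (x τ)) (h.cocycle τ σ t hτ0 hσ.1 hσ.2 ht.2)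
      change U t σ (U σ τ (x τ)) = U t τ (x τ) at e2
      rw [map_sub, e2, sub_add_cancel]
    · rw [h0, map_zero, zero_add]
  have key := norm_image_sub_le_of_norm_deriv_right_le_segment (C := M * δ) hcont hderiv
    (fun τ hτ => ((U t τ).le_opNorm _).trans (mul_le_mul
      (hM τ t (hs.trans hτ.1) hτ.2.le ht.2) (hr τ ⟨hτ.1, hτ.2.trans_le ht.2⟩) (norm_nonneg _)
      ((norm_nonneg _).trans (hM τ t (hs.trans hτ.1) hτ.2.le ht.2)))) t ⟨ht.1, le_rfl⟩
  rwa [hself] at key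

/-- Operators `D(t)` that intertwine two families of generators up to a bounded error `E` intertwine
the corresponding evolutions up to an error controlled by `D' - E`. -/
theorem norm_intertwine_le [CompleteSpace X] {B' : ℝ → X →ₗ.[ℂ] X} {W : ℝ → ℝ → X →L[ℂ] X}
    {D D' E : ℝ → X →L[ℂ] X} {M K δ : ℝ} (h : IsEvolutionSystem B U) (h' : IsEvolutionSystem B' W)
    (hd : ∀ t ∈ Icc (0 : ℝ) 1, Dense ((B t).domain : Set X))
    (hd' : ∀ t ∈ Icc (0 : ℝ) 1, Dense ((B' t).domain : Set X))
    (hM : ∀ s t : ℝ, 0 ≤ s → s ≤ t → t ≤ 1 → ‖U t s‖ ≤ M)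
    (hK : ∀ s t : ℝ, 0 ≤ s → s ≤ t → t ≤ 1 → ‖W t s‖ ≤ K)
    (hD : ∀ t ∈ Icc (0 : ℝ) 1, ∀ x, HasDerivWithinAt (fun s => D s x) (D' t x) (Icc 0 1) t)
    (hE : ∀ t ∈ Icc (0 : ℝ) 1, ∀ x v, Acts (B' t) x v → Acts (B t) (D t x) (D t v + E t x))
    (hδ : ∀ t ∈ Icc (0 : ℝ) 1, ‖D' t - E t‖ ≤ δ) (hs : 0 ≤ s) (hst : s ≤ t) (ht : t ≤ 1) :
    ‖D t * W t s - U t s * D s‖ ≤ M * δ * K := by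
  have hM0 : 0 ≤ M := (norm_nonneg _).trans (hM s t hs hst ht)
  have hK0 : 0 ≤ K := (norm_nonneg _).trans (hK s t hs hst ht)
  have hδ0 : 0 ≤ δ := (norm_nonneg _).trans (hδ s ⟨hs, hst.trans ht⟩)
  have hsI : s ∈ Icc (0 : ℝ) 1 := ⟨hs, hst.trans ht⟩
  rcases hsI.2.lt_or_eq with hs1 | rfl
  swap
  · obtain rfl : t = 1 := le_antisymm ht hst
    rw [h.self_eq_one hd hsI, h'.self_eq_one hd' hsI, one_mul, mul_one, sub_self, norm_zero]
    positivity
  have hDc : ∀ x, ContinuousOn (fun t => D t x) (Icc 0 1) := fun x t ht =>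
    (hD t ht x).continuousWithinAt
  obtain ⟨N, hN⟩ := exists_norm_bound_of_strongly_continuous isCompact_Icc hDc
  have hsub : ∀ τ ∈ Icc s 1, τ ∈ Icc (0 : ℝ) 1 := fun τ hτ => ⟨hs.trans hτ.1, hτ.2⟩
  refine ContinuousLinearMap.opNorm_le_bound _ (by positivity) fun y => ?_
  have hcl : IsClosed {y | ‖(D t * W t s - U t s * D s) y‖ ≤ M * δ * K * ‖y‖} :=
    isClosed_le (by fun_prop) (by fun_prop)
  refine hcl.closure_subset_iff.2 (fun y hy => ?_) (hd' s hsI y)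
  have key := h.norm_sub_le_of_approx hd hM (δ := δ * (K * ‖y‖)) hs (x := fun τ => D τ (W τ s y))
    (r := fun τ => (D' τ - E τ) (W τ s y)) ?_ ?_ ?_ ⟨hst, ht⟩
  · have hss : W s s y = y := by rw [h'.self_eq_one hd' hsI]; rfl
    simp only [hss] at key
    refine key.trans ?_
    have h1 : 0 ≤ M * (δ * (K * ‖y‖)) := by positivity
    calc _ ≤ M * (δ * (K * ‖y‖)) * 1 := mul_le_mul_of_nonneg_left (by linarith) h1
      _ = _ := by ring
  · intro τ hτ
    refine tendsto_clm_apply (B := D) (K := N) ?_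
      ((hDc (W τ s y)).mono (fun τ hτ => hsub τ hτ) τ hτ) (h'.continuousOn_right hs y τ hτ)
    filter_upwards [self_mem_nhdsWithin] with σ hσ using hN σ (hsub σ hσ)
  · intro τ hτ
    have hτ' : τ ∈ Icc s 1 := ⟨hτ.1, hτ.2.le⟩
    obtain ⟨hw, hw'⟩ := h'.solves s ⟨hs, hs1⟩ y hy τ hτ'
    refine ⟨_, hE τ (hsub τ hτ') _ _ ⟨hw, rfl⟩, ?_⟩
    have h1 := hasDerivWithinAt_clm_apply (B := D) (K := N) (fun σ hσ => hN σ (hsub σ hσ))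
      ((hDc _).mono (fun τ hτ => hsub τ hτ) τ hτ')
      ((hD τ (hsub τ hτ') (W τ s y)).mono fun σ hσ => hsub σ hσ) hw'
    have h2 := h1.mono (Icc_subset_Icc_left hτ.1)
    refine (h2.mono_of_mem_nhdsWithin (Icc_mem_nhdsGE hτ.2)).congr_deriv ?_
    rw [sub_apply]
    abel
  · intro τ hτ
    have hτ' : τ ∈ Icc s 1 := ⟨hτ.1, hτ.2.le⟩
    refine ((D' τ - E τ).le_opNorm _).trans (mul_le_mul (hδ τ (hsub τ hτ')) ?_ (norm_nonneg _) hδ0)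
    exact ((W τ s).le_opNorm _).trans
      (mul_le_mul_of_nonneg_right (hK s τ hs hτ.1 hτ.2.le) (norm_nonneg _))

end IsEvolutionSystem

/-- The derivative of a projection valued function is off-diagonal, so that it is recovered from
`[P', P]`. -/
theorem strongDeriv_eq_commutator {Q : ℝ → X →L[ℂ] X} {f : ℕ → ℝ}
    (hQ : StrongJet 1 f (Icc 0 1) Q) (hi : ∀ t ∈ Icc (0 : ℝ) 1, IsIdempotentElem (Q t)) {t : ℝ}
    (ht : t ∈ Icc (0 : ℝ) 1) :
    derivComm Q t * Q t - Q t * derivComm Q t = strongDeriv Q t := by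
  have hQQ : Q t * Q t = Q t := hi t ht
  have h1 : strongDeriv Q t = strongDeriv Q t * Q t + Q t * strongDeriv Q t := by
    refine strongDeriv_eq ht fun x => ?_
    have h2 := hasDerivWithinAt_clm_apply (B := Q) (fun s hs => hQ.norm_le s hs)
      (hQ.continuousOn (strongDeriv Q t x) t ht)
      (hQ.hasDerivWithinAt_strongDeriv (Q t x) ht) (hQ.hasDerivWithinAt_strongDeriv x ht)
    refine h2.congr (fun s hs => ?_) ?_
    · exact (congrArg (fun T : X →L[ℂ] X => T x) (hi s hs)).symm
    · exact (congrArg (fun T : X →L[ℂ] X => T x) (hi t ht)).symm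
  set Q' := strongDeriv Q t with hQ'
  have h3 : Q t * Q' * Q t = 0 := by
    have h4 := congrArg (fun T => Q t * T) h1
    simp only [mul_add] at h4
    rw [← mul_assoc, ← mul_assoc, hQQ] at h4
    simpa using h4
  rw [derivComm, ← hQ']
  calc _ = Q' * (Q t * Q t) - Q t * Q' * Q t - (Q t * Q' * Q t - Q t * Q t * Q') := by noncomm_ring
    _ = Q' * Q t + Q t * Q' := by rw [hQQ, h3]; abel
    _ = Q' := h1.symm

end EvolutionSystems

/-! ### Adiabatic estimates -/

section Estimates

variable {X : Type*} [NormedAddCommGroup X] [NormedSpace ℂ X]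

variable {n : ℕ} {A : ℝ → X →ₗ.[ℂ] X} {γ : ℝ → Cycle} {P : ℝ → X →L[ℂ] X}
  {a b c ℓ ε M : ℝ}

theorem domain_iterA (t : ℝ) : (iterA γ A ε n t).domain = (A t).domain := by
  rw [iterA_eq]
  rfl

/-- `ε⁻¹ A = ε⁻¹ A_{n ε} + K_{n-1 ε}`. -/
theorem acts_smul_iterA (hε : 0 < ε) {t : ℝ} {x v : X} :
    Acts (((ε⁻¹ : ℝ) : ℂ) • A t) x v ↔
      Acts (((ε⁻¹ : ℝ) : ℂ) • iterA γ A ε n t) x (v - prevK γ A ε n t x) := by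
  have hε' : (ε : ℂ) ≠ 0 := Complex.ofReal_ne_zero.2 hε.ne'
  rw [iterA_eq, Complex.ofReal_inv]
  constructor
  · intro h
    have h1 := acts_of_smul (inv_ne_zero hε') h
    have h2 : Acts (perturbed A ε (prevK γ A ε n) t) x
        ((ε : ℂ) • (v - prevK γ A ε n t x)) := acts_addBdd.2 (by
      convert h1 using 1
      rw [inv_inv, neg_apply, smul_apply, smul_sub, sub_neg_eq_add, sub_add_cancel])
    have h3 := acts_smul (c := (ε : ℂ)⁻¹) h2
    rwa [inv_smul_smul₀ hε'] at h3
  · intro h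
    have h1 := acts_addBdd.1 (acts_of_smul (inv_ne_zero hε') h)
    have h3 := acts_smul (c := (ε : ℂ)⁻¹) h1
    convert h3 using 1
    rw [inv_inv, neg_apply, smul_apply, sub_neg_eq_add, ← smul_add, sub_add_cancel,
      inv_smul_smul₀ hε']

variable [CompleteSpace X] {U : ℝ → ℝ → X →L[ℂ] X}

/-- Evolutions whose generators differ by small bounded operators are close. -/
theorem IsEvolutionSystem.norm_sub_le_of_norm_le {B B' : ℝ → X →ₗ.[ℂ] X} {V : ℝ → ℝ → X →L[ℂ] X}
    {Δ : ℝ → X →L[ℂ] X} {δ : ℝ} (h : IsEvolutionSystem B U) (h' : IsEvolutionSystem B' V)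
    (hd : ∀ t ∈ Icc (0 : ℝ) 1, Dense ((B t).domain : Set X))
    (hd' : ∀ t ∈ Icc (0 : ℝ) 1, Dense ((B' t).domain : Set X))
    (hM : ∀ s t : ℝ, 0 ≤ s → s ≤ t → t ≤ 1 → ‖U t s‖ ≤ M)
    (hΔ : ∀ t ∈ Icc (0 : ℝ) 1, ‖Δ t‖ ≤ δ) (hMδ : M * δ ≤ 1 / 2)
    (hB : ∀ t ∈ Icc (0 : ℝ) 1, ∀ x v, Acts (B' t) x v → Acts (B t) x (v - Δ t x)) {s t : ℝ}
    (hs : 0 ≤ s) (hst : s ≤ t) (ht : t ≤ 1) : ‖V t s - U t s‖ ≤ M * δ * (2 * M) := by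
  have hδ0 : 0 ≤ δ := (norm_nonneg _).trans (hΔ 0 (by simp))
  have hM0 : 0 ≤ M := (norm_nonneg _).trans (hM s t hs hst ht)
  have key : ∀ K, (∀ s t : ℝ, 0 ≤ s → s ≤ t → t ≤ 1 → ‖V t s‖ ≤ K) →
      ∀ s t : ℝ, 0 ≤ s → s ≤ t → t ≤ 1 → ‖V t s - U t s‖ ≤ M * δ * K := by
    intro K hK s t hs hst ht
    have := h.norm_intertwine_le h' hd hd' hM hK (D := fun _ => 1) (D' := fun _ => 0)
      (E := fun t => -Δ t) (δ := δ) (fun t _ x => hasDerivWithinAt_const _ _ _)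
      (fun t ht x v hxv => by simpa [sub_eq_add_neg] using hB t ht x v hxv)
      (fun t ht => by simpa using hΔ t ht) hs hst ht
    simpa using this
  -- the least bound for `V` satisfies `K ≤ M + M δ K`
  obtain ⟨K₀, hK₀⟩ := h'.exists_norm_bound
  set S := (fun p : ℝ × ℝ => ‖V p.2 p.1‖) '' {p : ℝ × ℝ | 0 ≤ p.1 ∧ p.1 ≤ p.2 ∧ p.2 ≤ 1} with hS
  have hbdd : BddAbove S := ⟨K₀, by rintro _ ⟨p, hp, rfl⟩; exact hK₀ _ _ hp.1 hp.2.1 hp.2.2⟩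
  have hne : S.Nonempty := ⟨_, (s, t), ⟨hs, hst, ht⟩, rfl⟩
  have hK : ∀ s t : ℝ, 0 ≤ s → s ≤ t → t ≤ 1 → ‖V t s‖ ≤ sSup S := fun s t hs hst ht =>
    le_csSup hbdd ⟨(s, t), ⟨hs, hst, ht⟩, rfl⟩
  have hK0 : 0 ≤ sSup S := (norm_nonneg _).trans (hK s t hs hst ht)
  have h1 : sSup S ≤ M + M * δ * sSup S := by
    refine csSup_le hne ?_
    rintro _ ⟨p, hp, rfl⟩
    have h2 := key _ hK _ _ hp.1 hp.2.1 hp.2.2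
    have h3 := hM _ _ hp.1 hp.2.1 hp.2.2
    have h4 := norm_add_le (U p.2 p.1) (V p.2 p.1 - U p.2 p.1)
    rw [add_sub_cancel] at h4
    exact h4.trans (add_le_add h3 h2)
  have h5 : sSup S ≤ 2 * M := by nlinarith
  exact (key _ hK s t hs hst ht).trans (mul_le_mul_of_nonneg_left h5 (by positivity))

/-- The constant in the adiabatic estimates: `2 M ^ 2` for the distance of the evolutions and
`(1 + p) * 2 p * M ^ 2` for the transitions, where `p = 3 a ℓ` bounds the norm of `P_{n ε}`. -/
def adiabaticConst (a ℓ M : ℝ) : ℝ := 2 * M ^ 2 + (1 + 3 * a * ℓ) * (6 * a * ℓ) * M ^ 2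

/-- The adiabatic estimates at the last stage `n` of the iteration: all errors are controlled by
`K_{n ε} - K_{n-1 ε}`. -/
theorem IterationData.adiabatic (h : IterationData n A γ P a b c ℓ) (hn : 1 ≤ n) (ha : 0 < a)
    (hb : 0 < b) (hc : 0 < c) (hℓ : 0 < ℓ) (hε : 0 < ε) (hε1 : 256 * ε * a * b ≤ 1)
    (hθ1 : growth a c ℓ * ε * n ≤ 1 / 2)
    (hd : ∀ t ∈ Icc (0 : ℝ) 1, Dense ((A t).domain : Set X))
    (hU : IsEvolutionSystem (fun t => ((ε⁻¹ : ℝ) : ℂ) • A t) U)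
    (hM : ∀ s t : ℝ, 0 ≤ s → s ≤ t → t ≤ 1 → ‖U t s‖ ≤ M) {δ : ℝ}
    (hδ : b * (growth a c ℓ * ε) ^ n * n.factorial ≤ δ) (hMδ : M * δ ≤ 1 / 2) :
    IterWellDefined γ A ε n ∧
    (∀ t ∈ Icc (0 : ℝ) 1, ‖iterP γ A ε n t - P t‖ ≤ 1152 * a ^ 2 * b * ℓ * ε) ∧
    (∀ V : ℝ → ℝ → X →L[ℂ] X,
      IsEvolutionSystem
        (fun t => addBdd (((ε⁻¹ : ℝ) : ℂ) • iterA γ A ε n t) (iterK γ A ε n t)) V →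
      IsAdiabatic V (iterP γ A ε n) ∧
      ∀ t ∈ Icc (0 : ℝ) 1, ‖V t 0 - U t 0‖ ≤ adiabaticConst a ℓ M * δ) ∧
    (∀ t ∈ Icc (0 : ℝ) 1,
      ‖(1 - iterP γ A ε n t) * U t 0 * iterP γ A ε n 0‖ ≤ adiabaticConst a ℓ M * δ ∧
      ‖iterP γ A ε n t * U t 0 * (1 - iterP γ A ε n 0)‖ ≤ adiabaticConst a ℓ M * δ) := by
  obtain ⟨h1, h2, hQ, hi, hcomm, hΔ⟩ := h.iterate hn ha hb hc hℓ hε hε1 hθ1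
  have hε' : (((ε⁻¹ : ℝ) : ℂ)) ≠ 0 := Complex.ofReal_ne_zero.2 (inv_pos.2 hε).ne'
  set Q := iterP γ A ε n with hQdef
  set p := 3 * a * ℓ with hp
  have hp0 : 0 < p := by positivity
  have hM0 : 0 ≤ M := (norm_nonneg _).trans (hM 0 0 le_rfl le_rfl zero_le_one)
  have hδ0 : 0 ≤ δ := le_trans (by unfold growth; positivity) hδ
  have hΔ' : ∀ t ∈ Icc (0 : ℝ) 1, ‖iterK γ A ε n t - prevK γ A ε n t‖ ≤ δ := fun t ht =>
    (hΔ t ht).trans hδ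
  have hQn : ∀ t ∈ Icc (0 : ℝ) 1, ‖Q t‖ ≤ p := fun t ht => by
    have := hQ.norm_le t ht
    rwa [weight_zero_right, Nat.factorial_zero, Nat.cast_one, mul_one] at this
  have hone : ∀ T : X →L[ℂ] X, ‖T‖ ≤ p → ‖1 - T‖ ≤ 1 + p := fun T hT =>
    (norm_sub_le _ _).trans (add_le_add ContinuousLinearMap.norm_id_le hT)
  have hQd : ∀ t ∈ Icc (0 : ℝ) 1, ∀ x,
      HasDerivWithinAt (fun s => Q s x) (strongDeriv Q t x) (Icc 0 1) t := fun t ht x =>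
    hQ.hasDerivWithinAt_strongDeriv x ht
  have hcomm' : ∀ t ∈ Icc (0 : ℝ) 1, ∀ x v, Acts (((ε⁻¹ : ℝ) : ℂ) • iterA γ A ε n t) x v →
      Acts (((ε⁻¹ : ℝ) : ℂ) • iterA γ A ε n t) (Q t x) (Q t v) := fun t ht x v hxv => by
    have h3 := acts_smul (c := ((ε⁻¹ : ℝ) : ℂ)) (hcomm t ht _ _ (acts_of_smul hε' hxv))
    rwa [map_smul, smul_inv_smul₀ hε'] at h3
  have hC1 : 2 * M ^ 2 * δ ≤ adiabaticConst a ℓ M * δ := by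
    refine mul_le_mul_of_nonneg_right ?_ hδ0
    rw [adiabaticConst]
    have : 0 ≤ (1 + 3 * a * ℓ) * (6 * a * ℓ) * M ^ 2 := by positivity
    linarith
  have hC2 : (1 + p) * (2 * p) * M ^ 2 * δ ≤ adiabaticConst a ℓ M * δ := by
    refine mul_le_mul_of_nonneg_right ?_ hδ0
    rw [adiabaticConst, hp]
    nlinarith [sq_nonneg M]
  refine ⟨h1, h2, fun V hV => ?_, fun t ht => ?_⟩
  · have hdV : ∀ t ∈ Icc (0 : ℝ) 1, Dense
        ((addBdd (((ε⁻¹ : ℝ) : ℂ) • iterA γ A ε n t) (iterK γ A ε n t)).domain : Set X) :=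
      fun t ht => by
        have := hd t ht
        rw [← domain_iterA (γ := γ) (ε := ε) (n := n)] at this
        exact this
    refine ⟨⟨hi, fun s t hs hst ht => ?_⟩, fun t ht => ?_⟩
    · obtain ⟨K, hK⟩ := hV.exists_norm_bound
      have h3 := hV.norm_intertwine_le hV hdV hdV hK hK hQd (δ := 0)
        (E := fun t => iterK γ A ε n t * Q t - Q t * iterK γ A ε n t)
        (fun t ht x v hxv => by
          refine acts_addBdd.2 ?_
          convert hcomm' t ht _ _ (acts_addBdd.1 hxv) using 1
          rw [sub_apply, map_sub]
          change Q t v + (iterK γ A ε n t (Q t x) - Q t (iterK γ A ε n t x)) -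
            iterK γ A ε n t (Q t x) = _
          abel)
        (fun t ht => by
          rw [← strongDeriv_eq_commutator hQ hi ht]
          exact (norm_eq_zero.2 (sub_self _)).le) hs hst ht
      rw [mul_zero, zero_mul] at h3
      exact sub_eq_zero.1 (norm_le_zero_iff.1 h3)
    · refine (hU.norm_sub_le_of_norm_le hV hd hdV hM hΔ' hMδ (fun t ht x v hxv => ?_)
        le_rfl ht.1 ht.2).trans (le_trans (by apply le_of_eq; ring) hC1)
      refine (acts_smul_iterA (γ := γ) (n := n) hε).2 ?_
      convert acts_addBdd.1 hxv using 1
      rw [sub_apply]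
      abel
  · have h0 : (0 : ℝ) ∈ Icc (0 : ℝ) 1 := ⟨le_rfl, zero_le_one⟩
    have h3 := hU.norm_intertwine_le hU hd hd hM hM hQd (δ := 2 * p * δ)
        (E := fun t => prevK γ A ε n t * Q t - Q t * prevK γ A ε n t)
        (fun t ht x v hxv => by
          refine (acts_smul_iterA (γ := γ) (n := n) hε).2 ?_
          convert hcomm' t ht _ _ ((acts_smul_iterA hε).1 hxv) using 1
          rw [sub_apply, map_sub]
          change Q t v + (prevK γ A ε n t (Q t x) - Q t (prevK γ A ε n t x)) -
            prevK γ A ε n t (Q t x) = _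
          abel)
        (fun t ht => by
          rw [← strongDeriv_eq_commutator hQ hi ht]
          change ‖iterK γ A ε n t * Q t - Q t * iterK γ A ε n t - _‖ ≤ _
          set Δ := iterK γ A ε n t - prevK γ A ε n t with hΔdef
          have e : iterK γ A ε n t * Q t - Q t * iterK γ A ε n t -
              (prevK γ A ε n t * Q t - Q t * prevK γ A ε n t) = Δ * Q t - Q t * Δ := by
            rw [hΔdef]; noncomm_ring
          rw [e]
          have h4 : ‖Δ * Q t‖ ≤ δ * p := (norm_mul_le _ _).trans
            (mul_le_mul (hΔ' t ht) (hQn t ht) (norm_nonneg _) hδ0)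
          have h5 : ‖Q t * Δ‖ ≤ p * δ := (norm_mul_le _ _).trans
            (mul_le_mul (hQn t ht) (hΔ' t ht) (norm_nonneg _) hp0.le)
          exact (norm_sub_le _ _).trans (by linarith)) le_rfl ht.1 ht.2
    have hbound : (1 + p) * (M * (2 * p * δ) * M) ≤ adiabaticConst a ℓ M * δ :=
      le_trans (by apply le_of_eq; ring) hC2
    constructor
    · have e : (1 - Q t) * U t 0 * Q 0 = -((1 - Q t) * (Q t * U t 0 - U t 0 * Q 0)) := by
        have : (1 - Q t) * Q t = 0 := (hi t ht).one_sub_mul_self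
        rw [mul_sub, ← mul_assoc, this, zero_mul, zero_sub, neg_neg, mul_assoc]
      rw [e, norm_neg]
      exact (norm_mul_le _ _).trans ((mul_le_mul (hone _ (hQn t ht)) h3 (norm_nonneg _)
        (by positivity)).trans hbound)
    · have e : Q t * U t 0 * (1 - Q 0) = (Q t * U t 0 - U t 0 * Q 0) * (1 - Q 0) := by
        have : Q 0 * (1 - Q 0) = 0 := (hi 0 h0).mul_one_sub_self
        rw [sub_mul, mul_assoc (U t 0), this, mul_zero, sub_zero]
      rw [e]
      refine (norm_mul_le _ _).trans ((mul_le_mul h3 (hone _ (hQn 0 h0)) (norm_nonneg _)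
        (by positivity)).trans (le_of_eq_of_le ?_ hbound))
      ring

end Estimates

/-- With `N = ⌊1 / (κ ε)⌋` and `κ ≥ 3 θ` the bound `(θ ε)^N N!` is exponentially small. -/
theorem pow_mul_factorial_le_exp {θ κ ε : ℝ} (hθ : 0 < θ) (hκ : 3 * θ ≤ κ) (hε : 0 < ε) :
    (θ * ε) ^ ⌊1 / (κ * ε)⌋₊ * (⌊1 / (κ * ε)⌋₊.factorial : ℝ) ≤
      Real.exp 1 * Real.exp (-(1 / κ) / ε) := by
  have hκ0 : 0 < κ := by linarith
  set N := ⌊1 / (κ * ε)⌋₊ with hN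
  have h1 : (N : ℝ) ≤ 1 / (κ * ε) := Nat.floor_le (by positivity)
  have h2 : 1 / (κ * ε) < N + 1 := Nat.lt_floor_add_one _
  have h3 : (N.factorial : ℝ) ≤ (N : ℝ) ^ N := by exact_mod_cast Nat.factorial_le_pow N
  have h4 : θ * ε * N ≤ 1 / 3 := by
    calc θ * ε * N ≤ θ * ε * (1 / (κ * ε)) := by gcongr
      _ = θ / κ := by field_simp
      _ ≤ 1 / 3 := by rw [div_le_div_iff₀ hκ0 (by norm_num)]; linarith
  have h5 : (1 / 3 : ℝ) ≤ Real.exp (-1) := by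
    rw [Real.exp_neg, ← one_div]
    exact one_div_le_one_div_of_le (Real.exp_pos _) (by linarith [Real.exp_one_lt_d9])
  calc (θ * ε) ^ N * (N.factorial : ℝ) ≤ (θ * ε) ^ N * (N : ℝ) ^ N := by gcongr
    _ = (θ * ε * N) ^ N := (mul_pow _ _ _).symm
    _ ≤ Real.exp (-1) ^ N := pow_le_pow_left₀ (by positivity) (h4.trans h5) N
    _ = Real.exp (-N) := by rw [← Real.exp_nat_mul]; ring_nf
    _ ≤ Real.exp (1 + -(1 / κ) / ε) := by
      refine Real.exp_le_exp.2 ?_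
      have e : -(1 / κ) / ε = -(1 / (κ * ε)) := by field_simp
      rw [e]
      linarith
    _ = _ := Real.exp_add _ _

end

end Adiabatic

theorem theorem3p7 {X : Type*} [NormedAddCommGroup X] [NormedSpace ℂ X] [CompleteSpace X]
    (A : ℝ → X →ₗ.[ℂ] X) (σ : ℝ → Set ℂ) (P : ℝ → X →L[ℂ] X)
    (U : ℝ → ℝ → ℝ → X →L[ℂ] X) (r₀ : ℝ) (γ : ℝ → Adiabatic.Cycle) (J : ℝ → Set ℝ)
    (hU : EvolutionCondition A U) :
    -- finite degree of regularity `n`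
    (∀ n : ℕ, 1 ≤ n → HigherOrderCondition n A σ P r₀ γ J →
      ∃ ε₀ : ℝ, 0 < ε₀ ∧ ∃ C : ℝ, ∀ ε : ℝ, 0 < ε → ε ≤ ε₀ →
        IterWellDefined γ A ε n ∧
        (∀ t ∈ Icc (0 : ℝ) 1, ‖iterP γ A ε n t - P t‖ ≤ C * ε) ∧
        (∀ V : ℝ → ℝ → X →L[ℂ] X,
          IsEvolutionSystem
            (fun t => addBdd (((ε⁻¹ : ℝ) : ℂ) • iterA γ A ε n t) (iterK γ A ε n t)) V →
          IsAdiabatic V (iterP γ A ε n) ∧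
          ∀ t ∈ Icc (0 : ℝ) 1, ‖V t 0 - U ε t 0‖ ≤ C * ε ^ n) ∧
        (∀ t ∈ Icc (0 : ℝ) 1,
          ‖(1 - iterP γ A ε n t) * U ε t 0 * iterP γ A ε n 0‖ ≤ C * ε ^ n ∧
          ‖iterP γ A ε n t * U ε t 0 * (1 - iterP γ A ε n 0)‖ ≤ C * ε ^ n)) ∧
    -- infinite degree of regularity, with iteration depth `N(ε) = ⌊1 / (κ ε)⌋`
    (HigherOrderCondition ⊤ A σ P r₀ γ J →
      ∃ κ ε₀ g C : ℝ, 0 < κ ∧ 0 < ε₀ ∧ 0 < g ∧ ∃ N : ℝ → ℕ, (∀ ε : ℝ, N ε = ⌊1 / (κ * ε)⌋₊) ∧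
        ∀ ε : ℝ, 0 < ε → ε ≤ ε₀ →
        1 ≤ N ε ∧
        IterWellDefined γ A ε (N ε) ∧
        (∀ t ∈ Icc (0 : ℝ) 1, ‖iterP γ A ε (N ε) t - P t‖ ≤ C * ε) ∧
        (∀ V : ℝ → ℝ → X →L[ℂ] X,
          IsEvolutionSystem
            (fun t => addBdd (((ε⁻¹ : ℝ) : ℂ) • iterA γ A ε (N ε) t) (iterK γ A ε (N ε) t)) V →
          IsAdiabatic V (iterP γ A ε (N ε)) ∧
          ∀ t ∈ Icc (0 : ℝ) 1, ‖V t 0 - U ε t 0‖ ≤ C * Real.exp (-g / ε)) ∧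
        (∀ t ∈ Icc (0 : ℝ) 1,
          ‖(1 - iterP γ A ε (N ε) t) * U ε t 0 * iterP γ A ε (N ε) 0‖ ≤ C * Real.exp (-g / ε) ∧
          ‖iterP γ A ε (N ε) t * U ε t 0 * (1 - iterP γ A ε (N ε) 0)‖
            ≤ C * Real.exp (-g / ε))) := by
  obtain ⟨M, hM1, hM⟩ := hU.bounded
  have hM0 : 0 < M := by linarith
  constructor
  · intro n hn H
    obtain ⟨a, b, c, ℓ, ha, hb, hc, hℓ, hdata⟩ := H.exists_iterationData (by exact_mod_cast hn)
    set θ := growth a c ℓ with hθ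
    have hθ0 : 0 < θ := by rw [hθ, growth]; positivity
    have hn0 : (0 : ℝ) < n := by exact_mod_cast hn
    have hf0 : (0 : ℝ) < n.factorial := by exact_mod_cast n.factorial_pos
    set d := b * θ ^ n * n.factorial with hd
    have hd0 : 0 < d := by positivity
    set C₁ := 1152 * a ^ 2 * b * ℓ with hC₁
    have hC₁0 : 0 < C₁ := by positivity
    set C₂ := adiabaticConst a ℓ M with hC₂
    have hC₂0 : 0 < C₂ := by rw [hC₂, adiabaticConst]; positivity
    set s := 1 + 256 * a * b + 2 * θ * n + 2 * M * d with hs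
    have hs0 : 0 < s := by positivity
    refine ⟨1 / s, by positivity, C₁ + C₂ * d, fun ε hε hε0 => ?_⟩
    have hsε : s * ε ≤ 1 := by rwa [le_div_iff₀ hs0, mul_comm] at hε0
    have p1 : 0 < ε * (a * b) := by positivity
    have p2 : 0 < ε * (θ * n) := by positivity
    have p3 : 0 < ε * (M * d) := by positivity
    have hsε' : ε + 256 * (ε * (a * b)) + 2 * (ε * (θ * n)) + 2 * (ε * (M * d)) ≤ 1 :=
      le_of_eq_of_le (by rw [hs]; ring) hsε
    have hpow : ε ^ n ≤ ε := pow_le_of_le_one hε.le (by linarith) (by omega)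
    have h1 : M * (d * ε ^ n) ≤ 1 / 2 := by
      calc M * (d * ε ^ n) ≤ M * (d * ε) := by gcongr
        _ ≤ 1 / 2 := by linarith
    obtain ⟨r1, r2, r3, r4⟩ := (hdata n le_rfl).adiabatic hn ha hb hc hℓ hε (by linarith)
      (by linarith) hU.dense (hU.evolution ε hε) (hM ε hε) (δ := d * ε ^ n)
      (by rw [mul_pow, hd]; apply le_of_eq; ring) h1
    have hC : C₂ * (d * ε ^ n) ≤ (C₁ + C₂ * d) * ε ^ n := by
      have : 0 ≤ C₁ * ε ^ n := by positivity
      linarith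
    refine ⟨r1, fun t ht => (r2 t ht).trans ?_, fun V hV => ⟨(r3 V hV).1, fun t ht =>
      ((r3 V hV).2 t ht).trans hC⟩, fun t ht => ⟨(r4 t ht).1.trans hC, (r4 t ht).2.trans hC⟩⟩
    have : 0 ≤ C₂ * d * ε := by positivity
    linarith
  · intro H
    obtain ⟨a, b, c, ℓ, ha, hb, hc, hℓ, hdata⟩ := H.exists_iterationData le_top
    set θ := growth a c ℓ with hθ
    have hθ0 : 0 < θ := by rw [hθ, growth]; positivity
    set C₁ := 1152 * a ^ 2 * b * ℓ with hC₁
    have hC₁0 : 0 < C₁ := by positivity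
    set C₂ := adiabaticConst a ℓ M with hC₂
    have hC₂0 : 0 < C₂ := by rw [hC₂, adiabaticConst]; positivity
    -- `κ` is so large that both `θ ε N(ε)` and the difference of the generators are small
    set κ := θ * (3 + 2 * M * b) with hκ
    have hκ0 : 0 < κ := by positivity
    set s := κ + 256 * a * b with hs
    have hs0 : 0 < s := by positivity
    refine ⟨κ, 1 / s, 1 / κ, C₁ + C₂ * (b * Real.exp 1), hκ0, by positivity, by positivity,
      fun ε => ⌊1 / (κ * ε)⌋₊, fun _ => rfl, fun ε hε hε0 => ?_⟩
    have hsε : s * ε ≤ 1 := by rwa [le_div_iff₀ hs0, mul_comm] at hε0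
    have p1 : 0 < ε * (a * b) := by positivity
    have p2 : 0 < κ * ε := by positivity
    have hsε' : κ * ε + 256 * (ε * (a * b)) ≤ 1 := le_of_eq_of_le (by rw [hs]; ring) hsε
    have hexp := pow_mul_factorial_le_exp (κ := κ) hθ0
      (by rw [hκ]; nlinarith [mul_pos hθ0 (mul_pos hM0 hb)]) hε
    have hN1 : 1 ≤ ⌊1 / (κ * ε)⌋₊ := by
      rw [Nat.one_le_floor_iff, le_div_iff₀ p2]
      linarith
    have hN2 : (⌊1 / (κ * ε)⌋₊ : ℝ) ≤ 1 / (κ * ε) := Nat.floor_le (by positivity)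
    simp only
    generalize ⌊1 / (κ * ε)⌋₊ = N at *
    have hx : θ * ε * N * (3 + 2 * M * b) ≤ 1 := by
      rw [le_div_iff₀ p2] at hN2
      calc _ = N * (κ * ε) := by rw [hκ]; ring
        _ ≤ 1 := hN2
    have hx0 : 0 ≤ θ * ε * N := by positivity
    have hxMb : 0 ≤ θ * ε * N * (M * b) := by positivity
    have hx1 : (θ * ε) ^ N * (N.factorial : ℝ) ≤ θ * ε * N := by
      calc (θ * ε) ^ N * (N.factorial : ℝ) ≤ (θ * ε) ^ N * (N : ℝ) ^ N := by
            gcongr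
            exact_mod_cast Nat.factorial_le_pow N
        _ = (θ * ε * N) ^ N := (mul_pow _ _ _).symm
        _ ≤ θ * ε * N := pow_le_of_le_one hx0 (by linarith) (by omega)
    have h1 : M * (b * (θ * ε) ^ N * N.factorial) ≤ 1 / 2 := by
      calc M * (b * (θ * ε) ^ N * N.factorial) = M * b * ((θ * ε) ^ N * N.factorial) := by ring
        _ ≤ M * b * (θ * ε * N) := by gcongr
        _ ≤ 1 / 2 := by linarith
    obtain ⟨r1, r2, r3, r4⟩ := (hdata N le_top).adiabatic hN1 ha hb hc hℓ hε (by linarith)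
      (by linarith) hU.dense (hU.evolution ε hε) (hM ε hε) le_rfl h1
    have hC : C₂ * (b * (θ * ε) ^ N * N.factorial) ≤
        (C₁ + C₂ * (b * Real.exp 1)) * Real.exp (-(1 / κ) / ε) := by
      have h2 : 0 ≤ C₁ * Real.exp (-(1 / κ) / ε) := by positivity
      have h3 := mul_le_mul_of_nonneg_left hexp (mul_pos hC₂0 hb).le
      linarith
    refine ⟨hN1, r1, fun t ht => (r2 t ht).trans ?_, fun V hV => ⟨(r3 V hV).1, fun t ht =>
      ((r3 V hV).2 t ht).trans hC⟩, fun t ht => ⟨(r4 t ht).1.trans hC, (r4 t ht).2.trans hC⟩⟩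
    have : 0 ≤ C₂ * (b * Real.exp 1) * ε := by positivity
    linarith
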